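/- **Notation.** Fix an integer $I\ge 1$ and real $q,\alpha$ such that either $0<q<1$ and $\alpha<-q^{-2I+1}$, or $q>1$ and $-q^{-2I+1}<\alpha<0$. For $n\in\mathbb Z$ let $(b;q)_n=\prod_{k=0}^{n-1}(1-bq^k)$ if $n\ge 0$ and $(b;q)_n=\prod_{k=0}^{-n-1}(1-bq^{n+k})^{-1}$ if $n<0$. Let $(b;q)_\infty=\prod_{k\ge 0}(1-bq^k)$ if $q<1$ and $(b;q)_\infty=1/(bq^{-1};q^{-1})_\infty$ if $q>1$. **Vertex weights.** Put $J=I$ and $\nu=q^{-I}$. For $i_1,i_2\in\{0,\dots,I\}$ and $j_1,j_2\in\{0,\dots,J\}$ let $$\mathsf L(i_1,j_1;i_2,j_2)=\mathbf 1_{\{i_1+j_1=i_2+j_2\}}\,q^{\frac{2j_1-j_1^2}{4}-\frac{2j_2-j_2^2}{4}+\frac{i_2^2+i_1^2}{4}+\frac{i_2(j_2-1)+i_1j_1}{2}}\,\frac{\nu^{j_1-i_2}\alpha^{j_2-j_1+i_2}(-\alpha\nu^{-1};q)_{j_2-i_1}}{(q;q)_{i_2}(-\alpha;q)_{i_2+j_2}(q^{J+1-j_1};q)_{j_1-j_2}}\;\overline\Phi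 ,$$ $$\overline\Phi=\sum_{k=0}^{i_2}q^k\frac{(q^{-i_2};q)_k}{(q;q)_k}\prod_{l=1}^{3}(a_l;q)_k\,(b_lq^k;q)_{i_2-k},$$ with $(a_1,a_2,a_3)=(q^{-i_1},-\alpha q^J,-q\nu\alpha^{-1})$ and $(b_1,b_2,b_3)=(\nu,q^{1+j_2-i_1},q^{J+1-i_2-j_2})$. In the given range of parameters this is a stochastic matrix. **The model.** Let $\mathcal G=\{0,\dots,I\}^{\mathbb Z}$ with the product topology and its Borel $\sigma$-algebra. The stochastic higher spin six vertex (SHS6V) model is the discrete-time Markov chain $(g_t)_{t\ge0}$ on $\mathcal G$ with the following step. From a configuration $g$ with finitely many particles, the sites are updated sequentially from left to right: with $h(x)$ the number of particles that enter $x$ from the left ($h(x)=0$ at the leftmost particle and to its left), the pair $(g'(x),h(x+1))$ is chosen with probability $\mathsf L(g(x),h(x);g'(x),h(x+1))$, and $g'$ is the new configuration. From an arbitrary $g\in\mathcal G$, the law of the new configuration is the weak limit, as $N\to\infty$, of the laws obtained from the finite configurations $g\mathbf 1_{[-N,N]}$. With $(\tau_ng)(i)=g(i+n)$, the shifted SHS6V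 model is $g'_t=\tau_t(g_t)$. Let $\mathfrak I^{\mathrm{HS}}$ be the set of its stationary distributions, that is, of the probability measures $\mu$ on $\mathcal G$ such that $g_0\sim\mu$ implies $\tau_t(g_t)\sim\mu$ for all $t\ge 0$. **The measures.** For $p\le 0$ let $q\mathrm{NB}(q^{-I},p)$ be the probability distribution on $\{0,\dots,I\}$ with $\mathbb P(X=n)=p^n\frac{(q^{-I};q)_n\,(p;q)_\infty}{(q;q)_n\,(pq^{-I};q)_\infty}$. For $\rho\in[0,1]$ let $\mu^{\mathrm{HS}}_\rho=\bigotimes_{x\in\mathbb Z}q\mathrm{NB}\big(q^{-I},\frac{-q^I\rho}{1-\rho}\big)$, where for $\rho=1$ the factor means the point mass at $I$. Let $\mu^{\mathrm{HS}}_*=\bigotimes_{k\in\mathbb Z}q\mathrm{NB}(q^{-I},-q^{-kI+1})$. For $n\in\mathbb Z$ let $$G_n=\Big\{g\in\mathcal G:\ n+\sum_{i\le 0}(I-g(i))=\sum_{i\ge 1}g(i)<\infty\Big\}\quad\text{if } q>1,$$ $$G_n=\Big\{g\in\mathcal G:\ n+\sum_{i\le 0}g(i)=\sum_{i\ge 1}(I-g(i))<\infty\Big\}\quad\text{if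 } q<1,$$ and let $\mu^{\mathrm{HS}}_{(n)}$ be $\mu^{\mathrm{HS}}_*$ conditioned on $G_n$, i.e. $\mu^{\mathrm{HS}}_{(n)}(B)=\mu^{\mathrm{HS}}_*(B\cap G_n)/\mu^{\mathrm{HS}}_*(G_n)$. **Theorem.** The set $\mathfrak I^{\mathrm{HS}}$ contains the closed convex hull, for the topology of weak convergence, of $\{\mu^{\mathrm{HS}}_\rho\}_{\rho\in[0,1]}\cup\{\mu^{\mathrm{HS}}_{(n)}\}_{n\in\mathbb Z}$. In particular $\mu^{\mathrm{HS}}_*(G_n)>0$, so that $\mu^{\mathrm{HS}}_{(n)}$ is a probability measure, for every $n$. -/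

import Mathlib

open MeasureTheory ProbabilityTheory Filter Topology
open scoped NNReal ENNReal BoundedContinuousFunction

noncomputable section

namespace SHS6V

/-! ### `q`-series -/

/-- The `q`-Pochhammer symbol `(b; q)_n` with an integer index `n`. -/
def qPoch (b q : ℝ) (n : ℤ) : ℝ :=
  if 0 ≤ n then ∏ k ∈ Finset.range n.toNat, (1 - b * q ^ k)
  else ∏ k ∈ Finset.range (-n).toNat, (1 - b * q ^ (n + (k : ℤ)))⁻¹

/-- The infinite `q`-Pochhammer symbol `(b; q)_∞`. For `0 < q < 1` it is the convergent product
`∏_{k ≥ 0} (1 - b q ^ k)`. For `q > 1` that product diverges, and the symbol has its usual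
meaning `1 / (b q⁻¹; q⁻¹)_∞`, which preserves `(b; q)_∞ = (b; q)_n * (b q ^ n; q)_∞`. -/
def qPochInf (b q : ℝ) : ℝ :=
  if q < 1 then ∏' k : ℕ, (1 - b * q ^ k)
  else (∏' k : ℕ, (1 - b * q⁻¹ * q⁻¹ ^ k))⁻¹

/-- The regularized terminating basic hypergeometric series `_{r+1} φ̄_r` with upper parameters
`q ^ (-n), a_1, …, a_r` and lower parameters `b_1, …, b_r`. -/
def regPhi {r : ℕ} (n : ℕ) (a b : Fin r → ℝ) (q z : ℝ) : ℝ :=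
  ∑ k ∈ Finset.range (n + 1), z ^ k * (qPoch (q ^ (-(n : ℤ))) q k / qPoch q q k) *
    ∏ i, (qPoch (a i) q k * qPoch (b i * q ^ k) q ((n : ℤ) - k))

/-! ### The vertex weights -/

/-- The vertex weight `L_α^{I,J}(i₁, j₁; i₂, j₂)`: `i₁` lines enter from below, `j₁` from the left,
`i₂` leave upwards and `j₂` leave to the right. -/
def L (I J : ℕ) (q α : ℝ) (i₁ : Fin (I + 1)) (j₁ : Fin (J + 1)) (i₂ : Fin (I + 1))
    (j₂ : Fin (J + 1)) : ℝ :=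
  if (i₁ : ℕ) + j₁ = i₂ + j₂ then
    q ^ ((2 * (j₁ : ℝ) - (j₁ : ℝ) ^ 2) / 4 - (2 * (j₂ : ℝ) - (j₂ : ℝ) ^ 2) / 4
        + ((i₂ : ℝ) ^ 2 + (i₁ : ℝ) ^ 2) / 4
        + ((i₂ : ℝ) * ((j₂ : ℝ) - 1) + (i₁ : ℝ) * (j₁ : ℝ)) / 2 : ℝ)
      * ((q ^ (-(I : ℤ))) ^ ((j₁ : ℤ) - (i₂ : ℤ)) * α ^ ((j₂ : ℤ) - (j₁ : ℤ) + (i₂ : ℤ))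
          * qPoch (-α * (q ^ (-(I : ℤ)))⁻¹) q ((j₂ : ℤ) - (i₁ : ℤ))
        / (qPoch q q (i₂ : ℤ) * qPoch (-α) q ((i₂ : ℤ) + (j₂ : ℤ))
          * qPoch (q ^ ((J : ℤ) + 1 - (j₁ : ℤ))) q ((j₁ : ℤ) - (j₂ : ℤ))))
      * regPhi (i₂ : ℕ)
          ![q ^ (-((i₁ : ℕ) : ℤ)), -α * q ^ J, -q * q ^ (-(I : ℤ)) * α⁻¹]
          ![q ^ (-(I : ℤ)), q ^ (1 + (j₂ : ℤ) - (i₁ : ℤ)),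
            q ^ ((J : ℤ) + 1 - (i₂ : ℤ) - (j₂ : ℤ))] q q
  else 0

/-- The range of parameters in which the weights `L_α^{I,J}` form a stochastic matrix. -/
def Admissible (I J : ℕ) (q α : ℝ) : Prop :=
  (0 < q ∧ q < 1 ∧ α < -q ^ (-(I : ℤ) - J + 1)) ∨
    (1 < q ∧ -q ^ (-(I : ℤ) - J + 1) < α ∧ α < 0)

lemma Admissible.pos {I J : ℕ} {q α : ℝ} (h : Admissible I J q α) : 0 < q := by
  rcases h with h | h
  · exact h.1
  · linarith [h.1]

lemma Admissible.ne_one {I J : ℕ} {q α : ℝ} (h : Admissible I J q α) : q ≠ 1 := by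
  rcases h with h | h
  · exact h.2.1.ne
  · exact h.1.ne'

/-! ### The dynamics -/

/-- Particle configurations on `ℤ` with at most `I` particles per site, with the product of the
discrete topologies and its Borel `σ`-algebra. -/
abbrev Config (I : ℕ) : Type := ℤ → Fin (I + 1)

/-- The shift `(τ_n g)(i) = g(i + n)`. -/
def shift {I : ℕ} (n : ℤ) (g : Config I) : Config I := fun i => g (i + n)

/-- The law of the configuration after one step of the model started from the finite
configuration `g`. A realization of the step consists of the new configuration `g'` and of the
numbers `h x` of particles that cross from `x - 1` to `x`. The sites are updated from left to right,
starting with no crossing particle, so that the realization has probability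
`∏_x L(g x, h x; g' x, h (x + 1))`. Only finitely many factors differ from
`L(0, 0; 0, 0) = 1`. -/
def finStep (I J : ℕ) (q α : ℝ) (g : ℤ →₀ Fin (I + 1)) : Measure (Config I) :=
  Measure.sum fun r : (ℤ →₀ Fin (I + 1)) × (ℤ →₀ Fin (J + 1)) =>
    ENNReal.ofReal (∏ᶠ x : ℤ, L I J q α (g x) (r.2 x) (r.1 x) (r.2 (x + 1))) •
      Measure.dirac (r.1 : Config I)

/-- The finite configuration obtained from `g` by deleting all particles outside `[-N, N]`. -/
def trunc {I : ℕ} (g : Config I) (N : ℕ) : ℤ →₀ Fin (I + 1) :=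
  Finsupp.indicator (Finset.Icc (-(N : ℤ)) N) fun x _ => g x

/-- `ν` is the law after one step from the (possibly infinite) configuration `g`: the weak limit of
the laws of the steps from the finite truncations of `g`. -/
def IsStepLaw (I J : ℕ) (q α : ℝ) (g : Config I) (ν : ProbabilityMeasure (Config I)) : Prop :=
  ∀ f : Config I →ᵇ ℝ,
    Tendsto (fun N : ℕ => ∫ g', f g' ∂(finStep I J q α (trunc g N))) atTop
      (𝓝 (∫ g', f g' ∂(ν : Measure (Config I))))

open Classical in
/-- The one-step transition law of the model from an arbitrary configuration. The limit
is unique; the value `0` in the absence of a limit is only a default, and a measure whose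
evolution met it would lose mass. -/
def stepLaw (I J : ℕ) (q α : ℝ) (g : Config I) : Measure (Config I) :=
  if h : ∃ ν : ProbabilityMeasure (Config I), IsStepLaw I J q α g ν then
    (h.choose : Measure (Config I))
  else 0

/-- The law at time `1` of the model with initial law `μ`. -/
def evolve (I J : ℕ) (q α : ℝ) (μ : Measure (Config I)) : Measure (Config I) :=
  μ.bind (stepLaw I J q α)

/-- The stationary distributions of the shifted model `g'_t = τ_t (g_t)`: the probability measures
`μ` such that `g_0 ∼ μ` implies `τ_t (g_t) ∼ μ` for all times `t`. -/
def shiftedStationary (I J : ℕ) (q α : ℝ) : Set (FiniteMeasure (Config I)) :=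
  {μ | IsProbabilityMeasure (μ : Measure (Config I)) ∧
    ∀ t : ℕ, ((evolve I J q α)^[t] (μ : Measure (Config I))).map (shift (t : ℤ)) =
      (μ : Measure (Config I))}

/-! ### The `q`-negative binomial distribution -/

/-- The weight at `n` of the `q`-negative binomial distribution `qNB(b, p)`. -/
def qNBWeight (q b p : ℝ) (n : ℕ) : ℝ :=
  p ^ n * (qPoch b q n * qPochInf p q / (qPoch q q n * qPochInf (p * b) q))


lemma qPoch_natCast (b q : ℝ) (n : ℕ) :
    qPoch b q (n : ℤ) = ∏ k ∈ Finset.range n, (1 - b * q ^ k) := by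
  simp [qPoch]

lemma prod_ratio {p r : ℝ} (hp : p ≤ 0) (hr0 : 0 < r) (hr1 : r < 1) (K : ℕ) :
    (∏' k : ℕ, (1 - p * r ^ k)) =
      (∏ k ∈ Finset.range K, (1 - p * r ^ k)) * ∏' k : ℕ, (1 - p * r ^ K * r ^ k) ∧
    0 < ∏' k : ℕ, (1 - p * r ^ k) := by
  have hm : Multipliable fun k : ℕ => (1 - p * r ^ k) := by
    have := Real.multipliable_one_add_of_summable
      (f := fun k : ℕ => -p * r ^ k) ((summable_geometric_of_lt_one hr0.le hr1).mul_left _)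
    simpa [sub_eq_add_neg] using this
  have h1 : ∀ k : ℕ, 1 ≤ 1 - p * r ^ k := fun k => by
    nlinarith [mul_nonneg (neg_nonneg.2 hp) (pow_pos hr0 k).le]
  have hm' : Multipliable fun k : ℕ => (1 - p * r ^ K * r ^ k) := by
    have := Real.multipliable_one_add_of_summable
      (f := fun k : ℕ => -p * r ^ K * r ^ k) ((summable_geometric_of_lt_one hr0.le hr1).mul_left _)
    simpa [sub_eq_add_neg] using this
  constructor
  · have hA := hm.hasProd.tendsto_prod_nat
    have hB := (hm'.hasProd.tendsto_prod_nat).const_mul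
      (∏ k ∈ Finset.range K, (1 - p * r ^ k))
    have hC := (tendsto_add_atTop_iff_nat K).2 hA
    refine tendsto_nhds_unique hC (hB.congr fun n => ?_)
    rw [add_comm n K, Finset.prod_range_add]
    congr 1
    exact Finset.prod_congr rfl fun k _ => by rw [pow_add]; ring
  · refine lt_of_lt_of_le one_pos (ge_of_tendsto' hm.hasProd.tendsto_prod_nat fun n => ?_)
    exact Finset.one_le_prod fun k _ => h1 k

lemma qPochInf_ratio {q p : ℝ} (hq : 0 < q) (hq1 : q ≠ 1) (hp : p ≤ 0) (K : ℕ) :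
    qPochInf p q / qPochInf (p * q ^ (-(K : ℤ))) q =
      (∏ k ∈ Finset.range K, (1 - p * q ^ (-(K : ℤ)) * q ^ k))⁻¹ := by
  have hb : p * q ^ (-(K : ℤ)) ≤ 0 := mul_nonpos_of_nonpos_of_nonneg hp (by positivity)
  have hqK : q ^ (-(K : ℤ)) * q ^ K = 1 := by
    rw [zpow_neg, zpow_natCast]; exact inv_mul_cancel₀ (by positivity)
  unfold qPochInf
  rcases lt_or_gt_of_ne hq1 with h | h
  · rw [if_pos h, if_pos h]
    obtain ⟨e, -⟩ := prod_ratio hb hq h K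
    have hpos := (prod_ratio hp hq h 0).2
    rw [e, mul_assoc p, hqK, mul_one]
    field_simp
  · rw [if_neg h.not_gt, if_neg h.not_gt]
    have hr0 : 0 < q⁻¹ := by positivity
    have hr1 : q⁻¹ < 1 := inv_lt_one_of_one_lt₀ h
    have hp' : p * q⁻¹ ≤ 0 := mul_nonpos_of_nonpos_of_nonneg hp hr0.le
    obtain ⟨e, hpos⟩ := prod_ratio hp' hr0 hr1 K
    have hb' : p * q⁻¹ * q⁻¹ ^ K ≤ 0 := mul_nonpos_of_nonpos_of_nonneg hp' (by positivity)
    have hpos' := (prod_ratio hb' hr0 hr1 0).2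
    have e1 : p * q ^ (-(K : ℤ)) * q⁻¹ = p * q⁻¹ * q⁻¹ ^ K := by
      rw [zpow_neg, zpow_natCast, inv_pow]; ring
    have e2 : ∏ k ∈ Finset.range K, (1 - p * q ^ (-(K : ℤ)) * q ^ k) =
        ∏ k ∈ Finset.range K, (1 - p * q⁻¹ * q⁻¹ ^ k) := by
      rw [← Finset.prod_range_reflect]
      refine Finset.prod_congr rfl fun k hk => ?_
      have hk' : k + 1 ≤ K := Finset.mem_range.1 hk
      have : q ^ (-(K : ℤ)) * q ^ (K - 1 - k) = q⁻¹ * q⁻¹ ^ k := by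
        rw [← zpow_natCast q (K - 1 - k), ← zpow_add₀ hq.ne', ← pow_succ', inv_pow,
          ← zpow_natCast, ← zpow_neg]
        congr 1
        omega
      rw [mul_assoc, this]; ring
    rw [e1, e2, e, div_eq_mul_inv, inv_inv, mul_inv, mul_assoc, inv_mul_cancel₀ hpos'.ne', mul_one]

/-- A finite form of the `q`-binomial theorem. -/
lemma sum_qbinom {q : ℝ} (hq : 0 < q) (hq1 : q ≠ 1) (p : ℝ) (K : ℕ) :
    ∑ n ∈ Finset.range (K + 1), p ^ n * (qPoch (q ^ (-(K : ℤ))) q n / qPoch q q n) =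
      ∏ k ∈ Finset.range K, (1 - p * q ^ (-(K : ℤ)) * q ^ k) := by
  have hne : ∀ n : ℕ, 1 - q ^ (n + 1) ≠ 0 := fun n h0 =>
    hq1 ((pow_eq_one_iff_of_nonneg hq.le (Nat.succ_ne_zero n)).1 (sub_eq_zero.1 h0).symm)
  have hQ : ∀ n : ℕ, ∏ k ∈ Finset.range n, (1 - q * q ^ k) ≠ 0 := fun n =>
    Finset.prod_ne_zero_iff.2 fun k _ => by rw [← pow_succ']; exact hne k
  simp only [qPoch_natCast]
  induction K with
  | zero => simp
  | succ K ih =>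
    have ha : q ^ (-((K + 1 : ℕ) : ℤ)) = q ^ (-(K : ℤ)) / q := by
      rw [div_eq_mul_inv, ← zpow_sub_one₀ hq.ne']; congr 1; push_cast; ring
    have hz : ∏ k ∈ Finset.range (K + 1), (1 - q ^ (-(K : ℤ)) * q ^ k) = 0 :=
      Finset.prod_eq_zero (Finset.self_mem_range_succ K) (by
        rw [zpow_neg, zpow_natCast, inv_mul_cancel₀ (by positivity), sub_self])
    rw [ha]
    set a := q ^ (-(K : ℤ)) with hadef
    have hrec : ∀ n : ℕ, (∏ k ∈ Finset.range (n + 1), (1 - a / q * q ^ k)) /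
          (∏ k ∈ Finset.range (n + 1), (1 - q * q ^ k)) =
        (∏ k ∈ Finset.range (n + 1), (1 - a * q ^ k)) /
          (∏ k ∈ Finset.range (n + 1), (1 - q * q ^ k)) -
        a / q * ((∏ k ∈ Finset.range n, (1 - a * q ^ k)) /
          (∏ k ∈ Finset.range n, (1 - q * q ^ k))) := by
      intro n
      have e : ∏ k ∈ Finset.range (n + 1), (1 - a / q * q ^ k) =
          (∏ k ∈ Finset.range n, (1 - a * q ^ k)) * (1 - a / q) := by
        rw [Finset.prod_range_succ', pow_zero, mul_one]
        congr 1
        refine Finset.prod_congr rfl fun k _ => ?_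
        field_simp
        ring
      rw [e, Finset.prod_range_succ (fun k => 1 - a * q ^ k),
        Finset.prod_range_succ (fun k => 1 - q * q ^ k)]
      have h1 := hQ n
      have h2 : 1 - q * q ^ n ≠ 0 := by rw [← pow_succ']; exact hne n
      generalize ∏ k ∈ Finset.range n, (1 - a * q ^ k) = A
      generalize ∏ k ∈ Finset.range n, (1 - q * q ^ k) = B at h1
      field_simp
      ring
    have eP : ∏ k ∈ Finset.range (K + 1), (1 - p * (a / q) * q ^ k) =
        (∏ k ∈ Finset.range K, (1 - p * a * q ^ k)) * (1 - p * (a / q)) := by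
      rw [Finset.prod_range_succ', pow_zero, mul_one]
      congr 1
      refine Finset.prod_congr rfl fun k _ => ?_
      field_simp
      ring
    have eS : ∑ n ∈ Finset.range (K + 1), p ^ (n + 1) *
          ((∏ k ∈ Finset.range (n + 1), (1 - a * q ^ k)) /
            (∏ k ∈ Finset.range (n + 1), (1 - q * q ^ k))) + 1 =
        ∏ k ∈ Finset.range K, (1 - p * a * q ^ k) := by
      rw [← ih, Finset.sum_range_succ, hz, zero_div, mul_zero, add_zero, Finset.sum_range_succ'
        (fun n => p ^ n * ((∏ k ∈ Finset.range n, (1 - a * q ^ k)) /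
          (∏ k ∈ Finset.range n, (1 - q * q ^ k))))]
      simp
    rw [eP, Finset.sum_range_succ']
    simp only [hrec, mul_sub, Finset.sum_sub_distrib, Finset.range_zero, Finset.prod_empty,
      pow_zero, div_one, mul_one]
    have eT : ∑ n ∈ Finset.range (K + 1), p ^ (n + 1) * (a / q *
          ((∏ k ∈ Finset.range n, (1 - a * q ^ k)) / (∏ k ∈ Finset.range n, (1 - q * q ^ k)))) =
        p * (a / q) * ∏ k ∈ Finset.range K, (1 - p * a * q ^ k) := by
      rw [← ih, Finset.mul_sum]
      exact Finset.sum_congr rfl fun n _ => by ring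
    rw [eT]
    linear_combination eS

lemma qNB_term_nonneg {q p : ℝ} (hq : 0 < q) (hq1 : q ≠ 1) (hp : p ≤ 0) {K n : ℕ} (hn : n ≤ K) :
    0 ≤ p ^ n * (qPoch (q ^ (-(K : ℤ))) q n / qPoch q q n) := by
  rw [qPoch_natCast, qPoch_natCast, ← Finset.prod_div_distrib, ← Finset.card_range n,
    ← Finset.prod_const, Finset.card_range, ← Finset.prod_mul_distrib]
  refine Finset.prod_nonneg fun k hk => mul_nonneg_of_nonpos_of_nonpos hp ?_
  have hk' : k < n := Finset.mem_range.1 hk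
  have e : q ^ (-(K : ℤ)) * q ^ k = q⁻¹ ^ (K - k) := by
    rw [← zpow_natCast q k, ← zpow_add₀ hq.ne', inv_pow, ← zpow_natCast, ← zpow_neg]
    congr 1
    omega
  rw [e, ← pow_succ']
  rcases lt_or_gt_of_ne hq1 with h | h
  · refine div_nonpos_of_nonpos_of_nonneg ?_ ?_
    · linarith [one_le_pow₀ (n := K - k) ((one_le_inv₀ hq).2 h.le)]
    · linarith [pow_le_one₀ (n := k + 1) hq.le h.le]
  · refine div_nonpos_of_nonneg_of_nonpos ?_ ?_
    · linarith [pow_le_one₀ (n := K - k) (inv_pos.2 hq).le (inv_le_one_of_one_le₀ h.le)]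
    · linarith [one_le_pow₀ (n := k + 1) h.le]

lemma qNBWeight_eq {q p : ℝ} (hq : 0 < q) (hq1 : q ≠ 1) (hp : p ≤ 0) (K n : ℕ) :
    qNBWeight q (q ^ (-(K : ℤ))) p n =
      p ^ n * (qPoch (q ^ (-(K : ℤ))) q n / qPoch q q n) *
        (∏ k ∈ Finset.range K, (1 - p * q ^ (-(K : ℤ)) * q ^ k))⁻¹ := by
  rw [← qPochInf_ratio hq hq1 hp, qNBWeight, mul_div_mul_comm, mul_assoc]

lemma prod_pos' {q p : ℝ} (hq : 0 < q) (hp : p ≤ 0) (K : ℕ) :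
    0 < ∏ k ∈ Finset.range K, (1 - p * q ^ (-(K : ℤ)) * q ^ k) := by
  refine Finset.prod_pos fun k _ => ?_
  have : 0 ≤ -p * (q ^ (-(K : ℤ)) * q ^ k) := mul_nonneg (neg_nonneg.2 hp) (by positivity)
  nlinarith

lemma sum_qNBWeight {q p : ℝ} (hq : 0 < q) (hq1 : q ≠ 1) (hp : p ≤ 0) (K : ℕ) :
    ∑ n : Fin (K + 1), ENNReal.ofReal (qNBWeight q (q ^ (-(K : ℤ))) p n) = 1 := by
  have hpos := prod_pos' hq hp K
  rw [← ENNReal.ofReal_sum_of_nonneg, Fin.sum_univ_eq_sum_range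
    (fun n => qNBWeight q (q ^ (-(K : ℤ))) p n)]
  · simp_rw [qNBWeight_eq hq hq1 hp]
    rw [← Finset.sum_mul, sum_qbinom hq hq1, mul_inv_cancel₀ hpos.ne', ENNReal.ofReal_one]
  · intro n _
    rw [qNBWeight_eq hq hq1 hp]
    exact mul_nonneg (qNB_term_nonneg hq hq1 hp (Nat.lt_succ_iff.1 n.2)) (inv_pos.2 hpos).le

/-- The `q`-negative binomial distribution `qNB(q ^ (-I), p)`, `p ≤ 0`, which lives on
`{0, …, I}`. -/
def qNB (I : ℕ) {q : ℝ} (hq : 0 < q) (hq1 : q ≠ 1) (p : ℝ) (hp : p ≤ 0) : PMF (Fin (I + 1)) :=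
  PMF.ofFintype (fun n => ENNReal.ofReal (qNBWeight q (q ^ (-(I : ℤ))) p n))
    (sum_qNBWeight hq hq1 hp I)

/-! ### The product measures and the blocking measures -/

open Classical in
/-- The one-site marginal of `μ_ρ`: the law `qNB(q ^ (-I), -q ^ I ρ / (1 - ρ))`, which for `ρ = 1`
means its limit as `ρ → 1`, the point mass at `I`. -/
def densityLaw (I : ℕ) {q : ℝ} (hq : 0 < q) (hq1 : q ≠ 1) (ρ : Set.Icc (0 : ℝ) 1) :
    PMF (Fin (I + 1)) :=
  if (ρ : ℝ) = 1 then PMF.pure (Fin.last I)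
  else qNB I hq hq1 (-q ^ I * ρ / (1 - ρ))
    (div_nonpos_of_nonpos_of_nonneg
      (mul_nonpos_of_nonpos_of_nonneg (neg_nonpos.2 (pow_pos hq I).le) ρ.2.1)
      (sub_nonneg.2 ρ.2.2))

/-- The homogeneous product measure `μ_ρ`. -/
def muRho (I : ℕ) {q : ℝ} (hq : 0 < q) (hq1 : q ≠ 1) (ρ : Set.Icc (0 : ℝ) 1) :
    FiniteMeasure (Config I) :=
  ⟨Measure.infinitePi fun _ : ℤ => (densityLaw I hq hq1 ρ).toMeasure, inferInstance⟩

/-- The inhomogeneous product measure `μ_* = ⨂_k qNB(q ^ (-I), -q ^ (-k I + 1))`. -/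
def muStar (I : ℕ) {q : ℝ} (hq : 0 < q) (hq1 : q ≠ 1) : Measure (Config I) :=
  Measure.infinitePi fun k : ℤ =>
    (qNB I hq hq1 (-q ^ (-k * I + 1)) (neg_nonpos.2 (zpow_pos hq _).le)).toMeasure

/-- The class `G_n`. For `q > 1` it consists of the configurations with
`n + ∑_{i ≤ 0} (I - g i) = ∑_{i ≥ 1} g i < ∞`; for `q < 1` the roles of particles and holes are
exchanged. -/
def blockingClass (I : ℕ) (q : ℝ) (n : ℤ) : Set (Config I) :=
  {g | if 1 < q then
      Summable (fun k : ℕ => (I : ℝ) - (g (-(k : ℤ)) : ℕ)) ∧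
      Summable (fun k : ℕ => ((g ((k : ℤ) + 1) : ℕ) : ℝ)) ∧
      (n : ℝ) + ∑' k : ℕ, ((I : ℝ) - (g (-(k : ℤ)) : ℕ)) =
        ∑' k : ℕ, ((g ((k : ℤ) + 1) : ℕ) : ℝ)
    else
      Summable (fun k : ℕ => ((g (-(k : ℤ)) : ℕ) : ℝ)) ∧
      Summable (fun k : ℕ => (I : ℝ) - (g ((k : ℤ) + 1) : ℕ)) ∧
      (n : ℝ) + ∑' k : ℕ, ((g (-(k : ℤ)) : ℕ) : ℝ) =
        ∑' k : ℕ, ((I : ℝ) - (g ((k : ℤ) + 1) : ℕ))}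

/-- The blocking measure `μ_(n)`: the measure `μ_*` conditioned on the class `G_n`. -/
def muBlock (I : ℕ) {q : ℝ} (hq : 0 < q) (hq1 : q ≠ 1) (n : ℤ) : FiniteMeasure (Config I) :=
  ⟨(muStar I hq hq1)[|blockingClass I q n], inferInstance⟩

end SHS6V

end

/-! The theorem rests on an algebraic fact about one vertex, a mixing estimate that carries it to
the infinite lattice, and a conservation law.

Algebra. The index `k` of the `₄φ̄₃` series counts the vertical lines that stay vertical. Together
with the four boundary values it determines a 2 × 2 contingency table `(k, a, l, b)` with row sums
`i₁, j₁` and column sums `i₂, j₂`. After reflection of the Pochhammer symbols, each term of the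
series becomes an explicit product, `tableWeight`, which is positive on the tables with `a + l + b ≤
J` and `k + l ≤ I` and vanishes on the other relevant ones. Sums over tables are then nested
`q`-Chu–Vandermonde sums. They give stochasticity (`sum_L`) and two rules for products of a vertical
weight with parameter `p` and a horizontal one with parameter `s`: for `s = -α q ^ J p` the product
is invariant (`sum_nbTerm_L_invariant`); for `s = q ^ J p` and `J = I` the two laws trade places
(`mapsProduct_exchange`). The first rule suits `μ_ρ`. The second suits `μ_*`: if the line law
entering `x` is the marginal of `μ_*` at `x - 1`, it becomes the new vertical law at `x`, and the
old law at `x` moves on to `x + 1`. A step therefore moves `μ_*` by one site, which the shift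
undoes.

Mixing. A vertex with `i` vertical lines sends `i` lines to the right with probability at least `ε >
0`, whatever enters from the left, because the exchange of the two stacks is possible. This Doeblin
condition contracts the influence of the incoming lines by `1 - ε` per site
(`sum_abs_transfer_one_le`). Hence finite configurations have a step of total mass one, the step is
local (`isLocalFun`), the limit over truncations exists and is Feller, and the unknown line law far
to the left may be replaced by the convenient one (`integral_integral_jointLaw`). This makes the
vertex identities rigorous on `ℤ` (`map_newConfig_jointMeasure`).

Conservation. Under `μ_*`, both the configuration and the crossing lines differ from a step-shaped
background at finitely many sites, by Borel–Cantelli. Summing the conservation of lines over all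
sites shows that the excess over the background does not change (`ae_ae_mem_excessClass_iff`). The
classes `G_n` are the level sets of the excess, so conditioning on them preserves invariance. They
have positive mass because every finite perturbation of the background is an atom
(`prodMeasure_singleton_pos`).

Finally, the measures invariant under one shifted step form a convex set, closed by the Feller
property, and they are stationary for all times because the evolution commutes with the shift. -/

open MeasureTheory ProbabilityTheory Filter Topology
open scoped NNReal ENNReal BoundedContinuousFunction

noncomputable section

namespace SHS6V

/-! ### Finite `q`-Pochhammer symbols -/

/-- The `q`-Pochhammer symbol `(b; q)_n` with a natural index. -/
def poch (q b : ℝ) (n : ℕ) : ℝ := ∏ k ∈ Finset.range n, (1 - b * q ^ k)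

lemma qPoch_eq_poch (q b : ℝ) (n : ℕ) : qPoch b q (n : ℤ) = poch q b n := qPoch_natCast b q n

@[simp] lemma poch_zero (q b : ℝ) : poch q b 0 = 1 := by simp [poch]

lemma poch_succ (q b : ℝ) (n : ℕ) : poch q b (n + 1) = poch q b n * (1 - b * q ^ n) := by
  simp [poch, Finset.prod_range_succ]

lemma poch_add (q b : ℝ) (m n : ℕ) :
    poch q b (m + n) = poch q b m * poch q (b * q ^ m) n := by
  simp only [poch, Finset.prod_range_add]
  congr 1
  exact Finset.prod_congr rfl fun k _ => by rw [pow_add]; ring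

lemma poch_ne_zero {q b : ℝ} {n : ℕ} (h : ∀ k < n, b * q ^ k ≠ 1) : poch q b n ≠ 0 :=
  Finset.prod_ne_zero_iff.2 fun k hk => sub_ne_zero.2 (h k (Finset.mem_range.1 hk)).symm

lemma poch_eq_zero {q b : ℝ} {n k : ℕ} (hk : k < n) (h : b * q ^ k = 1) : poch q b n = 0 :=
  Finset.prod_eq_zero (Finset.mem_range.2 hk) (by rw [h, sub_self])

lemma poch_self_ne_zero {q : ℝ} (hq : 0 < q) (hq1 : q ≠ 1) (n : ℕ) : poch q q n ≠ 0 :=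
  poch_ne_zero fun k _ h => hq1 ((pow_eq_one_iff_of_nonneg hq.le (Nat.succ_ne_zero k)).1
    (by rw [pow_succ']; exact h))

/-- The `q`-Chu–Vandermonde summation. -/
lemma sum_antidiagonal_poch {q : ℝ} (hq : 0 < q) (hq1 : q ≠ 1) (A B : ℝ) (n : ℕ) :
    ∑ x ∈ Finset.HasAntidiagonal.antidiagonal n,
      poch q A x.1 / poch q q x.1 * (poch q B x.2 / poch q q x.2) * A ^ x.2 =
      poch q (A * B) n / poch q q n := by
  have hc := poch_self_ne_zero hq hq1
  have hone : ∀ k : ℕ, 1 - q * q ^ k ≠ 0 := fun k h => by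
    have := hc (k + 1); rw [poch_succ, h, mul_zero] at this; exact this rfl
  have hrec : ∀ (D : ℝ) (k : ℕ), (1 - q * q ^ k) * (poch q D (k + 1) / poch q q (k + 1)) =
      (1 - D * q ^ k) * (poch q D k / poch q q k) := fun D k => by
    rw [poch_succ, poch_succ]
    have := hone k; have := hc k
    field_simp
  induction n with
  | zero => simp
  | succ n ih =>
    refine mul_left_cancel₀ (hone n) ?_
    rw [hrec, ← ih, Finset.mul_sum, Finset.mul_sum]
    set a : ℕ → ℝ := fun k => poch q A k / poch q q k with ha
    set b : ℕ → ℝ := fun k => poch q B k / poch q q k with hb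
    -- Splitting `1 - q ^ (n + 1)` as `(1 - q ^ x₁) + q ^ x₁ (1 - q ^ x₂)` lets the two recurrences
    -- act. After reindexing, the factors add up to `(1 - A q ^ x₁) + A q ^ x₁ (1 - B q ^ x₂) = 1 -
    -- A B q ^ n`.
    have e1 : ∀ x ∈ Finset.HasAntidiagonal.antidiagonal (n + 1), (1 - q * q ^ n) * (a x.1 * b x.2 * A ^ x.2) =
        (1 - q ^ x.1) * a x.1 * (b x.2 * A ^ x.2) +
          q ^ x.1 * a x.1 * ((1 - q ^ x.2) * b x.2 * A ^ x.2) := by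
      intro x hx
      have : q * q ^ n = q ^ x.1 * q ^ x.2 := by
        rw [← pow_add, Finset.HasAntidiagonal.mem_antidiagonal.1 hx, pow_succ']
      rw [this]; ring
    rw [Finset.sum_congr rfl e1, Finset.sum_add_distrib, Finset.Nat.sum_antidiagonal_succ,
      Finset.Nat.sum_antidiagonal_succ' (f := fun x : ℕ × ℕ =>
        q ^ x.1 * a x.1 * ((1 - q ^ x.2) * b x.2 * A ^ x.2))]
    simp only [pow_zero, sub_self, zero_mul, mul_zero, zero_add]
    rw [← Finset.sum_add_distrib]
    refine Finset.sum_congr rfl fun x hx => ?_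
    have hn : q ^ n = q ^ x.1 * q ^ x.2 := by rw [← pow_add, Finset.HasAntidiagonal.mem_antidiagonal.1 hx]
    have h1 := hrec A x.1
    have h2 := hrec B x.2
    simp only [pow_succ']
    rw [hn, h1, h2]
    simp only [ha, hb]
    ring

/-- The mirror form of the summation. The exchange of parameters needs this one, whereas
stochasticity and invariance use the first form. -/
lemma sum_antidiagonal_poch' {q : ℝ} (hq : 0 < q) (hq1 : q ≠ 1) (A B : ℝ) (n : ℕ) :
    ∑ x ∈ Finset.HasAntidiagonal.antidiagonal n,
      poch q A x.1 / poch q q x.1 * (poch q B x.2 / poch q q x.2) * B ^ x.1 =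
      poch q (A * B) n / poch q q n := by
  rw [← Finset.Nat.sum_antidiagonal_swap, mul_comm A B, ← sum_antidiagonal_poch hq hq1]
  exact Finset.sum_congr rfl fun x _ => by simp only [Prod.fst_swap, Prod.snd_swap]; ring

/-- Reflection of the base of a `q`-Pochhammer symbol. -/
lemma poch_reflect {q x y : ℝ} (hq : 0 < q) (hxy : x * y = q) (n : ℕ) :
    poch q (x * q ^ (-(n : ℝ))) n = (-x) ^ n * q ^ (-((n : ℝ) * (n + 1) / 2)) * poch q y n := by
  have hx : x ≠ 0 := by rintro rfl; simp at hxy; exact hq.ne hxy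
  induction n with
  | zero => simp
  | succ n ih =>
    have e : poch q (x * q ^ (-((n + 1 : ℕ) : ℝ))) (n + 1) =
        (1 - x * q ^ (-((n + 1 : ℕ) : ℝ))) * poch q (x * q ^ (-(n : ℝ))) n := by
      rw [add_comm n 1, poch_add]
      congr 1
      · simp [poch]
      · congr 1
        rw [mul_assoc, pow_one, ← Real.rpow_add_one hq.ne']
        congr 2; push_cast; ring
    have e2 : q ^ (-(((n + 1 : ℕ) : ℝ) * ((n + 1 : ℕ) + 1) / 2)) =
        q ^ (-((n : ℝ) * (n + 1) / 2)) * q ^ (-((n + 1 : ℕ) : ℝ)) := by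
      rw [← Real.rpow_add hq]; congr 1; push_cast; ring
    -- This turns the new factor `1 - x q ^ (-(n + 1))` into `-x q ^ (-(n + 1)) (1 - y q ^ n)`.
    have e3 : x * q ^ (-((n + 1 : ℕ) : ℝ)) * (y * q ^ n) = 1 := by
      rw [mul_mul_mul_comm, hxy, mul_comm (q ^ (-((n + 1 : ℕ) : ℝ))), ← mul_assoc, ← pow_succ',
        ← Real.rpow_natCast, ← Real.rpow_add hq]
      simp
    rw [e, ih, e2, poch_succ, pow_succ]
    linear_combination (-x) ^ n * q ^ (-((n : ℝ) * (n + 1) / 2)) * poch q y n * (- e3)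

/-- The `q`-Pochhammer symbol with an integer index as a ratio of ones with natural indices. -/
lemma qPoch_sub {q : ℝ} (hq : 0 < q) (b : ℝ) (m k : ℕ)
    (h : poch q (b * q ^ (-(k : ℝ))) k ≠ 0) :
    qPoch b q ((m : ℤ) - k) = poch q (b * q ^ (-(k : ℝ))) m / poch q (b * q ^ (-(k : ℝ))) k := by
  rw [eq_div_iff h]
  rcases le_total k m with hkm | hkm
  · obtain ⟨d, rfl⟩ := Nat.exists_eq_add_of_le hkm
    have : ((k + d : ℕ) : ℤ) - k = (d : ℕ) := by push_cast; ring
    rw [this, qPoch_eq_poch, poch_add, mul_assoc b, ← Real.rpow_natCast q k, ← Real.rpow_add hq]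
    simp [mul_comm]
  · obtain ⟨d, rfl⟩ := Nat.exists_eq_add_of_le hkm
    have e : b * q ^ (-((m + d : ℕ) : ℝ)) * q ^ m = b * q ^ (-(d : ℤ)) := by
      rw [mul_assoc, ← Real.rpow_natCast q m, ← Real.rpow_add hq, ← Real.rpow_intCast]
      congr 2; push_cast; ring
    have h' : poch q (b * q ^ (-(d : ℤ))) d ≠ 0 := by
      rw [poch_add, e] at h; exact right_ne_zero_of_mul h
    rcases Nat.eq_zero_or_pos d with rfl | hd
    · simp [qPoch]
    have e2 : qPoch b q ((m : ℤ) - ((m + d : ℕ) : ℤ)) = (poch q (b * q ^ (-(d : ℤ))) d)⁻¹ := by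
      have : (m : ℤ) - ((m + d : ℕ) : ℤ) = -(d : ℤ) := by push_cast; ring
      rw [this, qPoch, if_neg (by omega), poch, ← Finset.prod_inv_distrib]
      simp only [neg_neg, Int.toNat_natCast]
      refine Finset.prod_congr rfl fun k _ => ?_
      rw [zpow_add₀ hq.ne', zpow_natCast, mul_assoc]
    rw [e2, poch_add, e, mul_comm (poch q _ m), inv_mul_cancel_left₀ h']

/-! ### The vertex weight as a sum over contingency tables -/

/-- The contribution to the vertex weight of the histories in which `k` lines stay vertical, `a`
vertical lines turn to the right, `l` horizontal lines turn upwards and `b` lines stay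
horizontal. -/
def tableWeight (I J : ℕ) (q α : ℝ) (k a l b : ℕ) : ℝ :=
  poch q q (k + a) / (poch q q k * poch q q a) * (poch q (-α * q ^ J) k *
      poch q (q ^ ((l + b : ℝ) - J)) a * (-α * q ^ J) ^ a) *
    (poch q q (l + b) / (poch q q l * poch q q b) * (poch q (q ^ ((k : ℝ) - I)) l *
      poch q (-α * q ^ ((I : ℝ) - k)) b * (q ^ ((k : ℝ) - I)) ^ b)) /
    poch q (-α) (k + a + l + b)

/-- Reflection with `x = q ^ (k + m + 1)`, read backwards. It turns the terminating parameters of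
the series into the numerators of `q`-binomial coefficients. -/
lemma poch_rpow_neg {q : ℝ} (hq : 0 < q) (hq1 : q ≠ 1) (m k : ℕ) :
    poch q (q ^ (-((k : ℝ) + m))) k = (-1) ^ k * q ^ (-(k : ℝ) * (k + m + 1)) *
      q ^ ((k : ℝ) * (k + 1) / 2) * (poch q q (k + m) / poch q q m) := by
  have h := poch_reflect hq (x := q ^ ((k : ℝ) + m + 1)) (y := q ^ (-((k : ℝ) + m)))
    (by rw [← Real.rpow_add hq]; ring_nf; exact Real.rpow_one q) k
  have e : q ^ ((k : ℝ) + m + 1) * q ^ (-(k : ℝ)) = q * q ^ m := by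
    rw [← pow_succ', ← Real.rpow_add hq, ← Real.rpow_natCast]; congr 1; push_cast; ring
  rw [e, eq_comm] at h
  rw [add_comm k m, poch_add, mul_div_cancel_left₀ _ (poch_self_ne_zero hq hq1 m), ← h,
    neg_pow (q ^ _), ← Real.rpow_natCast (q ^ _) k, ← Real.rpow_mul hq.le]
  have e1 : q ^ (-(k : ℝ) * (k + m + 1)) * q ^ (((k : ℝ) + m + 1) * k) = 1 := by
    rw [← Real.rpow_add hq]; ring_nf; exact Real.rpow_zero q
  have e2 : q ^ ((k : ℝ) * (k + 1) / 2) * q ^ (-((k : ℝ) * (k + 1) / 2)) = 1 := by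
    rw [← Real.rpow_add hq]; ring_nf; exact Real.rpow_zero q
  have e3 : ((-1 : ℝ) ^ k) * (-1) ^ k = 1 := by rw [← mul_pow]; simp
  generalize q ^ (-(k : ℝ) * (k + m + 1)) = A at *
  generalize q ^ (((k : ℝ) + m + 1) * k) = B at *
  generalize q ^ ((k : ℝ) * (k + 1) / 2) = C at *
  generalize q ^ (-((k : ℝ) * (k + 1) / 2)) = D at *
  generalize ((-1 : ℝ) ^ k) = s at *
  calc poch q (q ^ (-((k : ℝ) + m))) k =
      (A * B) * (C * D) * (s * s) * poch q (q ^ (-((k : ℝ) + m))) k := by rw [e1, e2, e3]; ring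
    _ = _ := by ring

/-- Two cancellations drive the identity. The denominator of `(-αν⁻¹; q)_{b-k}` reflects onto the
parameter `-qνα⁻¹` of the series. The symbol `(q ^ (J + 1 - j₁); q)_{l-a}` is a ratio: one half
cancels the last lower parameter, the other reflects to `(q ^ (l + b - J); q)_a`. What remains is a
comparison of powers of `q`, `α` and `-1`. -/
lemma table_term {I J : ℕ} {q α : ℝ} (hq : 0 < q) (hq1 : q ≠ 1) (hα : α ≠ 0) {k a l b : ℕ}
    (hj₁ : l + b ≤ J) (hj₂ : a + b ≤ J)
    (hk : poch q (-α * (q ^ (-(I : ℤ)))⁻¹ * q ^ (-(k : ℝ))) k ≠ 0) :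
    q ^ ((2 * ((l : ℝ) + b) - ((l : ℝ) + b) ^ 2) / 4 - (2 * ((a : ℝ) + b) - ((a : ℝ) + b) ^ 2) / 4
        + (((k : ℝ) + l) ^ 2 + ((k : ℝ) + a) ^ 2) / 4
        + (((k : ℝ) + l) * (((a : ℝ) + b) - 1) + ((k : ℝ) + a) * ((l : ℝ) + b)) / 2 : ℝ)
      * ((q ^ (-(I : ℤ))) ^ ((b : ℤ) - k) * α ^ (k + a)
          * qPoch (-α * (q ^ (-(I : ℤ)))⁻¹) q ((b : ℤ) - k)
        / (poch q q (k + l) * poch q (-α) (k + a + l + b)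
          * qPoch (q ^ ((J : ℝ) + 1 - (l + b))) q ((l : ℤ) - a)))
      * (q ^ k * (poch q (q ^ (-((k : ℝ) + l))) k / poch q q k) *
        (poch q (q ^ (-((k : ℝ) + a))) k * poch q (q ^ ((k : ℝ) - I)) l) *
        (poch q (-α * q ^ J) k * poch q (q * q ^ b) l) *
        (poch q (-q * q ^ (-(I : ℤ)) * α⁻¹) k * poch q (q ^ ((J : ℝ) + 1 - (a + l + b))) l)) =
      tableWeight I J q α k a l b := by
  have hc := poch_self_ne_zero hq hq1
  have hpow : ∀ x : ℝ, 0 < q ^ x := fun x => Real.rpow_pos_of_pos hq x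
  -- The factor to be cancelled vanishes in this case, so it is treated apart: both sides are `0`.
  by_cases hz : J < a + (l + b)
  · have hl : 1 ≤ l := by omega
    have z1 : poch q (q ^ ((J : ℝ) + 1 - (a + l + b))) l = 0 := by
      refine poch_eq_zero (k := a + l + b - (J + 1)) (by omega) ?_
      rw [← Real.rpow_natCast, ← Real.rpow_add hq, Nat.cast_sub (by omega)]
      push_cast; ring_nf; exact Real.rpow_zero q
    have z2 : poch q (q ^ ((l + b : ℝ) - J)) a = 0 := by
      refine poch_eq_zero (k := J - (l + b)) (by omega) ?_
      rw [← Real.rpow_natCast, ← Real.rpow_add hq, Nat.cast_sub (by omega)]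
      push_cast; ring_nf; exact Real.rpow_zero q
    simp [tableWeight, z1, z2]
  push Not at hz
  have hM : poch q (q ^ ((J : ℝ) + 1 - (l + b)) * q ^ (-(a : ℝ))) a ≠ 0 := by
    refine poch_ne_zero fun t _ h => ?_
    rw [← Real.rpow_add hq, ← Real.rpow_natCast, ← Real.rpow_add hq] at h
    have hcast : (a : ℝ) + (l + b) ≤ J := by exact_mod_cast hz
    have h0 := (Real.rpow_right_inj hq hq1).1 (h.trans (Real.rpow_zero q).symm)
    have : (0 : ℝ) ≤ t := Nat.cast_nonneg t
    linarith
  have hM' : poch q (q ^ ((J : ℝ) + 1 - (l + b)) * q ^ (-(a : ℝ))) l ≠ 0 := by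
    refine poch_ne_zero fun t _ h => ?_
    rw [← Real.rpow_add hq, ← Real.rpow_natCast, ← Real.rpow_add hq] at h
    have hcast : (a : ℝ) + (l + b) ≤ J := by exact_mod_cast hz
    have h0 := (Real.rpow_right_inj hq hq1).1 (h.trans (Real.rpow_zero q).symm)
    have : (0 : ℝ) ≤ t := Nat.cast_nonneg t
    linarith
  have eM : q ^ ((J : ℝ) + 1 - (a + l + b)) = q ^ ((J : ℝ) + 1 - (l + b)) * q ^ (-(a : ℝ)) := by
    rw [← Real.rpow_add hq]; congr 1; ring
  have eν : (q ^ (-(I : ℤ)))⁻¹ = q ^ (I : ℝ) := by simp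
  have eν' : q ^ (-(I : ℤ)) = q ^ (-(I : ℝ)) := by simp [Real.rpow_neg hq.le]
  have r1 := poch_reflect hq (x := -α * (q ^ (-(I : ℤ)))⁻¹) (y := -q * q ^ (-(I : ℤ)) * α⁻¹)
    (by have : q ^ (-(I : ℤ)) ≠ 0 := (zpow_pos hq _).ne'
        field_simp) k
  have r2 := poch_reflect hq (x := q ^ ((J : ℝ) + 1 - (l + b))) (y := q ^ ((l + b : ℝ) - J))
    (by rw [← Real.rpow_add hq]; ring_nf; exact Real.rpow_one q) a
  have eI : -α * (q ^ (-(I : ℤ)))⁻¹ * q ^ (-(k : ℝ)) = -α * q ^ ((I : ℝ) - k) := by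
    rw [eν, mul_assoc, ← Real.rpow_add hq, sub_eq_add_neg]
  have r3 : poch q (q * q ^ b) l = poch q q (l + b) / poch q q b := by
    rw [add_comm l b, poch_add, mul_div_cancel_left₀ _ (hc b)]
  rw [qPoch_sub hq _ b k hk, qPoch_sub hq _ l a hM, eM, poch_rpow_neg hq hq1 l k,
    poch_rpow_neg hq hq1 a k, r3]
  rw [eI] at r1 hk ⊢
  unfold tableWeight
  have hy1 : poch q (-q * q ^ (-(I : ℤ)) * α⁻¹) k ≠ 0 := by
    intro h; rw [h, mul_zero] at r1; exact hk r1
  have hy2 : poch q (q ^ ((l + b : ℝ) - J)) a ≠ 0 := by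
    intro h; rw [h, mul_zero] at r2; exact hM r2
  -- All monomial prefactors are gathered here; the quadratic exponent in the vertex weight is
  -- exactly the one that makes them match.
  have hpw : q ^ ((2 * ((l : ℝ) + b) - ((l : ℝ) + b) ^ 2) / 4
        - (2 * ((a : ℝ) + b) - ((a : ℝ) + b) ^ 2) / 4 + (((k : ℝ) + l) ^ 2 + ((k : ℝ) + a) ^ 2) / 4
        + (((k : ℝ) + l) * (((a : ℝ) + b) - 1) + ((k : ℝ) + a) * ((l : ℝ) + b)) / 2 : ℝ) *
      (q ^ (-(I : ℤ))) ^ ((b : ℤ) - k) * α ^ (k + a) *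
      ((-q ^ ((J : ℝ) + 1 - (l + b))) ^ a * q ^ (-((a : ℝ) * (a + 1) / 2))) * q ^ k *
      (q ^ (-(k : ℝ) * (k + l + 1)) * q ^ ((k : ℝ) * (k + 1) / 2)) *
      (q ^ (-(k : ℝ) * (k + a + 1)) * q ^ ((k : ℝ) * (k + 1) / 2)) =
      (-α * q ^ J) ^ a * (q ^ ((k : ℝ) - I)) ^ b *
        ((-(-α * (q ^ (-(I : ℤ)))⁻¹)) ^ k * q ^ (-((k : ℝ) * (k + 1) / 2))) := by
    have n1 : (q ^ (-(I : ℤ))) ^ ((b : ℤ) - k) = q ^ (-(I : ℝ) * (b - k)) := by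
      rw [← zpow_mul, ← Real.rpow_intCast]; push_cast; rfl
    have n2 : (-α * q ^ J) ^ a = α ^ a * (-1) ^ a * q ^ ((J : ℝ) * a) := by
      rw [neg_mul, neg_pow, mul_pow, ← pow_mul, ← Real.rpow_natCast q]; push_cast; ring
    have n3 : (q ^ ((k : ℝ) - I)) ^ b = q ^ (((k : ℝ) - I) * b) := by
      rw [← Real.rpow_natCast (q ^ _), ← Real.rpow_mul hq.le]
    have n4 : (-(-α * (q ^ (-(I : ℤ)))⁻¹)) ^ k = α ^ k * q ^ ((I : ℝ) * k) := by
      rw [eν, neg_mul, neg_neg, mul_pow, ← Real.rpow_natCast (q ^ _), ← Real.rpow_mul hq.le]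
    have n5 : (-q ^ ((J : ℝ) + 1 - (l + b))) ^ a = (-1) ^ a * q ^ (((J : ℝ) + 1 - (l + b)) * a) := by
      rw [neg_pow, ← Real.rpow_natCast (q ^ _), ← Real.rpow_mul hq.le]
    rw [n1, n2, n3, n4, n5, pow_add, ← Real.rpow_natCast q k]
    have key : ∀ x1 x2 x3 x4 x5 x6 x7 x8 x9 y1 y2 y3 y4 : ℝ,
        x1 + x2 + x3 + x4 + x5 + x6 + x7 + x8 + x9 = y1 + y2 + y3 + y4 →
        q ^ x1 * q ^ x2 * (α ^ k * α ^ a) * ((-1) ^ a * q ^ x3 * q ^ x4) * q ^ x5 *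
          (q ^ x6 * q ^ x7) * (q ^ x8 * q ^ x9) =
        α ^ a * (-1) ^ a * q ^ y1 * q ^ y2 * (α ^ k * q ^ y3 * q ^ y4) := by
      intro x1 x2 x3 x4 x5 x6 x7 x8 x9 y1 y2 y3 y4 h
      have : q ^ x1 * q ^ x2 * q ^ x3 * q ^ x4 * q ^ x5 * q ^ x6 * q ^ x7 * q ^ x8 * q ^ x9 =
          q ^ y1 * q ^ y2 * q ^ y3 * q ^ y4 := by
        simp only [← Real.rpow_add hq, h]
      linear_combination α ^ k * α ^ a * (-1) ^ a * this
    exact key _ _ _ _ _ _ _ _ _ _ _ _ _ (by ring)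
  have hs : ((-1 : ℝ) ^ k) * (-1) ^ k = 1 := by rw [← mul_pow]; simp
  have hx : (-(-α * (q ^ (-(I : ℤ)))⁻¹)) ^ k * q ^ (-((k : ℝ) * (k + 1) / 2)) ≠ 0 := by
    intro h; rw [h, zero_mul] at r1; exact hk r1
  rw [r2] at hM ⊢
  rw [r1]
  have h1 := hc k; have h2 := hc a; have h3 := hc l; have h4 := hc b; have h5 := hc (k + l)
  generalize poch q (q ^ ((J : ℝ) + 1 - (l + b)) * q ^ (-(a : ℝ))) l = Pl at *
  generalize (-(-α * (q ^ (-(I : ℤ)))⁻¹)) ^ k * q ^ (-((k : ℝ) * (k + 1) / 2)) = X at *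
  generalize (-q ^ ((J : ℝ) + 1 - (l + b))) ^ a * q ^ (-((a : ℝ) * (a + 1) / 2)) = Y at *
  generalize poch q (-q * q ^ (-(I : ℤ)) * α⁻¹) k = Z at *
  generalize poch q (-α) (k + a + l + b) = D
  generalize poch q (q ^ ((l + b : ℝ) - J)) a = U at *
  generalize (-α * q ^ J) ^ a = V at *
  generalize (q ^ ((k : ℝ) - I)) ^ b = V' at *
  generalize (q ^ (-(I : ℤ))) ^ ((b : ℤ) - k) = N at *
  generalize (-1 : ℝ) ^ k = s at *
  generalize q ^ (-(k : ℝ) * (k + l + 1)) = R₁ at *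
  generalize q ^ (-(k : ℝ) * (k + a + 1)) = R₂ at *
  generalize q ^ ((k : ℝ) * (k + 1) / 2) = T at *
  generalize poch q q (k + a) = c1
  generalize poch q q (l + b) = c2
  generalize poch q (-α * q ^ J) k = c3
  generalize poch q (q ^ ((k : ℝ) - I)) l = c4
  generalize poch q (-α * q ^ ((I : ℝ) - k)) b = c5
  generalize q ^ (_ - _ + _ + _ : ℝ) = E₀ at *
  -- The hypotheses do not exclude a vanishing `(-α; q)`; division by zero then makes both sides
  -- `0`.
  by_cases hD : D = 0
  · simp [hD]
  field_simp
  linear_combination (c1 * c2 * c3 * c4 * c5) * 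
    (E₀ * N * α ^ (k + a) * Y * q ^ k * (R₁ * T) * (R₂ * T) * hs + hpw)

lemma Admissible.neg {I J : ℕ} {q α : ℝ} (h : Admissible I J q α) : α < 0 := by
  rcases h with ⟨hq, -, h⟩ | ⟨-, -, h⟩
  · exact h.trans (neg_neg_of_pos (zpow_pos hq _))
  · exact h

/-- The admissible range says that `-α q ^ (I + J - 1)` lies strictly above `1` if `q < 1` and
strictly below `1` if `q > 1`. Monotonicity in the exponent extends this to all `x ≤ I + J - 1`, on
the same side of `1` as the negative powers of `q`. Quotients of such factors are therefore
positive. -/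
lemma Admissible.sign {I J : ℕ} {q α : ℝ} (h : Admissible I J q α) {x y : ℝ}
    (hx : x ≤ I + J - 1) (hy : y < 0) :
    (q < 1 ∧ 1 - -α * q ^ x < 0 ∧ 1 - q ^ y < 0) ∨ (1 < q ∧ 0 < 1 - -α * q ^ x ∧ 0 < 1 - q ^ y) := by
  have e : ∀ {q : ℝ}, 0 < q → q ^ (-(I : ℤ) - J + 1) * q ^ x = q ^ (x - (I + J - 1)) := by
    intro q hq
    rw [← Real.rpow_intCast, ← Real.rpow_add hq]; congr 1; push_cast; ring
  rcases h with ⟨hq, hq1, h⟩ | ⟨hq1, h, -⟩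
  · refine Or.inl ⟨hq1, ?_, ?_⟩
    · have h1 := mul_lt_mul_of_pos_right (lt_neg.1 h) (Real.rpow_pos_of_pos hq x)
      rw [e hq] at h1
      have := Real.one_le_rpow_of_pos_of_le_one_of_nonpos hq hq1.le (sub_nonpos.2 hx)
      linarith
    · linarith [Real.one_lt_rpow_of_pos_of_lt_one_of_neg hq hq1 hy]
  · have hq : 0 < q := by linarith
    refine Or.inr ⟨hq1, ?_, ?_⟩
    · have h1 := mul_lt_mul_of_pos_right (neg_lt.1 h) (Real.rpow_pos_of_pos hq x)
      rw [e hq] at h1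
      have := Real.rpow_le_one_of_one_le_of_nonpos hq1.le (sub_nonpos.2 hx)
      linarith
    · linarith [Real.rpow_lt_one_of_one_lt_of_neg hq1 hy]

lemma Admissible.ne_one_mul {I J : ℕ} {q α : ℝ} (h : Admissible I J q α) {x : ℝ}
    (hx : x ≤ I + J - 1) : -α * q ^ x ≠ 1 := by
  intro h1
  rcases h.sign hx (neg_one_lt_zero) with h | h <;> linarith [h.2.1]

lemma poch_div_pos {q x y : ℝ} {n : ℕ} (h : ∀ t < n, 0 < (1 - x * q ^ t) * (1 - y * q ^ t)) :
    0 < poch q x n / poch q y n := by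
  rw [poch, poch, ← Finset.prod_div_distrib]
  refine Finset.prod_pos fun t ht => ?_
  rw [← mul_div_mul_right _ _ (right_ne_zero_of_mul (h t (Finset.mem_range.1 ht)).ne')]
  exact div_pos (h t (Finset.mem_range.1 ht))
    (mul_self_pos.2 (right_ne_zero_of_mul (h t (Finset.mem_range.1 ht)).ne'))

lemma qbinom_pos {q : ℝ} (hq : 0 < q) (hq1 : q ≠ 1) (k a : ℕ) :
    0 < poch q q (k + a) / (poch q q k * poch q q a) := by
  rw [poch_add, mul_div_mul_left _ _ (poch_self_ne_zero hq hq1 k)]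
  refine poch_div_pos fun t _ => ?_
  rw [mul_assoc, ← pow_add, ← pow_succ', ← pow_succ']
  rcases lt_or_gt_of_ne hq1 with h | h
  · exact mul_pos (sub_pos.2 (pow_lt_one₀ hq.le h (by omega)))
      (sub_pos.2 (pow_lt_one₀ hq.le h (by omega)))
  · exact mul_pos_of_neg_of_neg (sub_neg.2 (one_lt_pow₀ h (by omega)))
      (sub_neg.2 (one_lt_pow₀ h (by omega)))

/-- The denominator `(-α; q)_{k+a+l+b}` is cut into blocks of lengths `k`, `a`, `l`, `b`, and each
block is matched with the numerator of the same length, so that every pair of factors has one sign.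
-/
lemma tableWeight_pos {I J : ℕ} {q α : ℝ} (h : Admissible I J q α) {k a l b : ℕ}
    (hJ : a + l + b ≤ J) (hI : k + l ≤ I) : 0 < tableWeight I J q α k a l b := by
  have hq := h.pos
  have hα := h.neg
  have hJ' : (a : ℝ) + l + b ≤ J := by exact_mod_cast hJ
  have hI' : (k : ℝ) + l ≤ I := by exact_mod_cast hI
  have c1 : ∀ x y : ℝ, x ≤ I + J - 1 → y ≤ I + J - 1 →
      0 < (1 - -α * q ^ x) * (1 - -α * q ^ y) := by
    intro x y hx hy
    rcases h.sign hx neg_one_lt_zero with h1 | h1 <;> rcases h.sign hy neg_one_lt_zero with h2 | h2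
    · exact mul_pos_of_neg_of_neg h1.2.1 h2.2.1
    · linarith [h1.1, h2.1]
    · linarith [h1.1, h2.1]
    · exact mul_pos h1.2.1 h2.2.1
  have c2 : ∀ x y : ℝ, x < 0 → y ≤ I + J - 1 → 0 < (1 - q ^ x) * (1 - -α * q ^ y) := by
    intro x y hx hy
    rcases h.sign hy hx with h1 | h1
    · exact mul_pos_of_neg_of_neg h1.2.2 h1.2.1
    · exact mul_pos h1.2.2 h1.2.1
  have hq' : ∀ (x : ℝ) (t : ℕ), q ^ x * q ^ t = q ^ (x + t) := fun x t => by
    rw [Real.rpow_add hq, Real.rpow_natCast]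
  have hq'' : ∀ (m t : ℕ), q ^ m * q ^ t = q ^ ((m + t : ℕ) : ℝ) := fun m t => by
    rw [Real.rpow_natCast, pow_add]
  have ht : ∀ {t n : ℕ}, t < n → (t : ℝ) ≤ n - 1 := fun {t n} h => by
    have : ((t + 1 : ℕ) : ℝ) ≤ n := by exact_mod_cast h
    push_cast at this; linarith
  have h0 : ∀ n : ℕ, (0 : ℝ) ≤ n := fun n => Nat.cast_nonneg n
  have r1 : 0 < poch q (-α * q ^ J) k / poch q (-α) k := by
    refine poch_div_pos fun t htk => ?_
    rw [mul_assoc, hq'', ← Real.rpow_natCast q t]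
    have := ht htk
    refine c1 _ _ ?_ ?_ <;> push_cast <;> linarith [h0 l, h0 a, h0 b, h0 J]
  have r2 : 0 < poch q (q ^ ((l + b : ℝ) - J)) a / poch q (-α * q ^ k) a := by
    refine poch_div_pos fun t hta => ?_
    rw [mul_assoc, hq'', hq']
    have := ht hta
    refine c2 _ _ ?_ ?_ <;> push_cast <;> linarith [h0 l, h0 a, h0 b, h0 J]
  have r3 : 0 < poch q (q ^ ((k : ℝ) - I)) l / poch q (-α * q ^ (k + a)) l := by
    refine poch_div_pos fun t htl => ?_
    rw [mul_assoc, hq'', hq']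
    have := ht htl
    refine c2 _ _ ?_ ?_ <;> push_cast <;> linarith [h0 l, h0 a, h0 b, h0 J]
  have r4 : 0 < poch q (-α * q ^ ((I : ℝ) - k)) b / poch q (-α * q ^ (k + a + l)) b := by
    refine poch_div_pos fun t htb => ?_
    rw [mul_assoc, mul_assoc, hq'', hq']
    have := ht htb
    refine c1 _ _ ?_ ?_ <;> push_cast <;> linarith [h0 l, h0 a, h0 b, h0 J, h0 k]
  have r5 := qbinom_pos hq h.ne_one k a
  have r6 := qbinom_pos hq h.ne_one l b
  have r7 : 0 < (-α * q ^ J) ^ a := pow_pos (mul_pos (neg_pos.2 hα) (pow_pos hq _)) _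
  have r8 : 0 < (q ^ ((k : ℝ) - I)) ^ b := pow_pos (Real.rpow_pos_of_pos hq _) _
  have e : tableWeight I J q α k a l b =
      poch q q (k + a) / (poch q q k * poch q q a) * (poch q q (l + b) / (poch q q l * poch q q b)) *
      (-α * q ^ J) ^ a * (q ^ ((k : ℝ) - I)) ^ b * (poch q (-α * q ^ J) k / poch q (-α) k) *
      (poch q (q ^ ((l + b : ℝ) - J)) a / poch q (-α * q ^ k) a) *
      (poch q (q ^ ((k : ℝ) - I)) l / poch q (-α * q ^ (k + a)) l) *
      (poch q (-α * q ^ ((I : ℝ) - k)) b / poch q (-α * q ^ (k + a + l)) b) := by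
    rw [tableWeight, poch_add q (-α) (k + a + l) b, poch_add q (-α) (k + a) l,
      poch_add q (-α) k a]
    simp only [div_eq_mul_inv, mul_inv]
    ring
  rw [e]
  positivity

/-- With its counterpart for `k + l > I`, this shows that tables with too many outgoing lines carry
no weight, so restricting the outgoing numbers to `{0, …, J}` and `{0, …, I}` loses nothing. -/
lemma tableWeight_eq_zero_right {I J : ℕ} {q α : ℝ} (hq : 0 < q) {k a l b : ℕ}
    (hJ : J < a + l + b) (hj : l + b ≤ J) : tableWeight I J q α k a l b = 0 := by
  have : poch q (q ^ ((l + b : ℝ) - J)) a = 0 := by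
    refine poch_eq_zero (k := J - (l + b)) (by omega) ?_
    rw [← Real.rpow_natCast, ← Real.rpow_add hq, Nat.cast_sub (by omega)]
    push_cast; ring_nf; exact Real.rpow_zero q
  simp [tableWeight, this]

lemma tableWeight_eq_zero_up {I J : ℕ} {q α : ℝ} (hq : 0 < q) {k a l b : ℕ}
    (hI : I < k + l) (hi : k ≤ I) : tableWeight I J q α k a l b = 0 := by
  have : poch q (q ^ ((k : ℝ) - I)) l = 0 := by
    refine poch_eq_zero (k := I - k) (by omega) ?_
    rw [← Real.rpow_natCast, ← Real.rpow_add hq, Nat.cast_sub (by omega)]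
    ring_nf; exact Real.rpow_zero q
  simp [tableWeight, this]

lemma tableWeight_nonneg {I J : ℕ} {q α : ℝ} (h : Admissible I J q α) {k a l b : ℕ}
    (hi : k ≤ I) (hj : l + b ≤ J) : 0 ≤ tableWeight I J q α k a l b := by
  rcases le_or_gt (a + l + b) J with hJ | hJ
  · rcases le_or_gt (k + l) I with hI | hI
    · exact (tableWeight_pos h hJ hI).le
    · exact (tableWeight_eq_zero_up h.pos hI hi).ge
  · exact (tableWeight_eq_zero_right h.pos hJ hj).ge

/-- Quadruples `(k, a, l, b)` of natural numbers below `N`. -/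
def tableBox (N : ℕ) : Finset (ℕ × ℕ × ℕ × ℕ) :=
  Finset.range N ×ˢ Finset.range N ×ˢ Finset.range N ×ˢ Finset.range N

lemma mem_tableBox {N : ℕ} {t : ℕ × ℕ × ℕ × ℕ} :
    t ∈ tableBox N ↔ t.1 < N ∧ t.2.1 < N ∧ t.2.2.1 < N ∧ t.2.2.2 < N := by
  simp [tableBox]

/-- The margins leave `k` as the only free entry of the table. A negative entry cannot occur: `(q ^
(-i₁); q)_k` vanishes for `k > i₁`, and the lower parameter `q ^ (1 + j₂ - i₁)` gives a zero when
`i₂ - k > j₁`. -/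
lemma L_term {I J : ℕ} {q α : ℝ} (h : Admissible I J q α) {i₁ j₁ i₂ j₂ k : ℕ} (hi₁ : i₁ ≤ I)
    (hj₁ : j₁ ≤ J) (hj₂ : j₂ ≤ J) (hij : i₁ + j₁ = i₂ + j₂) (hk : k ≤ i₂) :
    q ^ ((2 * (j₁ : ℝ) - (j₁ : ℝ) ^ 2) / 4 - (2 * (j₂ : ℝ) - (j₂ : ℝ) ^ 2) / 4
        + ((i₂ : ℝ) ^ 2 + (i₁ : ℝ) ^ 2) / 4
        + ((i₂ : ℝ) * ((j₂ : ℝ) - 1) + (i₁ : ℝ) * (j₁ : ℝ)) / 2 : ℝ)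
      * ((q ^ (-(I : ℤ))) ^ ((j₁ : ℤ) - (i₂ : ℤ)) * α ^ ((j₂ : ℤ) - (j₁ : ℤ) + (i₂ : ℤ))
          * qPoch (-α * (q ^ (-(I : ℤ)))⁻¹) q ((j₂ : ℤ) - (i₁ : ℤ))
        / (qPoch q q (i₂ : ℤ) * qPoch (-α) q ((i₂ : ℤ) + (j₂ : ℤ))
          * qPoch (q ^ ((J : ℤ) + 1 - (j₁ : ℤ))) q ((j₁ : ℤ) - (j₂ : ℤ))))
      * (q ^ k * (qPoch (q ^ (-(i₂ : ℤ))) q k / qPoch q q k) *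
        ∏ i, (qPoch (![q ^ (-(i₁ : ℤ)), -α * q ^ J, -q * q ^ (-(I : ℤ)) * α⁻¹] i) q k *
          qPoch (![q ^ (-(I : ℤ)), q ^ (1 + (j₂ : ℤ) - (i₁ : ℤ)),
            q ^ ((J : ℤ) + 1 - (i₂ : ℤ) - (j₂ : ℤ))] i * q ^ k) q ((i₂ : ℤ) - k))) =
      if k ≤ i₁ ∧ i₂ - k ≤ j₁ then
        tableWeight I J q α k (i₁ - k) (i₂ - k) (j₁ - (i₂ - k)) else 0 := by
  have hq := h.pos
  have hq1 := h.ne_one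
  obtain ⟨l, rfl⟩ := Nat.exists_eq_add_of_le hk
  have hl : ((k + l : ℕ) : ℤ) - k = (l : ℕ) := by push_cast; ring
  have hz : ∀ m : ℤ, q ^ m = q ^ (m : ℝ) := fun m => (Real.rpow_intCast q m).symm
  simp only [Fin.prod_univ_three, Matrix.cons_val_zero, Matrix.cons_val_one, Matrix.cons_val, hl,
    qPoch_eq_poch, Nat.add_sub_cancel_left]
  split_ifs with hc
  · obtain ⟨a, rfl⟩ := Nat.exists_eq_add_of_le hc.1
    obtain ⟨b, rfl⟩ := Nat.exists_eq_add_of_le hc.2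
    obtain rfl : j₂ = a + b := by omega
    rw [Nat.add_sub_cancel_left, Nat.add_sub_cancel_left, ← table_term hq hq1 h.neg.ne hj₁ hj₂]
    · have e1 : ((l + b : ℕ) : ℤ) - ((k + l : ℕ) : ℤ) = (b : ℤ) - k := by push_cast; ring
      have e2 : ((a + b : ℕ) : ℤ) - ((l + b : ℕ) : ℤ) + ((k + l : ℕ) : ℤ) = ((k + a : ℕ) : ℤ) := by
        push_cast; ring
      have e3 : ((a + b : ℕ) : ℤ) - ((k + a : ℕ) : ℤ) = (b : ℤ) - k := by push_cast; ring
      have e4 : ((k + l : ℕ) : ℤ) + ((a + b : ℕ) : ℤ) = ((k + a + l + b : ℕ) : ℤ) := by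
        push_cast; ring
      have e5 : ((l + b : ℕ) : ℤ) - ((a + b : ℕ) : ℤ) = (l : ℤ) - a := by push_cast; ring
      have e6 : q ^ ((J : ℤ) + 1 - ((l + b : ℕ) : ℤ)) = q ^ ((J : ℝ) + 1 - (l + b)) := by
        rw [hz]; push_cast; rfl
      have e7 : q ^ (-((k + l : ℕ) : ℤ)) = q ^ (-((k : ℝ) + l)) := by rw [hz]; push_cast; rfl
      have e8 : q ^ (-((k + a : ℕ) : ℤ)) = q ^ (-((k : ℝ) + a)) := by rw [hz]; push_cast; rfl
      have e9 : q ^ (-(I : ℤ)) * q ^ k = q ^ ((k : ℝ) - I) := by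
        rw [hz, ← Real.rpow_natCast, ← Real.rpow_add hq]; congr 1; push_cast; ring
      have e10 : q ^ (1 + ((a + b : ℕ) : ℤ) - ((k + a : ℕ) : ℤ)) * q ^ k = q * q ^ b := by
        rw [hz, ← Real.rpow_natCast, ← Real.rpow_add hq, ← pow_succ', ← Real.rpow_natCast]
        congr 1; push_cast; ring
      have e11 : q ^ ((J : ℤ) + 1 - ((k + l : ℕ) : ℤ) - ((a + b : ℕ) : ℤ)) * q ^ k =
          q ^ ((J : ℝ) + 1 - (a + l + b)) := by
        rw [hz, ← Real.rpow_natCast, ← Real.rpow_add hq]; congr 1; push_cast; ring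
      rw [e1, e2, e3, e4, e5, e6, e7, e8, e9, e10, e11, zpow_natCast, qPoch_eq_poch]
      push_cast
      ring
    · refine poch_ne_zero fun t ht => ?_
      have : -α * (q ^ (-(I : ℤ)))⁻¹ * q ^ (-(k : ℝ)) * q ^ t = -α * q ^ ((I : ℝ) - k + t) := by
        rw [Real.rpow_add hq, sub_eq_add_neg, Real.rpow_add hq, Real.rpow_natCast,
          Real.rpow_natCast, zpow_neg, zpow_natCast, inv_inv]
        ring
      rw [this]
      refine h.ne_one_mul ?_
      have h1 : ((t + 1 : ℕ) : ℝ) ≤ k := by exact_mod_cast ht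
      have h2 : (0 : ℝ) ≤ J := Nat.cast_nonneg J
      push_cast at h1
      linarith
  · rw [not_and_or, not_le, not_le] at hc
    rcases hc with hc | hc
    · have : poch q (q ^ (-(i₁ : ℤ))) k = 0 := poch_eq_zero hc (by
        rw [zpow_neg, zpow_natCast]; exact inv_mul_cancel₀ (pow_pos hq _).ne')
      rw [this]; ring
    · have : poch q (q ^ (1 + (j₂ : ℤ) - (i₁ : ℤ)) * q ^ k) l = 0 := by
        refine poch_eq_zero (k := l - 1 - j₁) (by omega) ?_
        rw [← zpow_natCast, ← zpow_natCast, ← zpow_add₀ hq.ne', ← zpow_add₀ hq.ne']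
        rw [show (1 + (j₂ : ℤ) - (i₁ : ℤ)) + k + ((l - 1 - j₁ : ℕ) : ℤ) = 0 by omega, zpow_zero]
      rw [this]; ring

/-- The vertex weight as a sum over contingency tables. -/
lemma L_eq_sum_tableBox {I J : ℕ} {q α : ℝ} (h : Admissible I J q α) (i₁ : Fin (I + 1))
    (j₁ : Fin (J + 1)) (i₂ : Fin (I + 1)) (j₂ : Fin (J + 1)) :
    L I J q α i₁ j₁ i₂ j₂ = ∑ t ∈ tableBox (I + J + 1),
      if t.1 + t.2.1 = i₁ ∧ t.2.2.1 + t.2.2.2 = j₁ ∧ t.1 + t.2.2.1 = i₂ ∧ t.2.1 + t.2.2.2 = j₂ then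
        tableWeight I J q α t.1 t.2.1 t.2.2.1 t.2.2.2 else 0 := by
  have hq := h.pos
  have hq1 := h.ne_one
  obtain ⟨i₁, hi₁⟩ := i₁
  obtain ⟨j₁, hj₁⟩ := j₁
  obtain ⟨i₂, hi₂⟩ := i₂
  obtain ⟨j₂, hj₂⟩ := j₂
  unfold L
  simp only
  split_ifs with hij
  swap
  · symm
    refine Finset.sum_eq_zero fun t _ => if_neg fun ht => hij ?_
    omega
  have hterm : ∀ k ∈ Finset.range (i₂ + 1), _ = if k ≤ i₁ ∧ i₂ - k ≤ j₁ then
      tableWeight I J q α k (i₁ - k) (i₂ - k) (j₁ - (i₂ - k)) else 0 :=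
    fun k hk => L_term h (Nat.lt_succ_iff.1 hi₁) (Nat.lt_succ_iff.1 hj₁) (Nat.lt_succ_iff.1 hj₂) hij
      (Nat.lt_succ_iff.1 (Finset.mem_range.1 hk))
  rw [regPhi, Finset.mul_sum, Finset.sum_congr rfl hterm, ← Finset.sum_filter, ← Finset.sum_filter]
  refine Finset.sum_nbij' (fun k => (k, i₁ - k, i₂ - k, j₁ - (i₂ - k))) (fun t => t.1) ?_ ?_ ?_ ?_ ?_
  · intro k hk
    simp only [Finset.mem_filter, Finset.mem_range, mem_tableBox] at hk ⊢
    omega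
  · intro t ht
    simp only [Finset.mem_filter, Finset.mem_range, mem_tableBox] at ht ⊢
    omega
  · intro k _; rfl
  · rintro ⟨k, a, l, b⟩ ht
    simp only [Finset.mem_filter, mem_tableBox] at ht
    simp only [Prod.mk.injEq, true_and]
    omega
  · intro k _; rfl

/-! ### Stochasticity and invariant weights -/

lemma L_nonneg {I J : ℕ} {q α : ℝ} (h : Admissible I J q α) (i₁ : Fin (I + 1))
    (j₁ : Fin (J + 1)) (i₂ : Fin (I + 1)) (j₂ : Fin (J + 1)) : 0 ≤ L I J q α i₁ j₁ i₂ j₂ := by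
  rw [L_eq_sum_tableBox h]
  refine Finset.sum_nonneg fun t _ => ?_
  split_ifs with ht
  · exact tableWeight_nonneg h (by omega) (by omega)
  · exact le_rfl

/-- The source of all mixing below. A table for the exchange has `k = b`; the choice `k = min i j`
gives `a + l + b = max i j ≤ I`, hence a positive weight. -/
lemma L_swap_pos {I : ℕ} {q α : ℝ} (h : Admissible I I q α) (i j : Fin (I + 1)) :
    0 < L I I q α i j j i := by
  rw [L_eq_sum_tableBox h]
  refine Finset.sum_pos' (fun t _ => ?_) 
    ⟨(min (i : ℕ) j, i - min (i : ℕ) j, j - min (i : ℕ) j, min (i : ℕ) j), ?_, ?_⟩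
  · split_ifs with ht
    · exact tableWeight_nonneg h (by omega) (by omega)
    · exact le_rfl
  · rw [mem_tableBox]
    simp only
    omega
  · simp only
    rw [if_pos (by omega)]
    exact tableWeight_pos h (by omega) (by omega)

lemma L_conservation {I J : ℕ} {q α : ℝ} {i₁ : Fin (I + 1)} {j₁ : Fin (J + 1)} {i₂ : Fin (I + 1)}
    {j₂ : Fin (J + 1)} (h : L I J q α i₁ j₁ i₂ j₂ ≠ 0) : (i₁ : ℕ) + j₁ = i₂ + j₂ := by
  by_contra hc
  exact h (if_neg hc)

/-- Row sums are the incoming numbers, so this form serves stochasticity. The column form below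
fixes the outgoing numbers and serves the images of product weights. -/
lemma sum_tableBox_rows {N i j : ℕ} (hi : i < N) (hj : j < N) (f : ℕ → ℕ → ℕ → ℕ → ℝ) :
    (∑ t ∈ tableBox N, if t.1 + t.2.1 = i ∧ t.2.2.1 + t.2.2.2 = j then
      f t.1 t.2.1 t.2.2.1 t.2.2.2 else 0) =
    ∑ x ∈ Finset.HasAntidiagonal.antidiagonal i, ∑ y ∈ Finset.HasAntidiagonal.antidiagonal j,
      f x.1 x.2 y.1 y.2 := by
  rw [← Finset.sum_filter, ← Finset.sum_product']
  refine Finset.sum_nbij' (fun t => ((t.1, t.2.1), (t.2.2.1, t.2.2.2)))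
    (fun p => (p.1.1, p.1.2, p.2.1, p.2.2)) ?_ ?_ ?_ ?_ ?_
  · intro t ht
    simpa using (Finset.mem_filter.1 ht).2
  · intro p hp
    simp only [Finset.mem_product, Finset.HasAntidiagonal.mem_antidiagonal] at hp
    simp only [Finset.mem_filter, mem_tableBox]
    omega
  · intro t _; rfl
  · intro t _; rfl
  · intro t _; rfl

lemma sum_tableBox_columns {N i j : ℕ} (hi : i < N) (hj : j < N) (f : ℕ → ℕ → ℕ → ℕ → ℝ) :
    (∑ t ∈ tableBox N, if t.1 + t.2.2.1 = i ∧ t.2.1 + t.2.2.2 = j then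
      f t.1 t.2.1 t.2.2.1 t.2.2.2 else 0) =
    ∑ x ∈ Finset.HasAntidiagonal.antidiagonal i, ∑ y ∈ Finset.HasAntidiagonal.antidiagonal j,
      f x.1 y.1 x.2 y.2 := by
  rw [← Finset.sum_filter, ← Finset.sum_product']
  refine Finset.sum_nbij' (fun t => ((t.1, t.2.2.1), (t.2.1, t.2.2.2)))
    (fun p => (p.1.1, p.2.1, p.1.2, p.2.2)) ?_ ?_ ?_ ?_ ?_
  · intro t ht
    simpa using (Finset.mem_filter.1 ht).2
  · intro p hp
    simp only [Finset.mem_product, Finset.HasAntidiagonal.mem_antidiagonal] at hp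
    simp only [Finset.mem_filter, mem_tableBox]
    omega
  · intro t _; rfl
  · intro t _; rfl
  · intro t _; rfl

lemma poch_neg_ne_zero {I J : ℕ} {q α : ℝ} (h : Admissible I J q α) {n : ℕ} (hn : n ≤ I + J) :
    poch q (-α) n ≠ 0 := by
  refine poch_ne_zero fun t ht => ?_
  rw [← Real.rpow_natCast]
  refine h.ne_one_mul ?_
  have : ((t + 1 : ℕ) : ℝ) ≤ (I + J : ℕ) := by exact_mod_cast ht.trans_le hn
  push_cast at this
  linarith

/-- Two nested Chu–Vandermonde sums. The inner one has the product parameter `q ^ (k - I) · (-α q ^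
(I - k)) = -α`, which is independent of `k`, so the outer sum decouples. The results combine to
`(-α; q)_j (-α q ^ j; q)_i = (-α; q)_{i+j}`. -/
lemma sum_tableWeight {I J : ℕ} {q α : ℝ} (h : Admissible I J q α) {i j : ℕ} (hi : i ≤ I)
    (hj : j ≤ J) :
    ∑ x ∈ Finset.HasAntidiagonal.antidiagonal i, ∑ y ∈ Finset.HasAntidiagonal.antidiagonal j,
      tableWeight I J q α x.1 x.2 y.1 y.2 = 1 := by
  have hq := h.pos
  have hq1 := h.ne_one
  have hci := poch_self_ne_zero hq hq1 i
  have hcj := poch_self_ne_zero hq hq1 j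
  have hD := poch_neg_ne_zero h (n := i + j) (by omega)
  have inner : ∀ x ∈ Finset.HasAntidiagonal.antidiagonal i,
      ∑ y ∈ Finset.HasAntidiagonal.antidiagonal j, tableWeight I J q α x.1 x.2 y.1 y.2 =
      poch q q i * poch q (-α) j / poch q (-α) (i + j) * (poch q (-α * q ^ J) x.1 / poch q q x.1 *
        (poch q (q ^ ((j : ℝ) - J)) x.2 / poch q q x.2) * (-α * q ^ J) ^ x.2) := by
    intro x hx
    rw [Finset.HasAntidiagonal.mem_antidiagonal] at hx
    have hA : q ^ ((x.1 : ℝ) - I) * (-α * q ^ ((I : ℝ) - x.1)) = -α := by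
      rw [mul_left_comm, ← Real.rpow_add hq]; simp
    have key := sum_antidiagonal_poch hq hq1 (q ^ ((x.1 : ℝ) - I)) (-α * q ^ ((I : ℝ) - x.1)) j
    rw [hA] at key
    have e : ∀ y ∈ Finset.HasAntidiagonal.antidiagonal j, tableWeight I J q α x.1 x.2 y.1 y.2 =
        poch q q i * poch q q j / poch q (-α) (i + j) * (poch q (-α * q ^ J) x.1 / poch q q x.1 *
          (poch q (q ^ ((j : ℝ) - J)) x.2 / poch q q x.2) * (-α * q ^ J) ^ x.2) *
        (poch q (q ^ ((x.1 : ℝ) - I)) y.1 / poch q q y.1 *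
          (poch q (-α * q ^ ((I : ℝ) - x.1)) y.2 / poch q q y.2) * (q ^ ((x.1 : ℝ) - I)) ^ y.2) := by
      intro y hy
      rw [Finset.HasAntidiagonal.mem_antidiagonal] at hy
      rw [tableWeight, add_assoc (x.1 + x.2), hx, hy, ← Nat.cast_add, hy]
      simp only [div_eq_mul_inv, mul_inv]
      ring
    rw [Finset.sum_congr rfl e, ← Finset.mul_sum, key]
    field_simp
  have hB : -α * q ^ J * q ^ ((j : ℝ) - J) = -α * q ^ j := by
    rw [mul_assoc, ← Real.rpow_natCast, ← Real.rpow_add hq, add_sub_cancel, Real.rpow_natCast]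
  have key := sum_antidiagonal_poch hq hq1 (-α * q ^ J) (q ^ ((j : ℝ) - J)) i
  rw [Finset.sum_congr rfl inner, ← Finset.mul_sum, key, hB]
  rw [add_comm i j, poch_add] at hD ⊢
  rw [div_mul_div_comm, mul_right_comm, mul_comm (poch q q i * _), mul_comm (_ * _) (poch q q i),
    mul_left_comm, mul_div_mul_left _ _ hci, mul_comm, div_self (by rwa [mul_comm])]

lemma sum_L {I J : ℕ} {q α : ℝ} (h : Admissible I J q α) (i₁ : Fin (I + 1)) (j₁ : Fin (J + 1)) :
    ∑ i₂, ∑ j₂, L I J q α i₁ j₁ i₂ j₂ = 1 := by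
  rw [← sum_tableWeight h (Nat.lt_succ_iff.1 i₁.2) (Nat.lt_succ_iff.1 j₁.2),
    ← sum_tableBox_rows (N := I + J + 1) (by omega) (by omega)]
  simp_rw [L_eq_sum_tableBox h]
  simp_rw [Finset.sum_comm (s := Finset.univ) (t := tableBox (I + J + 1))]
  refine Finset.sum_congr rfl fun t _ => ?_
  split_ifs with ht
  · by_cases hr : t.1 + t.2.2.1 < I + 1 ∧ t.2.1 + t.2.2.2 < J + 1
    · rw [Finset.sum_eq_single ⟨t.1 + t.2.2.1, hr.1⟩, Finset.sum_eq_single ⟨t.2.1 + t.2.2.2, hr.2⟩]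
      · rw [if_pos ⟨ht.1, ht.2, rfl, rfl⟩]
      · exact fun j _ hj => if_neg fun hc => hj (Fin.ext hc.2.2.2.symm)
      · simp
      · exact fun i _ hi => Finset.sum_eq_zero fun j _ =>
          if_neg fun hc => hi (Fin.ext hc.2.2.1.symm)
      · simp
    · have hz : ∀ (i : Fin (I + 1)) (j : Fin (J + 1)), ¬ (t.1 + t.2.1 = (i₁ : ℕ) ∧
          t.2.2.1 + t.2.2.2 = (j₁ : ℕ) ∧ t.1 + t.2.2.1 = i ∧ t.2.1 + t.2.2.2 = j) :=
        fun i j hc => hr ⟨hc.2.2.1 ▸ i.2, hc.2.2.2 ▸ j.2⟩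
      simp only [hz, if_false, Finset.sum_const_zero]
      rw [not_and_or, not_lt, not_lt] at hr
      symm
      rcases hr with hr | hr
      · exact tableWeight_eq_zero_up h.pos (by omega) (by omega)
      · exact tableWeight_eq_zero_right h.pos (by omega) (by omega)
  · exact Finset.sum_eq_zero fun i _ => Finset.sum_eq_zero fun j _ =>
      if_neg fun hc => ht ⟨hc.1, hc.2.1⟩

lemma L_zero {I J : ℕ} {q α : ℝ} (h : Admissible I J q α) : L I J q α 0 0 0 0 = 1 := by
  rw [← sum_L h 0 0, Finset.sum_eq_single 0, Finset.sum_eq_single 0]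
  · intro j _ hj
    by_contra hc
    have h1 := L_conservation hc
    rw [Fin.val_zero, Fin.val_zero] at h1
    exact hj (Fin.ext (by rw [Fin.val_zero]; omega))
  · simp
  · intro i _ hi
    refine Finset.sum_eq_zero fun j _ => ?_
    by_contra hc
    have h1 := L_conservation hc
    rw [Fin.val_zero, Fin.val_zero] at h1
    exact hi (Fin.ext (by rw [Fin.val_zero]; omega))
  · simp

/-- The unnormalized weight `p ^ n (q ^ (-K); q)_n / (q; q)_n` of the `q`-negative binomial
distribution. -/
def nbTerm (q : ℝ) (K : ℕ) (p : ℝ) (n : ℕ) : ℝ :=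
  p ^ n * (poch q (q ^ (-(K : ℝ))) n / poch q q n)

lemma nbTerm_eq_zero {q : ℝ} (hq : 0 < q) {K n : ℕ} (p : ℝ) (hn : K < n) : nbTerm q K p n = 0 := by
  have : poch q (q ^ (-(K : ℝ))) n = 0 := poch_eq_zero hn (by
    rw [← Real.rpow_natCast, ← Real.rpow_add hq]; simp)
  rw [nbTerm, this, zero_div, mul_zero]

/-- The sum over the incoming lines, organized by contingency tables. -/
lemma sum_nbTerm_L {I J : ℕ} {q α : ℝ} (h : Admissible I J q α) (p s : ℝ) (i₂ : Fin (I + 1))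
    (j₂ : Fin (J + 1)) :
    ∑ i₁ : Fin (I + 1), ∑ j₁ : Fin (J + 1),
      nbTerm q I p i₁ * nbTerm q J s j₁ * L I J q α i₁ j₁ i₂ j₂ =
    poch q (q ^ (-(I : ℝ))) i₂ * poch q (q ^ (-(J : ℝ))) j₂ / poch q (-α) (i₂ + j₂) *
      ∑ x ∈ Finset.HasAntidiagonal.antidiagonal (i₂ : ℕ), p ^ x.1 * s ^ x.2 *
        (poch q (-α * q ^ J) x.1 / poch q q x.1 *
          (poch q (q ^ ((j₂ : ℝ) - J)) x.2 / poch q q x.2)) *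
        ∑ y ∈ Finset.HasAntidiagonal.antidiagonal (j₂ : ℕ), (p * (-α * q ^ J)) ^ y.1 *
          (s * q ^ ((x.1 : ℝ) - I)) ^ y.2 *
          (poch q (q ^ ((x.1 : ℝ) - I)) y.1 / poch q q y.1 *
            (poch q (-α * q ^ ((I : ℝ) - x.1)) y.2 / poch q q y.2)) := by
  have hq := h.pos
  have hq1 := h.ne_one
  have hc := poch_self_ne_zero hq hq1
  have step : ∑ i₁ : Fin (I + 1), ∑ j₁ : Fin (J + 1),
      nbTerm q I p i₁ * nbTerm q J s j₁ * L I J q α i₁ j₁ i₂ j₂ =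
      ∑ x ∈ Finset.HasAntidiagonal.antidiagonal (i₂ : ℕ),
        ∑ y ∈ Finset.HasAntidiagonal.antidiagonal (j₂ : ℕ),
        nbTerm q I p (x.1 + y.1) * nbTerm q J s (x.2 + y.2) *
          tableWeight I J q α x.1 y.1 x.2 y.2 := by
    rw [← sum_tableBox_columns (N := I + J + 1) (by omega) (by omega) (fun k a l b =>
      nbTerm q I p (k + a) * nbTerm q J s (l + b) * tableWeight I J q α k a l b)]
    simp_rw [L_eq_sum_tableBox h, Finset.mul_sum]
    simp_rw [Finset.sum_comm (s := Finset.univ) (t := tableBox (I + J + 1))]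
    refine Finset.sum_congr rfl fun t _ => ?_
    split_ifs with ht
    · by_cases hr : t.1 + t.2.1 < I + 1 ∧ t.2.2.1 + t.2.2.2 < J + 1
      · rw [Finset.sum_eq_single ⟨t.1 + t.2.1, hr.1⟩,
          Finset.sum_eq_single ⟨t.2.2.1 + t.2.2.2, hr.2⟩]
        · rw [if_pos ⟨rfl, rfl, ht.1, ht.2⟩]
        · exact fun j _ hj => by
            rw [if_neg fun hc => hj (Fin.ext hc.2.1.symm), mul_zero]
        · simp
        · exact fun i _ hi => Finset.sum_eq_zero fun j _ => by
            rw [if_neg fun hc => hi (Fin.ext hc.1.symm), mul_zero]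
        · simp
      · have hz : ∀ (i : Fin (I + 1)) (j : Fin (J + 1)), ¬ (t.1 + t.2.1 = (i : ℕ) ∧
            t.2.2.1 + t.2.2.2 = (j : ℕ) ∧ t.1 + t.2.2.1 = i₂ ∧ t.2.1 + t.2.2.2 = j₂) :=
          fun i j hc => hr ⟨hc.1 ▸ i.2, hc.2.1 ▸ j.2⟩
        simp only [hz, if_false, mul_zero, Finset.sum_const_zero]
        rw [not_and_or, not_lt, not_lt] at hr
        rcases hr with hr | hr
        · rw [nbTerm_eq_zero hq p (by omega), zero_mul, zero_mul]
        · rw [nbTerm_eq_zero hq s (by omega), mul_zero, zero_mul]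
    · exact Finset.sum_eq_zero fun i _ => Finset.sum_eq_zero fun j _ => by
        rw [if_neg fun hc => ht ⟨hc.2.2.1, hc.2.2.2⟩, mul_zero]
  rw [step, Finset.mul_sum]
  refine Finset.sum_congr rfl fun x hx => ?_
  rw [Finset.mul_sum, Finset.mul_sum]
  refine Finset.sum_congr rfl fun y hy => ?_
  rw [Finset.HasAntidiagonal.mem_antidiagonal] at hx hy
  have e1 : poch q (q ^ (-(I : ℝ))) (x.1 + y.1) =
      poch q (q ^ (-(I : ℝ))) x.1 * poch q (q ^ ((x.1 : ℝ) - I)) y.1 := by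
    rw [poch_add, ← Real.rpow_natCast, ← Real.rpow_add hq]; congr 3; ring
  have e2 : poch q (q ^ (-(I : ℝ))) i₂ =
      poch q (q ^ (-(I : ℝ))) x.1 * poch q (q ^ ((x.1 : ℝ) - I)) x.2 := by
    rw [← hx, poch_add, ← Real.rpow_natCast, ← Real.rpow_add hq]; congr 3; ring
  -- Both sides equal `(q ^ (-J); q)_{a+l+b}`. This trades the row sum `l + b` for the column sum
  -- `j₂`, so that the factor leaves the inner sum.
  have e3 : poch q (q ^ (-(J : ℝ))) (x.2 + y.2) * poch q (q ^ ((x.2 + y.2 : ℝ) - J)) y.1 =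
      poch q (q ^ (-(J : ℝ))) j₂ * poch q (q ^ ((j₂ : ℝ) - J)) x.2 := by
    have a1 : poch q (q ^ (-(J : ℝ))) (x.2 + y.2 + y.1) =
        poch q (q ^ (-(J : ℝ))) (x.2 + y.2) * poch q (q ^ ((x.2 + y.2 : ℝ) - J)) y.1 := by
      rw [poch_add, ← Real.rpow_natCast, ← Real.rpow_add hq]; congr 3; push_cast; ring
    have a2 : poch q (q ^ (-(J : ℝ))) (j₂ + x.2) =
        poch q (q ^ (-(J : ℝ))) j₂ * poch q (q ^ ((j₂ : ℝ) - J)) x.2 := by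
      rw [poch_add, ← Real.rpow_natCast, ← Real.rpow_add hq]; congr 3; ring
    rw [← a1, ← a2]; congr 1; omega
  have e4 : x.1 + y.1 + x.2 + y.2 = (i₂ : ℕ) + j₂ := by omega
  rw [tableWeight, e4, nbTerm, nbTerm, e1, e2, mul_pow, mul_pow, pow_add, pow_add]
  have h5 := hc (x.1 + y.1); have h6 := hc (x.2 + y.2)
  calc _ = poch q q (x.1 + y.1) / poch q q (x.1 + y.1) *
        (poch q q (x.2 + y.2) / poch q q (x.2 + y.2)) *
        (poch q (q ^ (-(J : ℝ))) (x.2 + y.2) * poch q (q ^ ((x.2 + y.2 : ℝ) - J)) y.1) *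
        (p ^ x.1 * p ^ y.1 * (s ^ x.2 * s ^ y.2) * (poch q (q ^ (-(I : ℝ))) x.1 *
        poch q (q ^ ((x.1 : ℝ) - I)) y.1) * poch q (q ^ ((x.1 : ℝ) - I)) x.2 *
        (poch q (-α * q ^ J) x.1 * (-α * q ^ J) ^ y.1 * (q ^ ((x.1 : ℝ) - I)) ^ y.2 *
          poch q (-α * q ^ ((I : ℝ) - x.1)) y.2) /
        (poch q q x.1 * poch q q y.1 * poch q q x.2 * poch q q y.2 *
          poch q (-α) ((i₂ : ℕ) + j₂))) := by
        simp only [div_eq_mul_inv, mul_inv]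
        ring
    _ = _ := by
        rw [div_self h5, div_self h6, e3]
        simp only [div_eq_mul_inv, mul_inv]
        ring

lemma poch_neg_split {I J : ℕ} {q α : ℝ} (h : Admissible I J q α) (i₂ : Fin (I + 1))
    (j₂ : Fin (J + 1)) (u v : ℝ) :
    u * v / poch q (-α) (i₂ + j₂) * (poch q (-α) j₂ / poch q q j₂ *
      (poch q (-α * q ^ (j₂ : ℕ)) i₂ / poch q q i₂)) = u / poch q q i₂ * (v / poch q q j₂) := by
  have hD := poch_neg_ne_zero h (n := (i₂ : ℕ) + j₂) (by omega)
  have e : poch q (-α) (i₂ + j₂) = poch q (-α) j₂ * poch q (-α * q ^ (j₂ : ℕ)) i₂ := by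
    rw [add_comm, poch_add]
  calc _ = (poch q (-α) j₂ * poch q (-α * q ^ (j₂ : ℕ)) i₂) / poch q (-α) (i₂ + j₂) *
        (u / poch q q i₂ * (v / poch q q j₂)) := by ring
    _ = _ := by rw [← e, div_self hD, one_mul]

/-- Product weights whose parameters have the ratio `-α q ^ J` are invariant. -/
lemma sum_nbTerm_L_invariant {I J : ℕ} {q α : ℝ} (h : Admissible I J q α) (p : ℝ)
    (i₂ : Fin (I + 1)) (j₂ : Fin (J + 1)) :
    ∑ i₁ : Fin (I + 1), ∑ j₁ : Fin (J + 1),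
      nbTerm q I p i₁ * nbTerm q J (p * (-α * q ^ J)) j₁ * L I J q α i₁ j₁ i₂ j₂ =
      nbTerm q I p i₂ * nbTerm q J (p * (-α * q ^ J)) j₂ := by
  have hq := h.pos
  have hq1 := h.ne_one
  rw [sum_nbTerm_L h]
  set s := p * (-α * q ^ J) with hs
  -- For this ratio of parameters the powers of `s` combine to `s ^ j₂`, and the first
  -- Chu–Vandermonde form gives a value independent of `k`.
  have inner : ∀ x : ℕ × ℕ, ∑ y ∈ Finset.HasAntidiagonal.antidiagonal (j₂ : ℕ), s ^ y.1 *
      (s * q ^ ((x.1 : ℝ) - I)) ^ y.2 * (poch q (q ^ ((x.1 : ℝ) - I)) y.1 / poch q q y.1 *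
        (poch q (-α * q ^ ((I : ℝ) - x.1)) y.2 / poch q q y.2)) =
      s ^ (j₂ : ℕ) * (poch q (-α) j₂ / poch q q j₂) := by
    intro x
    have hA : q ^ ((x.1 : ℝ) - I) * (-α * q ^ ((I : ℝ) - x.1)) = -α := by
      rw [mul_left_comm, ← Real.rpow_add hq]; simp
    have key := sum_antidiagonal_poch hq hq1 (q ^ ((x.1 : ℝ) - I)) (-α * q ^ ((I : ℝ) - x.1)) j₂
    rw [hA] at key
    rw [← key, Finset.mul_sum]
    refine Finset.sum_congr rfl fun y hy => ?_
    rw [← Finset.HasAntidiagonal.mem_antidiagonal.1 hy, mul_pow, pow_add]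
    ring
  simp_rw [inner]
  have hB : -α * q ^ J * q ^ ((j₂ : ℝ) - J) = -α * q ^ (j₂ : ℕ) := by
    rw [mul_assoc, ← Real.rpow_natCast, ← Real.rpow_add hq, add_sub_cancel, Real.rpow_natCast]
  have key := sum_antidiagonal_poch hq hq1 (-α * q ^ J) (q ^ ((j₂ : ℝ) - J)) i₂
  rw [hB] at key
  have outer : ∀ x ∈ Finset.HasAntidiagonal.antidiagonal (i₂ : ℕ), p ^ x.1 * s ^ x.2 *
        (poch q (-α * q ^ J) x.1 / poch q q x.1 *
          (poch q (q ^ ((j₂ : ℝ) - J)) x.2 / poch q q x.2)) *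
        (s ^ (j₂ : ℕ) * (poch q (-α) j₂ / poch q q j₂)) =
      p ^ (i₂ : ℕ) * s ^ (j₂ : ℕ) * (poch q (-α) j₂ / poch q q j₂) *
        (poch q (-α * q ^ J) x.1 / poch q q x.1 *
          (poch q (q ^ ((j₂ : ℝ) - J)) x.2 / poch q q x.2) * (-α * q ^ J) ^ x.2) := by
    intro x hx
    have : p ^ x.1 * s ^ x.2 = p ^ (i₂ : ℕ) * (-α * q ^ J) ^ x.2 := by
      rw [← Finset.HasAntidiagonal.mem_antidiagonal.1 hx, hs, mul_pow, pow_add]; ring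
    rw [this]; ring
  rw [Finset.sum_congr rfl outer, ← Finset.mul_sum, key, nbTerm, nbTerm]
  have := poch_neg_split h i₂ j₂ (poch q (q ^ (-(I : ℝ))) i₂) (poch q (q ^ (-(J : ℝ))) j₂)
  linear_combination p ^ (i₂ : ℕ) * s ^ (j₂ : ℕ) * this

/-- Product weights whose parameters have the ratio `q ^ J` are mapped to product weights. -/
lemma sum_nbTerm_L_exchange {I J : ℕ} {q α : ℝ} (h : Admissible I J q α) (p : ℝ)
    (i₂ : Fin (I + 1)) (j₂ : Fin (J + 1)) :
    ∑ i₁ : Fin (I + 1), ∑ j₁ : Fin (J + 1),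
      nbTerm q I p i₁ * nbTerm q J (p * q ^ J) j₁ * L I J q α i₁ j₁ i₂ j₂ =
      nbTerm q I (p * q ^ J) i₂ * nbTerm q J (p * q ^ J * q ^ (-(I : ℝ))) j₂ := by
  have hq := h.pos
  have hq1 := h.ne_one
  rw [sum_nbTerm_L h]
  set s := p * q ^ J with hs
  have inner : ∀ x : ℕ × ℕ, ∑ y ∈ Finset.HasAntidiagonal.antidiagonal (j₂ : ℕ),
      (p * (-α * q ^ J)) ^ y.1 * (s * q ^ ((x.1 : ℝ) - I)) ^ y.2 *
        (poch q (q ^ ((x.1 : ℝ) - I)) y.1 / poch q q y.1 *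
        (poch q (-α * q ^ ((I : ℝ) - x.1)) y.2 / poch q q y.2)) =
      (s * q ^ ((x.1 : ℝ) - I)) ^ (j₂ : ℕ) * (poch q (-α) j₂ / poch q q j₂) := by
    intro x
    have hA : q ^ ((x.1 : ℝ) - I) * (-α * q ^ ((I : ℝ) - x.1)) = -α := by
      rw [mul_left_comm, ← Real.rpow_add hq]; simp
    have key := sum_antidiagonal_poch' hq hq1 (q ^ ((x.1 : ℝ) - I)) (-α * q ^ ((I : ℝ) - x.1)) j₂
    rw [hA] at key
    -- For this ratio of parameters the summation appears in its second form. Its value keeps a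
    -- factor `q ^ (k j₂)`, which is just what the outer sum needs to take the second form as well.
    have hpD : p * (-α * q ^ J) = s * q ^ ((x.1 : ℝ) - I) * (-α * q ^ ((I : ℝ) - x.1)) := by
      rw [mul_assoc, hA, hs]; ring
    rw [← key, Finset.mul_sum, hpD]
    refine Finset.sum_congr rfl fun y hy => ?_
    rw [← Finset.HasAntidiagonal.mem_antidiagonal.1 hy, mul_pow (s * _), pow_add]
    ring
  simp_rw [inner]
  have hB : -α * q ^ J * q ^ ((j₂ : ℝ) - J) = -α * q ^ (j₂ : ℕ) := by
    rw [mul_assoc, ← Real.rpow_natCast, ← Real.rpow_add hq, add_sub_cancel, Real.rpow_natCast]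
  have key := sum_antidiagonal_poch' hq hq1 (-α * q ^ J) (q ^ ((j₂ : ℝ) - J)) i₂
  rw [hB] at key
  have outer : ∀ x ∈ Finset.HasAntidiagonal.antidiagonal (i₂ : ℕ), p ^ x.1 * s ^ x.2 *
        (poch q (-α * q ^ J) x.1 / poch q q x.1 *
          (poch q (q ^ ((j₂ : ℝ) - J)) x.2 / poch q q x.2)) *
        ((s * q ^ ((x.1 : ℝ) - I)) ^ (j₂ : ℕ) * (poch q (-α) j₂ / poch q q j₂)) =
      s ^ (i₂ : ℕ) * (s * q ^ (-(I : ℝ))) ^ (j₂ : ℕ) * (poch q (-α) j₂ / poch q q j₂) *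
        (poch q (-α * q ^ J) x.1 / poch q q x.1 *
          (poch q (q ^ ((j₂ : ℝ) - J)) x.2 / poch q q x.2) * (q ^ ((j₂ : ℝ) - J)) ^ x.1) := by
    intro x hx
    have e1 : (s * q ^ ((x.1 : ℝ) - I)) ^ (j₂ : ℕ) =
        (s * q ^ (-(I : ℝ))) ^ (j₂ : ℕ) * (q ^ (j₂ : ℝ)) ^ x.1 := by
      rw [Real.rpow_natCast, ← pow_mul, mul_comm (j₂ : ℕ), pow_mul, ← mul_pow, mul_assoc s,
        ← Real.rpow_natCast q x.1, ← Real.rpow_add hq]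
      congr 3; ring
    have e2 : (q ^ ((j₂ : ℝ) - J)) ^ x.1 * (q ^ J) ^ x.1 = (q ^ (j₂ : ℝ)) ^ x.1 := by
      rw [← mul_pow, ← Real.rpow_natCast q J, ← Real.rpow_add hq, sub_add_cancel]
    rw [e1, ← e2, ← Finset.HasAntidiagonal.mem_antidiagonal.1 hx, pow_add s,
      show s ^ x.1 = p ^ x.1 * (q ^ J) ^ x.1 by rw [hs, mul_pow]]
    ring
  rw [Finset.sum_congr rfl outer, ← Finset.mul_sum, key, nbTerm, nbTerm]
  have := poch_neg_split h i₂ j₂ (poch q (q ^ (-(I : ℝ))) i₂) (poch q (q ^ (-(J : ℝ))) j₂)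
  linear_combination s ^ (i₂ : ℕ) * (s * q ^ (-(I : ℝ))) ^ (j₂ : ℕ) * this

/-! ### The `q`-negative binomial laws at one vertex -/

lemma toReal_qNB (I : ℕ) {q : ℝ} (hq : 0 < q) (hq1 : q ≠ 1) {p : ℝ} (hp : p ≤ 0)
    (n : Fin (I + 1)) :
    (qNB I hq hq1 p hp n).toReal =
      nbTerm q I p n * (∏ k ∈ Finset.range I, (1 - p * q ^ (-(I : ℤ)) * q ^ k))⁻¹ := by
  have hn := Nat.lt_succ_iff.1 n.2
  have e : nbTerm q I p n = p ^ (n : ℕ) * (qPoch (q ^ (-(I : ℤ))) q n / qPoch q q n) := by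
    rw [nbTerm, qPoch_eq_poch, qPoch_eq_poch, ← Real.rpow_intCast]; push_cast; rfl
  have h0 := mul_nonneg (qNB_term_nonneg hq hq1 hp hn) (inv_pos.2 (prod_pos' hq hp I)).le
  rw [qNB, PMF.ofFintype_apply, qNBWeight_eq hq hq1 hp, ENNReal.toReal_ofReal h0, e]

/-- The vertex weights `K` map the product of the laws `π` (vertical) and `ρ` (horizontal) of the
incoming lines to the product of the laws `π'` and `ρ'` of the outgoing lines. -/
def MapsProduct {I : ℕ} (K : Fin (I + 1) → Fin (I + 1) → Fin (I + 1) → Fin (I + 1) → ℝ)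
    (π ρ π' ρ' : PMF (Fin (I + 1))) : Prop :=
  ∀ i' j', ∑ i, ∑ j, (π i).toReal * (ρ j).toReal * K i j i' j' = (π' i').toReal * (ρ' j').toReal

lemma mapsProduct_invariant {I : ℕ} {q α : ℝ} (h : Admissible I I q α) {p : ℝ} (hp : p ≤ 0)
    (hs : p * (-α * q ^ I) ≤ 0) :
    MapsProduct (L I I q α) (qNB I h.pos h.ne_one p hp) (qNB I h.pos h.ne_one _ hs)
      (qNB I h.pos h.ne_one p hp) (qNB I h.pos h.ne_one _ hs) := by
  intro i' j'
  have key := sum_nbTerm_L_invariant h p i' j'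
  simp only [toReal_qNB]
  rw [mul_mul_mul_comm, ← key, Finset.sum_mul]
  refine Finset.sum_congr rfl fun i _ => ?_
  rw [Finset.sum_mul]
  exact Finset.sum_congr rfl fun j _ => by ring

/-- Since `J = I`, the outgoing horizontal parameter `p q ^ J q ^ (-I)` is `p` again: the vertical
and the horizontal law trade places. -/
lemma mapsProduct_exchange {I : ℕ} {q α : ℝ} (h : Admissible I I q α) {p s : ℝ} (hp : p ≤ 0)
    (hs : s ≤ 0) (hps : s = p * q ^ I) :
    MapsProduct (L I I q α) (qNB I h.pos h.ne_one p hp) (qNB I h.pos h.ne_one s hs)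
      (qNB I h.pos h.ne_one s hs) (qNB I h.pos h.ne_one p hp) := by
  intro i' j'
  have key := sum_nbTerm_L_exchange h p i' j'
  have e : p * q ^ I * q ^ (-(I : ℝ)) = p := by
    rw [mul_assoc, ← Real.rpow_natCast, ← Real.rpow_add h.pos]; simp
  rw [e, ← hps] at key
  simp only [toReal_qNB]
  rw [mul_mul_mul_comm, ← key, Finset.sum_mul]
  refine Finset.sum_congr rfl fun i _ => ?_
  rw [Finset.sum_mul]
  exact Finset.sum_congr rfl fun j _ => by ring

/-! ### Transfer operators -/

/-- Stochastic vertex weights that conserve the number of lines and give the exchange of the two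
incoming stacks of lines at least the probability `ε`. -/
structure IsVertexKernel {I : ℕ}
    (K : Fin (I + 1) → Fin (I + 1) → Fin (I + 1) → Fin (I + 1) → ℝ) (ε : ℝ) : Prop where
  nonneg : ∀ i j i' j', 0 ≤ K i j i' j'
  sum_eq_one : ∀ i j, ∑ i', ∑ j', K i j i' j' = 1
  zero : K 0 0 0 0 = 1
  conservation : ∀ {i j i' j'}, K i j i' j' ≠ 0 → (i : ℕ) + j = i' + j'
  pos : 0 < ε
  exchange : ∀ i j, ε ≤ K i j j i

lemma isVertexKernel_L {I : ℕ} {q α : ℝ} (h : Admissible I I q α) :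
    ∃ ε, IsVertexKernel (L I I q α) ε := by
  obtain ⟨m, hm⟩ := Finite.exists_min fun x : Fin (I + 1) × Fin (I + 1) =>
    L I I q α x.1 x.2 x.2 x.1
  exact ⟨L I I q α m.1 m.2 m.2 m.1, L_nonneg h, sum_L h, L_zero h, L_conservation, L_swap_pos h _ _,
    fun i j => hm (i, j)⟩

variable {I : ℕ} {K : Fin (I + 1) → Fin (I + 1) → Fin (I + 1) → Fin (I + 1) → ℝ} {ε : ℝ}

lemma IsVertexKernel.le_one (hK : IsVertexKernel K ε) : ε ≤ 1 := by
  rw [← hK.zero]; exact hK.exchange 0 0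

lemma IsVertexKernel.sum_eq_one' (hK : IsVertexKernel K ε) (i j : Fin (I + 1)) :
    ∑ j', ∑ i', K i j i' j' = 1 := by
  rw [Finset.sum_comm, hK.sum_eq_one]

/-- The transfer operator of one vertex with `i` incoming vertical lines, acting on weights on the
number of horizontal lines; the outgoing lines carry the additional weight `φ`. -/
def transfer (K : Fin (I + 1) → Fin (I + 1) → Fin (I + 1) → Fin (I + 1) → ℝ)
    (φ : Fin (I + 1) → Fin (I + 1) → ℝ) (i : Fin (I + 1)) (v : Fin (I + 1) → ℝ) :
    Fin (I + 1) → ℝ :=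
  fun j' => ∑ j, v j * ∑ i', K i j i' j' * φ i' j'

/-- The product of the transfer operators of the `n` vertices from `x` on. -/
def transferIter (K : Fin (I + 1) → Fin (I + 1) → Fin (I + 1) → Fin (I + 1) → ℝ)
    (g : ℤ → Fin (I + 1)) (φ : ℤ → Fin (I + 1) → Fin (I + 1) → ℝ) (x : ℤ)
    (v : Fin (I + 1) → ℝ) : ℕ → Fin (I + 1) → ℝ
  | 0 => v
  | n + 1 => transfer K (φ (x + n)) (g (x + n)) (transferIter K g φ x v n)

lemma transferIter_add (g : ℤ → Fin (I + 1)) (φ : ℤ → Fin (I + 1) → Fin (I + 1) → ℝ) (x : ℤ)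
    (v : Fin (I + 1) → ℝ) (m n : ℕ) :
    transferIter K g φ x v (m + n) =
      transferIter K g φ (x + m) (transferIter K g φ x v m) n := by
  induction n with
  | zero => rfl
  | succ n ih =>
    rw [← add_assoc, transferIter, ih, transferIter]
    push_cast
    rw [add_assoc]

lemma transferIter_congr {g g' : ℤ → Fin (I + 1)} {φ φ' : ℤ → Fin (I + 1) → Fin (I + 1) → ℝ}
    {x : ℤ} (v : Fin (I + 1) → ℝ) {n : ℕ} (hg : ∀ y, x ≤ y → y < x + n → g y = g' y)
    (hφ : ∀ y, x ≤ y → y < x + n → φ y = φ' y) :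
    transferIter K g φ x v n = transferIter K g' φ' x v n := by
  induction n with
  | zero => rfl
  | succ n ih =>
    rw [transferIter, transferIter, ih (fun y h1 h2 => hg y h1 (by push_cast; omega))
      (fun y h1 h2 => hφ y h1 (by push_cast; omega)), hg _ (by omega) (by push_cast; omega),
      hφ _ (by omega) (by push_cast; omega)]

lemma transfer_sub (φ : Fin (I + 1) → Fin (I + 1) → ℝ) (i : Fin (I + 1))
    (v w : Fin (I + 1) → ℝ) : transfer K φ i (v - w) = transfer K φ i v - transfer K φ i w := by
  ext j'
  simp [transfer, sub_mul, Finset.sum_sub_distrib]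

lemma transferIter_sub (g : ℤ → Fin (I + 1)) (φ : ℤ → Fin (I + 1) → Fin (I + 1) → ℝ) (x : ℤ)
    (v w : Fin (I + 1) → ℝ) (n : ℕ) :
    transferIter K g φ x (v - w) n = transferIter K g φ x v n - transferIter K g φ x w n := by
  induction n with
  | zero => rfl
  | succ n ih => rw [transferIter, ih, transfer_sub]; rfl

lemma transferIter_nonneg (hK : IsVertexKernel K ε) {g : ℤ → Fin (I + 1)}
    {φ : ℤ → Fin (I + 1) → Fin (I + 1) → ℝ} (hφ : ∀ y i j, 0 ≤ φ y i j) (x : ℤ)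
    {v : Fin (I + 1) → ℝ} (hv : ∀ j, 0 ≤ v j) (n : ℕ) (j : Fin (I + 1)) :
    0 ≤ transferIter K g φ x v n j := by
  induction n generalizing j with
  | zero => exact hv j
  | succ n ih =>
    rw [transferIter, transfer]
    exact Finset.sum_nonneg fun j _ => mul_nonneg (ih j) (Finset.sum_nonneg fun i _ =>
      mul_nonneg (hK.nonneg _ _ _ _) (hφ _ _ _))

lemma sum_abs_transfer_le (hK : IsVertexKernel K ε) {φ : Fin (I + 1) → Fin (I + 1) → ℝ}
    (hφ : ∀ i j, 0 ≤ φ i j ∧ φ i j ≤ 1) (i : Fin (I + 1)) (v : Fin (I + 1) → ℝ) :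
    ∑ j, |transfer K φ i v j| ≤ ∑ j, |v j| := by
  calc ∑ j', |transfer K φ i v j'| ≤ ∑ j', ∑ j, |v j| * ∑ i', K i j i' j' := by
        refine Finset.sum_le_sum fun j' _ => (Finset.abs_sum_le_sum_abs _ _).trans
          (Finset.sum_le_sum fun j _ => ?_)
        rw [abs_mul]
        refine mul_le_mul_of_nonneg_left ?_ (abs_nonneg _)
        rw [abs_of_nonneg (Finset.sum_nonneg fun i' _ =>
          mul_nonneg (hK.nonneg _ _ _ _) (hφ _ _).1)]
        exact Finset.sum_le_sum fun i' _ => mul_le_of_le_one_right (hK.nonneg _ _ _ _) (hφ _ _).2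
    _ = ∑ j, |v j| := by
        rw [Finset.sum_comm]
        refine Finset.sum_congr rfl fun j _ => ?_
        rw [← Finset.mul_sum, hK.sum_eq_one', mul_one]

lemma sum_abs_transferIter_le (hK : IsVertexKernel K ε) {g : ℤ → Fin (I + 1)}
    {φ : ℤ → Fin (I + 1) → Fin (I + 1) → ℝ} (hφ : ∀ y i j, 0 ≤ φ y i j ∧ φ y i j ≤ 1) (x : ℤ)
    (v : Fin (I + 1) → ℝ) (n : ℕ) : ∑ j, |transferIter K g φ x v n j| ≤ ∑ j, |v j| := by
  induction n with
  | zero => exact le_rfl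
  | succ n ih => exact (sum_abs_transfer_le hK (hφ _) _ _).trans ih

lemma sum_transfer_one (hK : IsVertexKernel K ε) (i : Fin (I + 1)) (v : Fin (I + 1) → ℝ) :
    ∑ j, transfer K 1 i v j = ∑ j, v j := by
  simp only [transfer, Pi.one_apply, mul_one]
  rw [Finset.sum_comm]
  refine Finset.sum_congr rfl fun j _ => ?_
  rw [← Finset.mul_sum, hK.sum_eq_one', mul_one]

lemma sum_transferIter_one (hK : IsVertexKernel K ε) (g : ℤ → Fin (I + 1)) (x : ℤ)
    (v : Fin (I + 1) → ℝ) (n : ℕ) : ∑ j, transferIter K g 1 x v n j = ∑ j, v j := by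
  induction n with
  | zero => rfl
  | succ n ih => rw [← ih]; exact sum_transfer_one hK _ _

/-- One vertex contracts the differences of weights of equal mass. -/
lemma sum_abs_transfer_one_le (hK : IsVertexKernel K ε) (i : Fin (I + 1)) {v : Fin (I + 1) → ℝ}
    (hv : ∑ j, v j = 0) : ∑ j, |transfer K 1 i v j| ≤ (1 - ε) * ∑ j, |v j| := by
  -- Doeblin minorization: the exchange sends `i` lines to the right with probability at least `ε`,
  -- whatever `j` is. As `v` has total mass zero, this common part can be subtracted from the kernel
  -- without changing the image of `v`.
  have hle : ∀ j j', (if j' = i then ε else 0) ≤ ∑ i', K i j i' j' := by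
    intro j j'
    split_ifs with h
    · subst h
      exact (hK.exchange _ j).trans
        (Finset.single_le_sum (f := fun i' => K j' j i' j') (fun i' _ => hK.nonneg _ _ _ _)
          (Finset.mem_univ j))
    · exact Finset.sum_nonneg fun i' _ => hK.nonneg _ _ _ _
  have e : ∀ j', transfer K 1 i v j' =
      ∑ j, v j * (∑ i', K i j i' j' - if j' = i then ε else 0) := by
    intro j'
    simp only [transfer, Pi.one_apply, mul_one, mul_sub, Finset.sum_sub_distrib]
    rw [← Finset.sum_mul, hv, zero_mul, sub_zero]
  calc ∑ j', |transfer K 1 i v j'|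
      ≤ ∑ j', ∑ j, |v j| * (∑ i', K i j i' j' - if j' = i then ε else 0) := by
        refine Finset.sum_le_sum fun j' _ => ?_
        rw [e]
        refine (Finset.abs_sum_le_sum_abs _ _).trans (Finset.sum_le_sum fun j _ => ?_)
        rw [abs_mul, abs_of_nonneg (sub_nonneg.2 (hle j j'))]
    _ = (1 - ε) * ∑ j, |v j| := by
        rw [Finset.sum_comm, Finset.mul_sum]
        refine Finset.sum_congr rfl fun j _ => ?_
        rw [← Finset.mul_sum, Finset.sum_sub_distrib, hK.sum_eq_one']
        simp [mul_comm]

lemma sum_abs_transferIter_one_le (hK : IsVertexKernel K ε) (g : ℤ → Fin (I + 1)) (x : ℤ)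
    {v : Fin (I + 1) → ℝ} (hv : ∑ j, v j = 0) (n : ℕ) :
    ∑ j, |transferIter K g 1 x v n j| ≤ (1 - ε) ^ n * ∑ j, |v j| := by
  induction n with
  | zero => simp [transferIter]
  | succ n ih =>
    rw [pow_succ', mul_assoc]
    refine (sum_abs_transfer_one_le hK _ ?_).trans
      (mul_le_mul_of_nonneg_left ih (sub_nonneg.2 hK.le_one))
    rw [sum_transferIter_one hK, hv]

/-- The unit mass at no line. -/
abbrev noLine (I : ℕ) : Fin (I + 1) → ℝ := Pi.single 0 1

lemma transfer_noLine (hK : IsVertexKernel K ε) : transfer K 1 0 (noLine I) = noLine I := by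
  ext j'
  simp only [transfer, noLine, Pi.one_apply, mul_one]
  rw [Finset.sum_eq_single 0 (fun j _ hj => by rw [Pi.single_eq_of_ne hj, zero_mul]) (by simp),
    Pi.single_eq_same, one_mul]
  rcases eq_or_ne j' 0 with rfl | hj
  · rw [Pi.single_eq_same, Finset.sum_eq_single 0 _ (by simp), hK.zero]
    intro i' _ hi
    by_contra hc
    have h1 := hK.conservation hc
    rw [Fin.val_zero] at h1
    exact hi (Fin.ext (by rw [Fin.val_zero]; omega))
  · rw [Pi.single_eq_of_ne hj]
    refine Finset.sum_eq_zero fun i' _ => ?_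
    by_contra hc
    have h1 := hK.conservation hc
    rw [Fin.val_zero] at h1
    exact hj (Fin.ext (by rw [Fin.val_zero]; omega))

lemma transferIter_noLine (hK : IsVertexKernel K ε) {g : ℤ → Fin (I + 1)} {x : ℤ} {n : ℕ}
    (hg : ∀ y, x ≤ y → y < x + n → g y = 0) : transferIter K g 1 x (noLine I) n = noLine I := by
  induction n with
  | zero => rfl
  | succ n ih =>
    rw [transferIter, ih fun y h1 h2 => hg y h1 (by push_cast; omega),
      hg _ (by omega) (by push_cast; omega)]
    exact transfer_noLine hK

/-- Without vertical lines, all horizontal lines are eventually absorbed. -/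
lemma tendsto_transferIter_zero (hK : IsVertexKernel K ε) {g : ℤ → Fin (I + 1)} {x : ℤ}
    (hg : ∀ y, x ≤ y → g y = 0) (v : Fin (I + 1) → ℝ) :
    Tendsto (fun n => transferIter K g 1 x v n 0) atTop (𝓝 (∑ j, v j)) := by
  -- The weight of the same mass concentrated at no line is fixed by empty vertices, so the
  -- contraction applies to `v - w`.
  set w : Fin (I + 1) → ℝ := (∑ j, v j) • noLine I with hw
  have hsum : ∑ j, (v - w) j = 0 := by
    simp [hw, Finset.sum_sub_distrib, ← Finset.mul_sum]
  have hwn : ∀ n, transferIter K g 1 x w n = w := by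
    intro n
    induction n with
    | zero => rfl
    | succ n ih =>
      rw [transferIter, ih, hg _ (by omega)]
      have h1 := transfer_noLine hK
      ext j'
      have h2 := congr_fun h1 j'
      have : transfer K 1 0 w j' = (∑ j, v j) * transfer K 1 0 (noLine I) j' := by
        simp only [transfer, hw, Pi.smul_apply, smul_eq_mul, Finset.mul_sum, mul_assoc]
      rw [show (1 : ℤ → Fin (I + 1) → Fin (I + 1) → ℝ) (x + n) = 1 from rfl, this, h2]
      rfl
  have hlim : Tendsto (fun n : ℕ => (1 - ε) ^ n * ∑ j, |(v - w) j|) atTop (𝓝 0) := by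
    have := (tendsto_pow_atTop_nhds_zero_of_lt_one (sub_nonneg.2 hK.le_one)
      (sub_lt_self 1 hK.pos)).mul_const (∑ j, |(v - w) j|)
    simpa using this
  rw [tendsto_iff_dist_tendsto_zero]
  refine squeeze_zero (fun _ => dist_nonneg) (fun n => ?_) hlim
  have h1 : transferIter K g 1 x v n 0 - ∑ j, v j = transferIter K g 1 x (v - w) n 0 := by
    rw [transferIter_sub, hwn]
    simp [hw]
  rw [Real.dist_eq, h1]
  exact (Finset.single_le_sum (f := fun j => |transferIter K g 1 x (v - w) n j|)
    (fun j _ => abs_nonneg _) (Finset.mem_univ 0)).trans (sum_abs_transferIter_one_le hK g x hsum n)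

/-! ### The joint law of the new configuration and of the crossing lines -/

/-- A realization of a step: the value at `x` consists of the new number of particles at `x` and of
the number of particles that cross from `x` to `x + 1`. -/
abbrev Path (I : ℕ) : Type := ℤ → Fin (I + 1) × Fin (I + 1)

/-- The probability of a realization of the step from `g`. -/
def pathWeight (K : Fin (I + 1) → Fin (I + 1) → Fin (I + 1) → Fin (I + 1) → ℝ)
    (g : ℤ →₀ Fin (I + 1)) (s : ℤ →₀ Fin (I + 1) × Fin (I + 1)) : ℝ :=
  ∏ᶠ x : ℤ, K (g x) (s (x - 1)).2 (s x).1 (s x).2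

/-- The law of the realization of the step from the finite configuration `g`. -/
def jointStep (K : Fin (I + 1) → Fin (I + 1) → Fin (I + 1) → Fin (I + 1) → ℝ)
    (g : ℤ →₀ Fin (I + 1)) : Measure (Path I) :=
  Measure.sum fun s : ℤ →₀ Fin (I + 1) × Fin (I + 1) =>
    ENNReal.ofReal (pathWeight K g s) • Measure.dirac (s : Path I)

/-- The realizations that vanish outside `[x, x + n)`. -/
def pathBox (I : ℕ) (x : ℤ) : ℕ → Finset (ℤ →₀ Fin (I + 1) × Fin (I + 1))
  | 0 => {0}
  | n + 1 => (pathBox I x n ×ˢ Finset.univ).image fun p => p.1.update (x + n) p.2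

lemma mem_pathBox {x : ℤ} {n : ℕ} {s : ℤ →₀ Fin (I + 1) × Fin (I + 1)} :
    s ∈ pathBox I x n ↔ ∀ y, y < x ∨ x + n ≤ y → s y = 0 := by
  induction n generalizing s with
  | zero =>
    simp only [pathBox, Finset.mem_singleton]
    constructor
    · rintro rfl y _; rfl
    · intro h
      ext1 y
      exact h y (by push_cast; omega)
  | succ n ih =>
    simp only [pathBox, Finset.mem_image, Finset.mem_product, Finset.mem_univ, and_true, ih]
    constructor
    · rintro ⟨⟨u, a⟩, hu, rfl⟩ y hy
      push_cast at hy
      rw [Finsupp.coe_update, Function.update_of_ne (by omega)]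
      exact hu y (by omega)
    · intro h
      refine ⟨(s.update (x + n) 0, s (x + n)), fun y hy => ?_, ?_⟩
      · rw [Finsupp.coe_update]
        rcases eq_or_ne y (x + n) with rfl | hne
        · rw [Function.update_self]
        · rw [Function.update_of_ne hne]
          exact h y (by push_cast; omega)
      · ext1 y
        simp only [Finsupp.coe_update]
        rcases eq_or_ne y (x + n) with rfl | hne
        · rw [Function.update_self]
        · rw [Function.update_of_ne hne, Function.update_of_ne hne]

/-- The sum over realizations in a box is computed by the transfer operators. -/
lemma sum_pathBox (g : ℤ → Fin (I + 1)) (φ : ℤ → Fin (I + 1) → Fin (I + 1) → ℝ) (x : ℤ) (n : ℕ)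
    (u : Fin (I + 1) → ℝ) :
    ∑ s ∈ pathBox I x n, (∏ k ∈ Finset.range n, (K (g (x + k)) (s (x + k - 1)).2 (s (x + k)).1
      (s (x + k)).2 * φ (x + k) (s (x + k)).1 (s (x + k)).2)) * u (s (x + n - 1)).2 =
    ∑ j, transferIter K g φ x (noLine I) n j * u j := by
  induction n generalizing u with
  | zero => simp [pathBox, transferIter, Pi.single_apply]
  | succ n ih =>
    have hinj : Set.InjOn (fun p : (ℤ →₀ Fin (I + 1) × Fin (I + 1)) × (Fin (I + 1) × Fin (I + 1)) =>
        p.1.update (x + n) p.2) ↑(pathBox I x n ×ˢ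
          (Finset.univ : Finset (Fin (I + 1) × Fin (I + 1)))) := by
      rintro ⟨s, a⟩ hs ⟨s', a'⟩ hs' heq
      simp only [Finset.coe_product, Set.mem_prod, Finset.mem_coe, mem_pathBox] at hs hs'
      have hy : ∀ y, Function.update s (x + n) a y = Function.update s' (x + n) a' y := fun y => by
        have := DFunLike.congr_fun heq y
        simpa only [Finsupp.coe_update] using this
      refine Prod.ext ?_ ?_
      · ext1 y
        rcases eq_or_ne y (x + n) with rfl | hne
        · rw [hs.1 _ (by omega), hs'.1 _ (by omega)]
        · simpa [Function.update_of_ne hne] using hy y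
      · simpa using hy (x + n)
    rw [pathBox, Finset.sum_image hinj, Finset.sum_product]
    have e : ∀ s ∈ pathBox I x n, ∀ a : Fin (I + 1) × Fin (I + 1),
        (∏ k ∈ Finset.range (n + 1), (K (g (x + k)) ((s.update (x + n) a) (x + k - 1)).2
          ((s.update (x + n) a) (x + k)).1 ((s.update (x + n) a) (x + k)).2 *
          φ (x + k) ((s.update (x + n) a) (x + k)).1 ((s.update (x + n) a) (x + k)).2)) *
          u ((s.update (x + n) a) (x + (n + 1 : ℕ) - 1)).2 =
        (∏ k ∈ Finset.range n, (K (g (x + k)) (s (x + k - 1)).2 (s (x + k)).1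
          (s (x + k)).2 * φ (x + k) (s (x + k)).1 (s (x + k)).2)) *
          (K (g (x + n)) (s (x + n - 1)).2 a.1 a.2 * φ (x + n) a.1 a.2 * u a.2) := by
      intro s _ a
      rw [Finset.prod_range_succ]
      simp only [Finsupp.coe_update]
      rw [Function.update_self, Function.update_of_ne (by omega : x + (n : ℤ) - 1 ≠ x + n),
        show x + ((n + 1 : ℕ) : ℤ) - 1 = x + n by push_cast; ring, Function.update_self, mul_assoc]
      congr 1
      refine Finset.prod_congr rfl fun k hk => ?_
      have hk' := Finset.mem_range.1 hk
      rw [Function.update_of_ne (by omega), Function.update_of_ne (by omega)]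
    rw [Finset.sum_congr rfl fun s hs => Finset.sum_congr rfl fun a _ => e s hs a]
    simp_rw [← Finset.mul_sum]
    rw [ih fun j => ∑ a : Fin (I + 1) × Fin (I + 1),
      K (g (x + n)) j a.1 a.2 * φ (x + n) a.1 a.2 * u a.2]
    simp only [transferIter, transfer, Finset.sum_mul]
    rw [Finset.sum_comm]
    refine Finset.sum_congr rfl fun j _ => ?_
    simp only [Fintype.sum_prod_type, Finset.mul_sum, Finset.sum_mul]
    rw [Finset.sum_comm]
    exact Finset.sum_congr rfl fun _ _ => Finset.sum_congr rfl fun _ _ => by ring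

/-- The finite product form of the weight of a realization that vanishes outside a box. -/
lemma pathWeight_eq (hK : IsVertexKernel K ε) {g : ℤ →₀ Fin (I + 1)} {x : ℤ} {n : ℕ}
    (hg : ∀ y, y < x ∨ x + n ≤ y → g y = 0) {s : ℤ →₀ Fin (I + 1) × Fin (I + 1)}
    (hs : s ∈ pathBox I x n) :
    pathWeight K g s = (∏ k ∈ Finset.range n, K (g (x + k)) (s (x + k - 1)).2 (s (x + k)).1
      (s (x + k)).2) * if (s (x + n - 1)).2 = 0 then 1 else 0 := by
  rw [mem_pathBox] at hs
  have hsub : Function.mulSupport (fun y : ℤ => K (g y) (s (y - 1)).2 (s y).1 (s y).2) ⊆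
      ((Finset.range (n + 1)).image fun k : ℕ => x + (k : ℤ) : Finset ℤ) := by
    intro y hy
    by_contra hc
    have hy' : y < x ∨ x + n < y := by
      by_contra h'
      push Not at h'
      refine hc (Finset.mem_coe.2 (Finset.mem_image.2 ⟨(y - x).toNat, ?_, ?_⟩))
      · rw [Finset.mem_range]; omega
      · omega
    refine hy ?_
    simp only
    rw [hg y (by omega), hs y (by omega), hs (y - 1) (by omega)]
    exact hK.zero
  rw [pathWeight, finprod_eq_prod_of_mulSupport_subset _ hsub,
    Finset.prod_image (fun a _ b _ hab => by simpa using hab), Finset.prod_range_succ]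
  congr 1
  -- The vertex just after the box has no vertical line and emits nothing, so by conservation its
  -- factor vanishes unless no line enters it. This is the indicator in the statement.
  rw [hg _ (by omega), hs (x + n) (by omega)]
  split_ifs with h0
  · rw [h0]; exact hK.zero
  · by_contra hc
    have h1 := hK.conservation hc
    refine h0 (Fin.ext ?_)
    simpa using h1

lemma prod_Ico_int {M : Type*} [CommMonoid M] (f : ℤ → M) (x : ℤ) (n : ℕ) :
    ∏ y ∈ Finset.Ico x (x + n), f y = ∏ k ∈ Finset.range n, f (x + k) := by
  refine Finset.prod_nbij' (fun y => (y - x).toNat) (fun k => x + k) ?_ ?_ ?_ ?_ ?_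
  · intro y hy
    rw [Finset.mem_Ico] at hy
    rw [Finset.mem_range]
    omega
  · intro k hk
    rw [Finset.mem_range] at hk
    rw [Finset.mem_Ico]
    omega
  · intro y hy
    rw [Finset.mem_Ico] at hy
    omega
  · intro k _
    omega
  · intro y hy
    rw [Finset.mem_Ico] at hy
    congr 1
    omega

/-- The product of the local weights `φ` over the sites in `[-R, R)`. -/
def pathTest (φ : ℤ → Fin (I + 1) → Fin (I + 1) → ℝ) (R : ℕ) (s : Path I) : ℝ :=
  ∏ y ∈ Finset.Ico (-(R : ℤ)) R, φ y (s y).1 (s y).2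

lemma pathTest_eq_range (φ : ℤ → Fin (I + 1) → Fin (I + 1) → ℝ) (R : ℕ) (s : Path I) :
    pathTest φ R s = ∏ k ∈ Finset.range (2 * R), φ (-R + k) (s (-R + k)).1 (s (-R + k)).2 := by
  rw [← prod_Ico_int (fun y => φ y (s y).1 (s y).2), pathTest]
  congr 2
  push_cast; ring

lemma pathTest_mem_Icc {φ : ℤ → Fin (I + 1) → Fin (I + 1) → ℝ}
    (hφ : ∀ y i j, 0 ≤ φ y i j ∧ φ y i j ≤ 1) (R : ℕ) (s : Path I) :
    0 ≤ pathTest φ R s ∧ pathTest φ R s ≤ 1 :=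
  ⟨Finset.prod_nonneg fun _ _ => (hφ _ _ _).1,
    Finset.prod_le_one (fun _ _ => (hφ _ _ _).1) fun _ _ => (hφ _ _ _).2⟩

lemma pathTest_mono {φ : ℤ → Fin (I + 1) → Fin (I + 1) → ℝ} {R R' : ℕ} (hR : R ≤ R')
    (hφ1 : ∀ y, y < -(R : ℤ) ∨ (R : ℤ) ≤ y → φ y = 1) (s : Path I) :
    pathTest φ R' s = pathTest φ R s := by
  refine (Finset.prod_subset (fun y hy => ?_) fun y _ hy => ?_).symm
  · rw [Finset.mem_Ico] at hy ⊢; omega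
  · rw [Finset.mem_Ico] at hy
    rw [hφ1 y (by omega)]; rfl

@[fun_prop]
lemma continuous_pathTest (φ : ℤ → Fin (I + 1) → Fin (I + 1) → ℝ) (R : ℕ) :
    Continuous (pathTest φ R) := by
  refine continuous_finsetProd _ fun y _ => ?_
  have : Continuous fun a : Fin (I + 1) × Fin (I + 1) => φ y a.1 a.2 := continuous_of_discreteTopology
  exact this.comp (continuous_apply y)

lemma tendsto_pathBox : Tendsto (fun n : ℕ => pathBox I (-n) (2 * n)) atTop atTop := by
  refine tendsto_atTop_finset_of_monotone ?_ ?_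
  · intro m n hmn s hs
    rw [mem_pathBox] at hs ⊢
    intro y hy
    push_cast at hy
    exact hs y (by push_cast; omega)
  · intro s
    refine ⟨s.support.sup fun y => y.natAbs + 1, mem_pathBox.2 fun y hy => ?_⟩
    by_contra hc
    have : y.natAbs + 1 ≤ s.support.sup fun y => y.natAbs + 1 :=
      Finset.le_sup (f := fun y : ℤ => y.natAbs + 1) (Finsupp.mem_support_iff.2 hc)
    push_cast at hy
    omega

/-- Left of `-R` there is nothing to transport, and right of `R` there are neither particles nor
tests. Enlarging the window thus only adds empty vertices that absorb lines. -/
lemma transferIter_extend (hK : IsVertexKernel K ε) {g : ℤ → Fin (I + 1)}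
    {φ : ℤ → Fin (I + 1) → Fin (I + 1) → ℝ} {R n : ℕ}
    (hg : ∀ y, y < -(R : ℤ) ∨ (R : ℤ) ≤ y → g y = 0)
    (hφ1 : ∀ y, y < -(R : ℤ) ∨ (R : ℤ) ≤ y → φ y = 1) (hn : R ≤ n) :
    transferIter K g φ (-n) (noLine I) (2 * n) =
      transferIter K g 1 R (transferIter K g φ (-R) (noLine I) (2 * R)) (n - R) := by
  obtain ⟨d, rfl⟩ := Nat.exists_eq_add_of_le hn
  rw [show 2 * (R + d) = d + (2 * R + d) by ring, transferIter_add, transferIter_add,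
    Nat.add_sub_cancel_left]
  have h1 : transferIter K g φ (-((R + d : ℕ) : ℤ)) (noLine I) d = noLine I := by
    rw [transferIter_congr (g' := g) (φ' := 1) _ (fun _ _ _ => rfl)
      fun y h1 h2 => hφ1 y (by push_cast at *; omega)]
    exact transferIter_noLine hK fun y h1 h2 => hg y (by push_cast at *; omega)
  have e1 : -((R + d : ℕ) : ℤ) + d = -(R : ℤ) := by push_cast; ring
  have e2 : -(R : ℤ) + ((2 * R : ℕ) : ℤ) = R := by push_cast; ring
  rw [h1, e1, e2]
  exact transferIter_congr _ (fun _ _ _ => rfl) fun y h1 h2 => hφ1 y (by omega)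

/-- The expectation of a product of local functions under the law of a step. -/
lemma lintegral_jointStep (hK : IsVertexKernel K ε) {g : ℤ →₀ Fin (I + 1)}
    {φ : ℤ → Fin (I + 1) → Fin (I + 1) → ℝ} (hφ : ∀ y i j, 0 ≤ φ y i j ∧ φ y i j ≤ 1) {R : ℕ}
    (hg : ∀ y, y < -(R : ℤ) ∨ (R : ℤ) ≤ y → g y = 0)
    (hφ1 : ∀ y, y < -(R : ℤ) ∨ (R : ℤ) ≤ y → φ y = 1) :
    ∫⁻ s, ENNReal.ofReal (pathTest φ R s) ∂(jointStep K g) =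
      ENNReal.ofReal (∑ j, transferIter K g φ (-R) (noLine I) (2 * R) j) := by
  have hmeas : Measurable fun s : Path I => ENNReal.ofReal (pathTest φ R s) :=
    (continuous_pathTest φ R).measurable.ennreal_ofReal
  have hw : ∀ s, 0 ≤ pathWeight K g s := fun s => finprod_nonneg fun x => hK.nonneg _ _ _ _
  have e : ∫⁻ s, ENNReal.ofReal (pathTest φ R s) ∂(jointStep K g) =
      ∑' s : ℤ →₀ Fin (I + 1) × Fin (I + 1), ENNReal.ofReal (pathWeight K g s * pathTest φ R s) := by
    rw [jointStep, lintegral_sum_measure]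
    refine tsum_congr fun s => ?_
    rw [lintegral_smul_measure, lintegral_dirac' _ hmeas, smul_eq_mul, ← ENNReal.ofReal_mul (hw s)]
  have hlim : Tendsto (fun n : ℕ => ∑ s ∈ pathBox I (-n) (2 * n),
      ENNReal.ofReal (pathWeight K g s * pathTest φ R s)) atTop
      (𝓝 (∑' s : ℤ →₀ Fin (I + 1) × Fin (I + 1),
        ENNReal.ofReal (pathWeight K g s * pathTest φ R s))) :=
    ENNReal.summable.hasSum.comp tendsto_pathBox
  rw [e]
  refine tendsto_nhds_unique hlim ?_
  -- A box of realizations only sees the event that no line leaves it. Absorption over the empty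
  -- sites on the right shows that this loses no mass in the limit.
  have hT : Tendsto (fun n : ℕ => ENNReal.ofReal (transferIter K g φ (-n) (noLine I) (2 * n) 0))
      atTop (𝓝 (ENNReal.ofReal (∑ j, transferIter K g φ (-R) (noLine I) (2 * R) j))) := by
    refine (ENNReal.continuous_ofReal.tendsto _).comp ?_
    have h1 := tendsto_transferIter_zero hK (x := (R : ℤ)) (fun y hy => hg y (Or.inr hy))
      (transferIter K g φ (-R) (noLine I) (2 * R))
    refine (h1.comp (tendsto_sub_atTop_nat R)).congr' ?_
    filter_upwards [eventually_ge_atTop R] with n hn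
    rw [transferIter_extend hK hg hφ1 hn]; rfl
  refine hT.congr' ?_
  filter_upwards [eventually_ge_atTop R] with n hn
  rw [← ENNReal.ofReal_sum_of_nonneg fun s _ => mul_nonneg (hw s) (pathTest_mem_Icc hφ R s).1]
  congr 1
  have key := sum_pathBox (K := K) g φ (-n) (2 * n) fun j => if j = 0 then 1 else 0
  simp only [mul_ite, mul_one, mul_zero, Finset.sum_ite_eq', Finset.mem_univ, if_true] at key
  rw [← key]
  refine Finset.sum_congr rfl fun s hs => ?_
  rw [pathWeight_eq hK (fun y hy => hg y (by push_cast at hy; omega)) hs, ← pathTest_mono hn hφ1,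
    pathTest_eq_range, Finset.prod_mul_distrib]
  split_ifs <;> ring

lemma exists_support_bound {M : Type*} [Zero M] (g : ℤ →₀ M) :
    ∃ R : ℕ, ∀ y, y < -(R : ℤ) ∨ (R : ℤ) ≤ y → g y = 0 := by
  refine ⟨g.support.sup fun y => y.natAbs + 1, fun y hy => ?_⟩
  by_contra hc
  have : y.natAbs + 1 ≤ g.support.sup fun y => y.natAbs + 1 :=
    Finset.le_sup (f := fun y : ℤ => y.natAbs + 1) (Finsupp.mem_support_iff.2 hc)
  omega

lemma isProbabilityMeasure_jointStep (hK : IsVertexKernel K ε) (g : ℤ →₀ Fin (I + 1)) :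
    IsProbabilityMeasure (jointStep K g) := by
  obtain ⟨R, hR⟩ := exists_support_bound g
  have := lintegral_jointStep hK (g := g) (φ := 1) (fun _ _ _ => by simp) hR fun _ _ => rfl
  rw [sum_transferIter_one hK] at this
  refine ⟨?_⟩
  simpa [pathTest, noLine] using this

lemma integral_jointStep (hK : IsVertexKernel K ε) {g : ℤ →₀ Fin (I + 1)}
    {φ : ℤ → Fin (I + 1) → Fin (I + 1) → ℝ} (hφ : ∀ y i j, 0 ≤ φ y i j ∧ φ y i j ≤ 1) {R : ℕ}
    (hg : ∀ y, y < -(R : ℤ) ∨ (R : ℤ) ≤ y → g y = 0)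
    (hφ1 : ∀ y, y < -(R : ℤ) ∨ (R : ℤ) ≤ y → φ y = 1) :
    ∫ s, pathTest φ R s ∂(jointStep K g) =
      ∑ j, transferIter K g φ (-R) (noLine I) (2 * R) j := by
  rw [integral_eq_lintegral_of_nonneg_ae (ae_of_all _ fun s => (pathTest_mem_Icc hφ R s).1)
    (continuous_pathTest φ R).measurable.aestronglyMeasurable, lintegral_jointStep hK hφ hg hφ1,
    ENNReal.toReal_ofReal]
  refine Finset.sum_nonneg fun j _ => transferIter_nonneg hK (fun y i j => (hφ y i j).1) _ ?_ _ _
  intro j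
  by_cases h : j = 0 <;> simp [noLine, h]

/-- Realizations as pairs of a new configuration and of numbers of crossing particles. -/
def pathEquiv (I : ℕ) : (ℤ →₀ Fin (I + 1) × Fin (I + 1)) ≃
    (ℤ →₀ Fin (I + 1)) × (ℤ →₀ Fin (I + 1)) where
  -- The second component is moved by one site: a path stores at `x` the lines that leave `x`,
  -- whereas `finStep` stores those that enter `x`.
  toFun s := (s.mapRange Prod.fst rfl, (s.mapRange Prod.snd rfl).equivMapDomain (Equiv.addRight 1))
  invFun r := Finsupp.zipWith Prod.mk rfl r.1 (r.2.equivMapDomain (Equiv.addRight (-1)))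
  left_inv s := by ext1 x; simp [Finsupp.equivMapDomain_apply]
  right_inv r := by
    refine Prod.ext ?_ ?_ <;> ext1 x <;> simp [Finsupp.equivMapDomain_apply]

/-- The new configuration of a realization. -/
def newConfig (s : Path I) : Config I := fun x => (s x).1

@[fun_prop]
lemma continuous_newConfig : Continuous (newConfig (I := I)) :=
  continuous_pi fun x => continuous_fst.comp (continuous_apply x)

lemma finStep_eq_map (q α : ℝ) (g : ℤ →₀ Fin (I + 1)) :
    finStep I I q α g = (jointStep (L I I q α) g).map newConfig := by
  rw [jointStep, Measure.map_sum continuous_newConfig.measurable.aemeasurable, finStep,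
    ← Measure.sum_comp_equiv (pathEquiv I)]
  congr 1
  ext1 s
  have h1 : ((pathEquiv I s).1 : Config I) = newConfig (s : Path I) := by
    ext1 x; simp [pathEquiv, newConfig]
  have h3 : ∀ x, (pathEquiv I s).2 x = (s (x - 1)).2 := fun x => by
    simp [pathEquiv, Finsupp.equivMapDomain_apply, sub_eq_add_neg]
  rw [Measure.map_smul, Measure.map_dirac' continuous_newConfig.measurable, pathWeight,
    Function.comp_apply, h1]
  simp only [h3, add_sub_cancel_right]
  rfl

/-- The shift of a finite configuration. -/
def finShift {M : Type*} [Zero M] (g : ℤ →₀ M) : ℤ →₀ M :=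
  g.equivMapDomain (Equiv.addRight (-1))

@[simp] lemma finShift_apply {M : Type*} [Zero M] (g : ℤ →₀ M) (x : ℤ) :
    finShift g x = g (x + 1) := by
  simp [finShift, Finsupp.equivMapDomain_apply]

/-- The shift of a realization. -/
def pathShift (s : Path I) : Path I := fun x => s (x + 1)

@[fun_prop]
lemma continuous_pathShift : Continuous (pathShift (I := I)) :=
  continuous_pi fun x => continuous_apply (x + 1)

lemma jointStep_finShift (g : ℤ →₀ Fin (I + 1)) :
    jointStep K (finShift g) = (jointStep K g).map pathShift := by
  rw [jointStep, jointStep, Measure.map_sum continuous_pathShift.measurable.aemeasurable,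
    ← Measure.sum_comp_equiv (Finsupp.equivCongrLeft (Equiv.addRight (-1 : ℤ)))]
  congr 1
  ext1 s
  have h1 : Finsupp.equivCongrLeft (Equiv.addRight (-1 : ℤ)) s = finShift s := rfl
  have h2 : (finShift s : Path I) = pathShift (s : Path I) := by
    ext1 x; simp [pathShift]
  have h3 : pathWeight K (finShift g) (finShift s) = pathWeight K g s := by
    rw [pathWeight, pathWeight, ← finprod_comp_equiv (Equiv.addRight (1 : ℤ))
      (f := fun x => K (g x) (s (x - 1)).2 (s x).1 (s x).2)]
    refine finprod_congr fun x => ?_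
    simp
  rw [Measure.map_smul, Measure.map_dirac' continuous_pathShift.measurable, Function.comp_apply, h1,
    h2, h3]

/-! ### Locality of the step -/

/-- The expectation of a product of local functions on `[-R, R)`, when the number of lines that
enter the site `-M` has the weight `v`. -/
def windowValue (K : Fin (I + 1) → Fin (I + 1) → Fin (I + 1) → Fin (I + 1) → ℝ)
    (g : ℤ → Fin (I + 1)) (φ : ℤ → Fin (I + 1) → Fin (I + 1) → ℝ) (R M : ℕ)
    (v : Fin (I + 1) → ℝ) : ℝ :=
  ∑ j, transferIter K g φ (-M) v (M + R) j

lemma windowValue_congr {g g' : ℤ → Fin (I + 1)} {φ : ℤ → Fin (I + 1) → Fin (I + 1) → ℝ} {R M : ℕ}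
    (hg : ∀ y, -(M : ℤ) ≤ y → y < R → g y = g' y) (v : Fin (I + 1) → ℝ) :
    windowValue K g φ R M v = windowValue K g' φ R M v := by
  rw [windowValue, transferIter_congr (g' := g') (φ' := φ) _
    (fun y h1 h2 => hg y h1 (by push_cast at h2; omega)) (fun _ _ _ => rfl), windowValue]

/-- The `M - R` sites before the tests contract the difference of the initial weights at rate `1 -
ε`, and the window itself does not increase the `ℓ¹` norm. The factor `2` bounds the `ℓ¹` distance
of two probability weights. -/
lemma abs_windowValue_sub_le (hK : IsVertexKernel K ε) {g : ℤ → Fin (I + 1)}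
    {φ : ℤ → Fin (I + 1) → Fin (I + 1) → ℝ} (hφ : ∀ y i j, 0 ≤ φ y i j ∧ φ y i j ≤ 1) {R M : ℕ}
    (hφ1 : ∀ y, y < -(R : ℤ) ∨ (R : ℤ) ≤ y → φ y = 1) (hRM : R ≤ M) {v w : Fin (I + 1) → ℝ}
    (hv : ∀ j, 0 ≤ v j) (hv1 : ∑ j, v j = 1) (hw : ∀ j, 0 ≤ w j) (hw1 : ∑ j, w j = 1) :
    |windowValue K g φ R M v - windowValue K g φ R M w| ≤ (1 - ε) ^ (M - R) * 2 := by
  obtain ⟨d, rfl⟩ := Nat.exists_eq_add_of_le hRM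
  rw [Nat.add_sub_cancel_left, windowValue, windowValue, ← Finset.sum_sub_distrib]
  have h0 : ∑ j, (v - w) j = 0 := by simp [Finset.sum_sub_distrib, hv1, hw1]
  have e : ∀ j, transferIter K g φ (-((R + d : ℕ) : ℤ)) v (R + d + R) j -
      transferIter K g φ (-((R + d : ℕ) : ℤ)) w (R + d + R) j =
      transferIter K g φ (-((R + d : ℕ) : ℤ) + d)
        (transferIter K g 1 (-((R + d : ℕ) : ℤ)) (v - w) d) (R + R) j := by
    intro j
    rw [← Pi.sub_apply, ← transferIter_sub, show R + d + R = d + (R + R) by ring, transferIter_add]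
    rw [transferIter_congr (g' := g) (φ' := 1) (v - w) (fun _ _ _ => rfl)
      fun y h1 h2 => hφ1 y (by push_cast at *; omega)]
  simp only [e]
  refine (Finset.abs_sum_le_sum_abs _ _).trans ((sum_abs_transferIter_le hK hφ _ _ _).trans
    ((sum_abs_transferIter_one_le hK g _ h0 d).trans ?_))
  refine mul_le_mul_of_nonneg_left ?_ (pow_nonneg (sub_nonneg.2 hK.le_one) _)
  calc ∑ j, |(v - w) j| ≤ ∑ j, (v j + w j) := Finset.sum_le_sum fun j _ => by
        rw [Pi.sub_apply, abs_le]; constructor <;> linarith [hv j, hw j]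
    _ = 2 := by rw [Finset.sum_add_distrib, hv1, hw1]; norm_num

lemma noLine_nonneg (j : Fin (I + 1)) : 0 ≤ noLine I j := by
  by_cases h : j = 0 <;> simp [noLine, h]

/-- What lies left of `-M` acts only through the law of the number of lines entering `-M`, and what
lies right of `R` sums to one. -/
lemma exists_integral_eq_windowValue (hK : IsVertexKernel K ε) (g : ℤ →₀ Fin (I + 1))
    {φ : ℤ → Fin (I + 1) → Fin (I + 1) → ℝ} (hφ : ∀ y i j, 0 ≤ φ y i j ∧ φ y i j ≤ 1) {R M : ℕ}
    (hφ1 : ∀ y, y < -(R : ℤ) ∨ (R : ℤ) ≤ y → φ y = 1) (hRM : R ≤ M) :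
    ∃ v : Fin (I + 1) → ℝ, (∀ j, 0 ≤ v j) ∧ ∑ j, v j = 1 ∧
      ∫ s, pathTest φ R s ∂(jointStep K g) = windowValue K g φ R M v := by
  obtain ⟨S, hS⟩ := exists_support_bound g
  obtain ⟨d, hd⟩ := Nat.exists_eq_add_of_le (le_max_left M S)
  set N := max M S
  have hN : ∀ y, y < -(N : ℤ) ∨ (N : ℤ) ≤ y → g y = 0 := fun y hy => hS y (by omega)
  refine ⟨transferIter K g 1 (-N) (noLine I) d, ?_, ?_, ?_⟩
  · exact transferIter_nonneg hK (fun _ _ _ => zero_le_one) _ noLine_nonneg _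
  · rw [sum_transferIter_one hK]; simp [noLine]
  · have e1 : (fun s => pathTest φ R s) = fun s : Path I => pathTest φ N s :=
      funext fun s => (pathTest_mono (by omega) hφ1 s).symm
    rw [e1, integral_jointStep hK hφ hN fun y hy => hφ1 y (by omega)]
    obtain ⟨d', hd'⟩ := Nat.exists_eq_add_of_le (show R ≤ N by omega)
    rw [show 2 * N = d + ((M + R) + d') by omega, transferIter_add, transferIter_add, windowValue]
    rw [transferIter_congr (φ := φ) (φ' := 1) (x := -(N : ℤ) + d + (M + R : ℕ)) _
      (fun _ _ _ => rfl) fun y h1 h2 => hφ1 y (by push_cast at *; omega), sum_transferIter_one hK]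
    rw [transferIter_congr (φ := φ) (φ' := 1) (x := -(N : ℤ)) _
      (fun _ _ _ => rfl) fun y h1 h2 => hφ1 y (by omega),
      show -(N : ℤ) + d = -M by omega]

/-- The function `f` of the realization has nearly the same expectation for configurations that
agree on a large interval. -/
def IsLocalFun (K : Fin (I + 1) → Fin (I + 1) → Fin (I + 1) → Fin (I + 1) → ℝ)
    (f : C(Path I, ℝ)) : Prop :=
  ∀ δ > 0, ∃ M : ℕ, ∀ g g' : ℤ →₀ Fin (I + 1), (∀ y, -(M : ℤ) ≤ y → y < M → g y = g' y) →
    |∫ s, f s ∂(jointStep K g) - ∫ s, f s ∂(jointStep K g')| ≤ δ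

lemma isLocalFun_pathTest (hK : IsVertexKernel K ε)
    {φ : ℤ → Fin (I + 1) → Fin (I + 1) → ℝ} (hφ : ∀ y i j, 0 ≤ φ y i j ∧ φ y i j ≤ 1) {R : ℕ}
    (hφ1 : ∀ y, y < -(R : ℤ) ∨ (R : ℤ) ≤ y → φ y = 1) :
    IsLocalFun K ⟨pathTest φ R, continuous_pathTest φ R⟩ := by
  intro δ hδ
  have hlim : Tendsto (fun n : ℕ => (1 - ε) ^ n * 2) atTop (𝓝 0) := by
    simpa using (tendsto_pow_atTop_nhds_zero_of_lt_one (sub_nonneg.2 hK.le_one)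
      (sub_lt_self 1 hK.pos)).mul_const 2
  obtain ⟨d, hd⟩ := (hlim.eventually (gt_mem_nhds hδ)).exists
  refine ⟨R + d, fun g g' hgg => ?_⟩
  obtain ⟨v, hv, hv1, ev⟩ := exists_integral_eq_windowValue hK g hφ hφ1 (Nat.le_add_right R d)
  obtain ⟨w, hw, hw1, ew⟩ := exists_integral_eq_windowValue hK g' hφ hφ1 (Nat.le_add_right R d)
  simp only [ContinuousMap.coe_mk]
  rw [ev, ew, windowValue_congr (g' := g') fun y h1 h2 => hgg y h1 (by push_cast; omega)]
  refine (abs_windowValue_sub_le hK hφ hφ1 (Nat.le_add_right R d) hv hv1 hw hw1).trans ?_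
  rw [Nat.add_sub_cancel_left]
  exact hd.le

lemma integrable_jointStep (hK : IsVertexKernel K ε) (g : ℤ →₀ Fin (I + 1)) (f : C(Path I, ℝ)) :
    Integrable f (jointStep K g) := by
  have := isProbabilityMeasure_jointStep hK g
  exact (BoundedContinuousFunction.mkOfCompact f).integrable _

lemma IsLocalFun.add (hK : IsVertexKernel K ε) {f f' : C(Path I, ℝ)} (hf : IsLocalFun K f)
    (hf' : IsLocalFun K f') : IsLocalFun K (f + f') := by
  intro δ hδ
  obtain ⟨M, hM⟩ := hf (δ / 2) (half_pos hδ)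
  obtain ⟨M', hM'⟩ := hf' (δ / 2) (half_pos hδ)
  refine ⟨max M M', fun g g' hgg => ?_⟩
  have h1 := hM g g' fun y h1 h2 => hgg y (by omega) (by omega)
  have h2 := hM' g g' fun y h1 h2 => hgg y (by omega) (by omega)
  simp only [ContinuousMap.add_apply]
  rw [integral_add (integrable_jointStep hK g f) (integrable_jointStep hK g f'),
    integral_add (integrable_jointStep hK g' f) (integrable_jointStep hK g' f')]
  rw [abs_le] at *
  constructor <;> linarith [h1.1, h1.2, h2.1, h2.2]

lemma IsLocalFun.smul {f : C(Path I, ℝ)} (c : ℝ) (hf : IsLocalFun K f) : IsLocalFun K (c • f) := by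
  intro δ hδ
  obtain ⟨M, hM⟩ := hf (δ / (|c| + 1)) (by positivity)
  refine ⟨M, fun g g' hgg => ?_⟩
  have h1 := hM g g' hgg
  simp only [ContinuousMap.smul_apply, smul_eq_mul]
  rw [integral_const_mul, integral_const_mul, ← mul_sub, abs_mul]
  calc |c| * _ ≤ |c| * (δ / (|c| + 1)) := mul_le_mul_of_nonneg_left h1 (abs_nonneg _)
    _ ≤ (|c| + 1) * (δ / (|c| + 1)) := by gcongr; linarith
    _ = δ := by field_simp

lemma isLocalFun_of_forall_near (hK : IsVertexKernel K ε) {f : C(Path I, ℝ)}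
    (hf : ∀ δ > 0, ∃ f', IsLocalFun K f' ∧ ‖f' - f‖ < δ) : IsLocalFun K f := by
  intro δ hδ
  obtain ⟨f', hf', hn⟩ := hf (δ / 3) (by positivity)
  obtain ⟨M, hM⟩ := hf' (δ / 3) (by positivity)
  refine ⟨M, fun g g' hgg => ?_⟩
  have h1 := hM g g' hgg
  have key : ∀ g, |∫ s, f' s ∂(jointStep K g) - ∫ s, f s ∂(jointStep K g)| ≤ δ / 3 := by
    intro g
    have := isProbabilityMeasure_jointStep hK g
    rw [← integral_sub (integrable_jointStep hK g f') (integrable_jointStep hK g f),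
      ← Real.norm_eq_abs]
    refine (norm_integral_le_of_norm_le_const (C := δ / 3) (ae_of_all _ fun s => ?_)).trans ?_
    · exact ((f' - f).norm_coe_le_norm s).trans hn.le
    · simp
  have h2 := key g
  have h3 := key g'
  rw [abs_le] at *
  constructor <;> linarith [h1.1, h1.2, h2.1, h2.2, h3.1, h3.2]

/-- The products of local functions with values in `[0, 1]`. -/
def pathTests (I : ℕ) : Submonoid C(Path I, ℝ) where
  carrier := {f | ∃ (φ : ℤ → Fin (I + 1) → Fin (I + 1) → ℝ) (R : ℕ),
    (∀ y i j, 0 ≤ φ y i j ∧ φ y i j ≤ 1) ∧ (∀ y, y < -(R : ℤ) ∨ (R : ℤ) ≤ y → φ y = 1) ∧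
    f = ⟨pathTest φ R, continuous_pathTest φ R⟩}
  one_mem' := ⟨1, 0, fun _ _ _ => by simp, fun _ _ => rfl, by ext s; simp [pathTest]⟩
  mul_mem' := by
    rintro _ _ ⟨φ, R, h1, h2, rfl⟩ ⟨φ', R', h1', h2', rfl⟩
    refine ⟨φ * φ', max R R', fun y i j => ⟨mul_nonneg (h1 y i j).1 (h1' y i j).1,
      mul_le_one₀ (h1 y i j).2 (h1' y i j).1 (h1' y i j).2⟩, fun y hy => ?_, ?_⟩
    · rw [Pi.mul_apply, h2 y (by omega), h2' y (by omega), mul_one]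
    · ext s
      simp only [ContinuousMap.mul_apply, ContinuousMap.coe_mk]
      rw [← pathTest_mono (le_max_left R R') h2, ← pathTest_mono (le_max_right R R') h2']
      simp [pathTest, Finset.prod_mul_distrib]

/-- Stone–Weierstrass on the compact path space. The products of local functions are closed under
multiplication, so the algebra they generate is their span, and there locality follows by linearity.
This algebra separates points, and locality survives uniform limits. -/
lemma isLocalFun (hK : IsVertexKernel K ε) (f : C(Path I, ℝ)) : IsLocalFun K f := by
  have hA : ∀ f' ∈ Algebra.adjoin ℝ (pathTests I : Set C(Path I, ℝ)), IsLocalFun K f' := by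
    intro f' hf'
    rw [← Subalgebra.mem_toSubmodule, Algebra.adjoin_eq_span, Submonoid.closure_eq] at hf'
    induction hf' using Submodule.span_induction with
    | mem x hx =>
      obtain ⟨φ, R, h1, h2, rfl⟩ := hx
      exact isLocalFun_pathTest hK h1 h2
    | zero => exact fun δ hδ => ⟨0, fun g g' _ => by simpa using hδ.le⟩
    | add x y _ _ hx hy => exact hx.add hK hy
    | smul c x _ hx => exact hx.smul c
  have hsep : (Algebra.adjoin ℝ (pathTests I : Set C(Path I, ℝ))).SeparatesPoints := by
    intro s s' hss
    obtain ⟨y, hy⟩ := Function.ne_iff.1 hss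
    classical
    set φ : ℤ → Fin (I + 1) → Fin (I + 1) → ℝ := fun z i j =>
      if z = y then (if (i, j) = s y then 1 else 0) else 1 with hφ
    set R : ℕ := y.natAbs + 1
    refine ⟨pathTest φ R, ⟨⟨pathTest φ R, continuous_pathTest φ R⟩, Algebra.subset_adjoin
      ⟨φ, R, fun z i j => ?_, fun z hz => ?_, rfl⟩, rfl⟩, ?_⟩
    · simp only [hφ]
      split_ifs <;> simp
    · ext i j
      simp only [hφ, Pi.one_apply]
      rw [if_neg (by omega)]
    · have h1 : ∀ t : Path I, pathTest φ R t = if t y = s y then 1 else 0 := by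
        intro t
        rw [pathTest, Finset.prod_eq_single y]
        · simp [hφ]
        · intro z _ hz
          simp only [hφ, if_neg hz]
        · intro hc
          rw [Finset.mem_Ico] at hc
          omega
      rw [h1, h1, if_pos rfl, if_neg (Ne.symm hy)]
      norm_num
  refine isLocalFun_of_forall_near hK fun δ hδ => ?_
  obtain ⟨f', hf'⟩ := ContinuousMap.exists_mem_subalgebra_near_continuousMap_of_separatesPoints
    _ hsep f δ hδ
  exact ⟨f', hA _ f'.2, hf'⟩

/-! ### The step from an infinite configuration -/

lemma trunc_apply_of_mem (g : Config I) {N : ℕ} {y : ℤ} (h1 : -(N : ℤ) ≤ y) (h2 : y ≤ N) :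
    trunc g N y = g y :=
  Finsupp.indicator_of_mem (Finset.mem_Icc.2 ⟨h1, h2⟩) _

lemma cauchySeq_integral_jointStep (hK : IsVertexKernel K ε) (g : Config I) (f : C(Path I, ℝ)) :
    CauchySeq fun N : ℕ => ∫ s, f s ∂(jointStep K (trunc g N)) := by
  rw [Metric.cauchySeq_iff']
  intro δ hδ
  obtain ⟨M, hM⟩ := isLocalFun hK f (δ / 2) (half_pos hδ)
  refine ⟨M, fun n hn => ?_⟩
  rw [Real.dist_eq]
  refine (hM _ _ fun y h1 h2 => ?_).trans_lt (half_lt_self hδ)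
  rw [trunc_apply_of_mem g (by omega) (by omega), trunc_apply_of_mem g h1 h2.le]

/-- The joint law of the new configuration and of the crossing particles exists for every initial
configuration. -/
lemma exists_jointLaw (hK : IsVertexKernel K ε) (g : Config I) :
    ∃ ν : ProbabilityMeasure (Path I), ∀ f : C(Path I, ℝ),
      Tendsto (fun N : ℕ => ∫ s, f s ∂(jointStep K (trunc g N))) atTop (𝓝 (∫ s, f s ∂ν)) := by
  set u : ℕ → ProbabilityMeasure (Path I) := fun N =>
    ⟨jointStep K (trunc g N), isProbabilityMeasure_jointStep hK _⟩ with hu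
  -- Compactness only yields a cluster point; the Cauchy property of each integral upgrades it to a
  -- limit.
  obtain ⟨ν, hν⟩ := exists_clusterPt_of_compactSpace (map u atTop)
  refine ⟨ν, fun f => ?_⟩
  have hcont : Tendsto (fun μ : ProbabilityMeasure (Path I) => ∫ s, f s ∂(μ : Measure (Path I)))
      (𝓝 ν) (𝓝 (∫ s, f s ∂(ν : Measure (Path I)))) :=
    ProbabilityMeasure.tendsto_iff_forall_integral_tendsto.1 tendsto_id
      (BoundedContinuousFunction.mkOfCompact f)
  exact le_nhds_of_cauchy_adhp (cauchySeq_integral_jointStep hK g f)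
    (MapClusterPt.tendsto_comp hcont hν)

/-- The joint law of the new configuration and of the crossing particles after a step
from `g`. -/
def jointLaw (hK : IsVertexKernel K ε) (g : Config I) : ProbabilityMeasure (Path I) :=
  (exists_jointLaw hK g).choose

lemma tendsto_jointLaw (hK : IsVertexKernel K ε) (g : Config I) (f : C(Path I, ℝ)) :
    Tendsto (fun N : ℕ => ∫ s, f s ∂(jointStep K (trunc g N))) atTop
      (𝓝 (∫ s, f s ∂(jointLaw hK g : Measure (Path I)))) :=
  (exists_jointLaw hK g).choose_spec f

/-- The limit does not depend on the way `g` is exhausted by finite configurations. The shift needs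
this, since it moves symmetric truncations to asymmetric ones. -/
lemma tendsto_jointLaw_of_eventually (hK : IsVertexKernel K ε) {g : Config I}
    {u : ℕ → ℤ →₀ Fin (I + 1)}
    (hu : ∀ M : ℕ, ∀ᶠ n in atTop, ∀ y, -(M : ℤ) ≤ y → y < M → u n y = g y) (f : C(Path I, ℝ)) :
    Tendsto (fun n : ℕ => ∫ s, f s ∂(jointStep K (u n))) atTop
      (𝓝 (∫ s, f s ∂(jointLaw hK g : Measure (Path I)))) := by
  have h0 : Tendsto (fun n : ℕ => ∫ s, f s ∂(jointStep K (u n)) -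
      ∫ s, f s ∂(jointStep K (trunc g n))) atTop (𝓝 0) := by
    rw [Metric.tendsto_atTop']
    intro δ hδ
    obtain ⟨M, hM⟩ := isLocalFun hK f (δ / 2) (half_pos hδ)
    obtain ⟨n₀, hn₀⟩ := eventually_atTop.1 (hu M)
    refine ⟨max n₀ M, fun n hn => ?_⟩
    rw [Real.dist_eq, sub_zero]
    refine (hM _ _ fun y h1 h2 => ?_).trans_lt (half_lt_self hδ)
    rw [hn₀ n (by omega) y h1 h2, trunc_apply_of_mem g (by omega) (by omega)]
  have := h0.add (tendsto_jointLaw hK g f)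
  simpa using this

/-- The Feller property. Agreement with `g` on an interval is a neighbourhood of `g` in the product
topology, and locality bounds the effect of all other sites. -/
lemma continuous_integral_jointLaw (hK : IsVertexKernel K ε) (f : C(Path I, ℝ)) :
    Continuous fun g : Config I => ∫ s, f s ∂(jointLaw hK g : Measure (Path I)) := by
  rw [continuous_iff_continuousAt]
  intro g
  rw [ContinuousAt, Metric.tendsto_nhds]
  intro δ hδ
  obtain ⟨M, hM⟩ := isLocalFun hK f (δ / 2) (half_pos hδ)
  have hnhds : Set.pi (Finset.Icc (-(M : ℤ)) M : Set ℤ) (fun y => {g y}) ∈ 𝓝 g :=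
    set_pi_mem_nhds (Finset.finite_toSet _) fun y _ => mem_nhds_discrete.2 rfl
  filter_upwards [hnhds] with g' hg'
  rw [Real.dist_eq]
  refine lt_of_le_of_lt ?_ (half_lt_self hδ)
  refine le_of_tendsto' ((tendsto_jointLaw hK g' f).sub (tendsto_jointLaw hK g f)).abs
    fun N => hM _ _ fun y h1 h2 => ?_
  by_cases hy : y ∈ Finset.Icc (-(N : ℤ)) N
  · rw [Finset.mem_Icc] at hy
    rw [trunc_apply_of_mem g' hy.1 hy.2, trunc_apply_of_mem g hy.1 hy.2]
    exact hg' y (by rw [Finset.mem_coe, Finset.mem_Icc]; omega)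
  · rw [trunc, trunc, Finsupp.indicator_of_notMem hy, Finsupp.indicator_of_notMem hy]

/-- The continuous indicator function of a clopen set. -/
def clopenIndicator {X : Type*} [TopologicalSpace X] {C : Set X} (hC : IsClopen C) : C(X, ℝ) :=
  ⟨C.indicator 1, continuous_one.indicator (by simp [hC.frontier_eq])⟩

lemma integral_clopenIndicator {X : Type*} [TopologicalSpace X] [MeasurableSpace X] [BorelSpace X]
    {C : Set X} (hC : IsClopen C) (μ : Measure X) :
    ∫ x, clopenIndicator hC x ∂μ = μ.real C :=
  integral_indicator_one hC.isOpen.measurableSet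

lemma isClopen_pi {X : Type*} [TopologicalSpace X] [DiscreteTopology X] (s : Finset ℤ)
    (t : ℤ → Set X) : IsClopen (Set.pi (s : Set ℤ) t) :=
  ⟨isClosed_set_pi fun _ _ => isClosed_discrete _,
    isOpen_set_pi s.finite_toSet fun _ _ => isOpen_discrete _⟩

/-- Cylinders are clopen, so their probabilities are continuous in `g` by the Feller property, and
they form a generating π-system. -/
lemma measurable_jointLaw (hK : IsVertexKernel K ε) :
    Measurable fun g : Config I => (jointLaw hK g : Measure (Path I)) := by
  refine Measurable.measure_of_isPiSystem_of_isProbabilityMeasure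
    (generateFrom_squareCylinders (α := fun _ : ℤ => Fin (I + 1) × Fin (I + 1))).symm
    (isPiSystem_squareCylinders (fun _ => MeasurableSpace.isPiSystem_measurableSet)
      fun _ => Set.mem_ofPred_eq ▸ MeasurableSet.univ) ?_
  rintro _ ⟨s, t, -, rfl⟩
  have hC := isClopen_pi s t
  have h1 := (continuous_integral_jointLaw hK (clopenIndicator hC)).measurable.ennreal_ofReal
  simp only [integral_clopenIndicator, measureReal_def,
    ENNReal.ofReal_toReal (measure_ne_top _ _)] at h1
  exact h1

lemma jointLaw_shift (hK : IsVertexKernel K ε) (g : Config I) :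
    (jointLaw hK (shift 1 g) : Measure (Path I)) =
      (jointLaw hK g : Measure (Path I)).map pathShift := by
  have : IsProbabilityMeasure ((jointLaw hK g : Measure (Path I)).map pathShift) :=
    Measure.isProbabilityMeasure_map continuous_pathShift.measurable.aemeasurable
  refine ext_of_forall_integral_eq_of_IsFiniteMeasure fun f => ?_
  rw [integral_map continuous_pathShift.measurable.aemeasurable
    f.continuous.measurable.aestronglyMeasurable]
  have h1 := tendsto_jointLaw_of_eventually hK (g := shift 1 g) (u := fun n => finShift (trunc g n))
    (fun M => by
      filter_upwards [eventually_ge_atTop (M + 1)] with n hn y h1 h2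
      rw [finShift_apply, trunc_apply_of_mem g (by omega) (by omega)]
      rfl) f.toContinuousMap
  have h2 := tendsto_jointLaw hK g ⟨fun s => f (pathShift s), f.continuous.comp continuous_pathShift⟩
  refine tendsto_nhds_unique h1 (h2.congr fun n => ?_)
  rw [jointStep_finShift]
  exact (integral_map continuous_pathShift.measurable.aemeasurable
    f.continuous.measurable.aestronglyMeasurable).symm

/-- The law of the new configuration after a step of the model. -/
lemma stepLaw_eq {q α : ℝ} (hK : IsVertexKernel (L I I q α) ε) (g : Config I) :
    stepLaw I I q α g = (jointLaw hK g : Measure (Path I)).map newConfig := by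
  have hprob : IsProbabilityMeasure ((jointLaw hK g : Measure (Path I)).map newConfig) :=
    Measure.isProbabilityMeasure_map continuous_newConfig.measurable.aemeasurable
  have hlaw : IsStepLaw I I q α g ⟨(jointLaw hK g : Measure (Path I)).map newConfig, hprob⟩ := by
    intro f
    have h2 := tendsto_jointLaw hK g
      ⟨fun s => f (newConfig s), f.continuous.comp continuous_newConfig⟩
    simp only [ProbabilityMeasure.coe_mk]
    rw [integral_map continuous_newConfig.measurable.aemeasurable
      f.continuous.measurable.aestronglyMeasurable]
    refine h2.congr fun N => ?_
    rw [finStep_eq_map, integral_map continuous_newConfig.measurable.aemeasurable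
      f.continuous.measurable.aestronglyMeasurable]
    rfl
  -- The limit exists for every `g`, so the default value `0` of `stepLaw` is never taken.
  have hex : ∃ ν : ProbabilityMeasure (Config I), IsStepLaw I I q α g ν := ⟨_, hlaw⟩
  rw [stepLaw, dif_pos hex]
  refine ext_of_forall_integral_eq_of_IsFiniteMeasure fun f => ?_
  exact tendsto_nhds_unique (hex.choose_spec f) (hlaw f)

/-! ### The step from a product measure -/

/-- The product measure with the marginals `π`. -/
abbrev prodMeasure (π : ℤ → PMF (Fin (I + 1))) : Measure (Config I) :=
  Measure.infinitePi fun x => (π x).toMeasure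

lemma integrable_of_continuous {X : Type*} [TopologicalSpace X] [CompactSpace X]
    [MeasurableSpace X] [OpensMeasurableSpace X] {μ : Measure X} [IsFiniteMeasure μ] {f : X → ℝ}
    (hf : Continuous f) : Integrable f μ :=
  (BoundedContinuousFunction.mkOfCompact ⟨f, hf⟩).integrable μ

lemma continuous_transferIter (φ : ℤ → Fin (I + 1) → Fin (I + 1) → ℝ) (x : ℤ)
    (v : Fin (I + 1) → ℝ) (n : ℕ) (j : Fin (I + 1)) :
    Continuous fun g : Config I => transferIter K g φ x v n j := by
  induction n generalizing j with
  | zero => exact continuous_const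
  | succ n ih =>
    simp only [transferIter, transfer]
    refine continuous_finsetSum _ fun j' _ => (ih j').mul ?_
    have : Continuous fun i : Fin (I + 1) => ∑ i', K i j' i' j * φ (x + n) i' j :=
      continuous_of_discreteTopology
    exact this.comp (continuous_apply (x + (n : ℤ)))

/-- Under a product measure, a coordinate is independent of a function of other coordinates. -/
lemma integral_mul_coordinate (π : ℤ → PMF (Fin (I + 1))) {b : Config I → ℝ} (S : Finset ℤ)
    {x : ℤ} (hx : x ∉ S) (hb : ∀ g g' : Config I, (∀ y ∈ S, g y = g' y) → b g = b g')
    (a : Fin (I + 1) → ℝ) :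
    ∫ g, b g * a (g x) ∂(prodMeasure π) =
      (∫ g, b g ∂(prodMeasure π)) * ∑ i, (π x i).toReal * a i := by
  classical
  have hind : iIndepFun (fun (y : ℤ) (g : Config I) => g y) (prodMeasure π) :=
    iIndepFun_infinitePi (X := fun _ i => i) fun _ => measurable_id
  have h2 := hind.indepFun_finset S {x} (Finset.disjoint_singleton_right.2 hx)
    fun y => measurable_pi_apply y
  -- `b` factors through the coordinates in `S`; the value `0` elsewhere is an arbitrary filling.
  set F : (S → Fin (I + 1)) → ℝ := fun r => b fun y => if h : y ∈ S then r ⟨y, h⟩ else 0 with hF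
  have hFb : ∀ g : Config I, F (fun y : S => g y) = b g := fun g =>
    hb _ _ fun y hy => by simp [hy]
  have h3 := h2.comp (φ := F) (ψ := fun r : ({x} : Finset ℤ) → Fin (I + 1) =>
    a (r ⟨x, Finset.mem_singleton_self x⟩)) .of_discrete .of_discrete
  have h4 : IndepFun b (fun g : Config I => a (g x)) (prodMeasure π) := by
    refine h3.congr (ae_of_all _ fun g => hFb g) (ae_of_all _ fun g => rfl)
  have hbm : Measurable b := by
    have hr : Measurable fun (g : Config I) (y : S) => g y :=
      measurable_pi_lambda _ fun y => measurable_pi_apply _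
    have : Measurable fun g : Config I => F (fun y : S => g y) :=
      (Measurable.of_discrete (f := F)).comp hr
    simpa only [hFb] using this
  have ham : Measurable fun g : Config I => a (g x) :=
    (Measurable.of_discrete (f := a)).comp (measurable_pi_apply x)
  rw [h4.integral_fun_mul_eq_mul_integral hbm.aestronglyMeasurable ham.aestronglyMeasurable]
  congr 1
  have h5 := measurePreserving_eval_infinitePi (fun x => (π x).toMeasure) x
  have h6 : ∫ g, a (g x) ∂(prodMeasure π) = ∫ i, a i ∂(π x).toMeasure := by
    rw [← h5.map_eq, integral_map h5.measurable.aemeasurable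
      (Measurable.of_discrete (f := a)).aestronglyMeasurable]
  rw [h6, PMF.integral_eq_sum]
  simp only [smul_eq_mul]

/-- The vertex weights propagate the product measure with vertical marginals `π` and horizontal
marginals `ρ` to the vertical marginals `π'`. -/
def Propagates (K : Fin (I + 1) → Fin (I + 1) → Fin (I + 1) → Fin (I + 1) → ℝ)
    (π ρ π' : ℤ → PMF (Fin (I + 1))) : Prop :=
  ∀ x, MapsProduct K (π x) (ρ x) (π' x) (ρ (x + 1))

/-- Induction along the sites. The line weight that reaches `x + n` depends only on `g` over `[x, x
+ n)`, hence is independent of `g (x + n)`. The vertex identity then turns `π ⊗ ρ` into `π' ⊗ ρ`,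
with the new line law at the next site. -/
lemma integral_transferIter {π ρ π' : ℤ → PMF (Fin (I + 1))} (h : Propagates K π ρ π')
    (ψ : ℤ → Fin (I + 1) → ℝ) (x : ℤ) (n : ℕ) (j : Fin (I + 1)) :
    ∫ g, transferIter K g (fun y i _ => ψ y i) x (fun j => (ρ x j).toReal) n j ∂(prodMeasure π) =
      (∏ k ∈ Finset.range n, ∑ i, (π' (x + k) i).toReal * ψ (x + k) i) * (ρ (x + n) j).toReal := by
  induction n generalizing j with
  | zero => simp [transferIter]
  | succ n ih =>
    simp only [transferIter, transfer]
    have h_integrable : ∀ j', Integrable (fun g : Config I =>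
        transferIter K g (fun y i _ => ψ y i) x (fun j => (ρ x j).toReal) n j' *
          ∑ i', K (g (x + n)) j' i' j * ψ (x + n) i') (prodMeasure π) := fun j' => by
      refine integrable_of_continuous ((continuous_transferIter _ _ _ _ _).mul ?_)
      have : Continuous fun i : Fin (I + 1) => ∑ i', K i j' i' j * ψ (x + n) i' :=
        continuous_of_discreteTopology
      exact this.comp (continuous_apply (x + (n : ℤ)))
    rw [integral_finsetSum _ fun j' _ => h_integrable j']
    have e : ∀ j', ∫ g : Config I, transferIter K g (fun y i _ => ψ y i) x
        (fun j => (ρ x j).toReal) n j' * ∑ i', K (g (x + n)) j' i' j * ψ (x + n) i'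
          ∂(prodMeasure π) =
        (∏ k ∈ Finset.range n, ∑ i, (π' (x + k) i).toReal * ψ (x + k) i) *
          ((ρ (x + n) j').toReal *
            ∑ i, (π (x + n) i).toReal * ∑ i', K i j' i' j * ψ (x + n) i') := by
      intro j'
      rw [integral_mul_coordinate π (Finset.Ico x (x + n)) (x := x + n) (by simp)
        (b := fun g => transferIter K g (fun y i _ => ψ y i) x (fun j => (ρ x j).toReal) n j')
        (fun g g' hg => by
          rw [transferIter_congr _ (fun y h1 h2 => hg y (Finset.mem_Ico.2 ⟨h1, h2⟩))
            fun _ _ _ => rfl])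
        (fun i => ∑ i', K i j' i' j * ψ (x + n) i'), ih, mul_assoc]
    rw [Finset.sum_congr rfl fun j' _ => e j', ← Finset.mul_sum, Finset.prod_range_succ, mul_assoc]
    congr 1
    push_cast
    rw [← add_assoc, Finset.sum_mul]
    have h1 : ∀ i', (π' (x + n) i').toReal * ψ (x + n) i' * (ρ (x + n + 1) j).toReal =
        ∑ j', ∑ i, (ρ (x + n) j').toReal * ((π (x + n) i).toReal *
          (K i j' i' j * ψ (x + n) i')) := by
      intro i'
      rw [mul_right_comm, ← h (x + n) i' j, Finset.sum_mul, Finset.sum_comm]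
      refine Finset.sum_congr rfl fun i _ => ?_
      rw [Finset.sum_mul]
      exact Finset.sum_congr rfl fun j' _ => by ring
    rw [Finset.sum_congr rfl fun i' _ => h1 i', Finset.sum_comm]
    refine Finset.sum_congr rfl fun j' _ => ?_
    rw [Finset.sum_comm, Finset.mul_sum]
    refine Finset.sum_congr rfl fun i _ => ?_
    rw [Finset.mul_sum, Finset.mul_sum]

lemma abs_integral_jointLaw_sub_windowValue_le (hK : IsVertexKernel K ε) (g : Config I)
    {φ : ℤ → Fin (I + 1) → Fin (I + 1) → ℝ} (hφ : ∀ y i j, 0 ≤ φ y i j ∧ φ y i j ≤ 1) {R M : ℕ}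
    (hφ1 : ∀ y, y < -(R : ℤ) ∨ (R : ℤ) ≤ y → φ y = 1) (hRM : R ≤ M) {v : Fin (I + 1) → ℝ}
    (hv : ∀ j, 0 ≤ v j) (hv1 : ∑ j, v j = 1) :
    |∫ s, pathTest φ R s ∂(jointLaw hK g : Measure (Path I)) - windowValue K g φ R M v| ≤
      (1 - ε) ^ (M - R) * 2 := by
  refine le_of_tendsto ((tendsto_jointLaw hK g
    ⟨pathTest φ R, continuous_pathTest φ R⟩).sub_const _).abs ?_
  filter_upwards [eventually_ge_atTop M] with N hN
  obtain ⟨w, hw, hw1, ew⟩ := exists_integral_eq_windowValue hK (trunc g N) hφ hφ1 hRM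
  simp only [ContinuousMap.coe_mk]
  rw [ew, windowValue_congr (g' := g) fun y h1 h2 => trunc_apply_of_mem g (by omega) (by omega)]
  exact abs_windowValue_sub_le hK hφ hφ1 hRM hw hw1 hv hv1

lemma sum_toReal_pmf (p : PMF (Fin (I + 1))) : ∑ i, (p i).toReal = 1 := by
  rw [← ENNReal.toReal_sum fun i _ => p.apply_ne_top i, ← tsum_fintype (L := .unconditional _), p.tsum_coe,
    ENNReal.toReal_one]

/-- The expectation after a step from a random configuration, when the windows may be started from
any weight on the horizontal lines. -/
lemma integral_integral_jointLaw (hK : IsVertexKernel K ε) {μ : Measure (Config I)}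
    [IsProbabilityMeasure μ] {φ : ℤ → Fin (I + 1) → Fin (I + 1) → ℝ}
    (hφ : ∀ y i j, 0 ≤ φ y i j ∧ φ y i j ≤ 1) {R : ℕ}
    (hφ1 : ∀ y, y < -(R : ℤ) ∨ (R : ℤ) ≤ y → φ y = 1) (ρ : ℤ → PMF (Fin (I + 1))) {c : ℝ}
    (hc : ∀ M : ℕ, R ≤ M →
      ∫ g, windowValue K g φ R M (fun j => (ρ (-M) j).toReal) ∂μ = c) :
    ∫ g, ∫ s, pathTest φ R s ∂(jointLaw hK g : Measure (Path I)) ∂μ = c := by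
  have hcont : Continuous fun g => ∫ s, pathTest φ R s ∂(jointLaw hK g : Measure (Path I)) :=
    continuous_integral_jointLaw hK ⟨pathTest φ R, continuous_pathTest φ R⟩
  have hcont' : ∀ M v, Continuous fun g : Config I => windowValue K g φ R M v := fun M v =>
    continuous_finsetSum _ fun j _ => continuous_transferIter _ _ _ _ _
  have hlim : Tendsto (fun d : ℕ => (1 - ε) ^ d * 2) atTop (𝓝 0) := by
    simpa using (tendsto_pow_atTop_nhds_zero_of_lt_one (sub_nonneg.2 hK.le_one)
      (sub_lt_self 1 hK.pos)).mul_const 2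
  -- `c` does not depend on the starting point `-(R + d)` of the window, while the error of starting
  -- from `ρ` there tends to zero with `d`.
  refine eq_of_abs_sub_nonpos (ge_of_tendsto' hlim fun d => ?_)
  rw [← hc (R + d) (by omega), ← integral_sub (integrable_of_continuous hcont)
    (integrable_of_continuous (hcont' _ _)),
    ← Real.norm_eq_abs]
  refine (norm_integral_le_of_norm_le_const (C := (1 - ε) ^ d * 2) (ae_of_all _ fun g => ?_)).trans
    (by simp)
  rw [Real.norm_eq_abs]
  have := abs_integral_jointLaw_sub_windowValue_le hK g hφ hφ1 (Nat.le_add_right R d)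
    (v := fun j => (ρ (-((R + d : ℕ) : ℤ)) j).toReal) (fun j => ENNReal.toReal_nonneg)
    (sum_toReal_pmf _)
  rwa [Nat.add_sub_cancel_left] at this

/-- The law of the realization of the step from a random configuration of law `μ`. -/
def jointMeasure (hK : IsVertexKernel K ε) (μ : Measure (Config I)) : Measure (Path I) :=
  μ.bind fun g => (jointLaw hK g : Measure (Path I))

lemma jointMeasure_apply (hK : IsVertexKernel K ε) (μ : Measure (Config I)) {C : Set (Path I)}
    (hC : MeasurableSet C) :
    jointMeasure hK μ C = ∫⁻ g, (jointLaw hK g : Measure (Path I)) C ∂μ :=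
  Measure.bind_apply hC (measurable_jointLaw hK).aemeasurable

lemma evolve_eq_map {q α : ℝ} (hK : IsVertexKernel (L I I q α) ε) (μ : Measure (Config I)) :
    evolve I I q α μ = (jointMeasure hK μ).map newConfig := by
  have e : stepLaw I I q α = fun g => (jointLaw hK g : Measure (Path I)).map newConfig :=
    funext fun g => stepLaw_eq hK g
  have hm : Measurable fun g : Config I => (jointLaw hK g : Measure (Path I)).map newConfig :=
    (Measure.measurable_map _ continuous_newConfig.measurable).comp (measurable_jointLaw hK)
  ext B hB
  rw [evolve, e, Measure.bind_apply hB hm.aemeasurable,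
    Measure.map_apply continuous_newConfig.measurable hB,
    jointMeasure_apply hK μ (continuous_newConfig.measurable hB)]
  exact lintegral_congr fun g => Measure.map_apply continuous_newConfig.measurable hB

lemma evolve_apply {q α : ℝ} (hK : IsVertexKernel (L I I q α) ε) (μ : Measure (Config I))
    {B : Set (Config I)} (hB : MeasurableSet B) :
    evolve I I q α μ B =
      ∫⁻ g, (jointLaw hK g : Measure (Path I)) (newConfig ⁻¹' B) ∂μ := by
  rw [evolve_eq_map hK, Measure.map_apply continuous_newConfig.measurable hB,
    jointMeasure_apply hK μ (continuous_newConfig.measurable hB)]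

lemma jointMeasure_apply_of_pathTest (hK : IsVertexKernel K ε) {μ : Measure (Config I)}
    [IsProbabilityMeasure μ] {φ : ℤ → Fin (I + 1) → Fin (I + 1) → ℝ}
    (hφ : ∀ y i j, 0 ≤ φ y i j ∧ φ y i j ≤ 1) {R : ℕ}
    (hφ1 : ∀ y, y < -(R : ℤ) ∨ (R : ℤ) ≤ y → φ y = 1) (ρ : ℤ → PMF (Fin (I + 1))) {c : ℝ}
    (hc : ∀ M : ℕ, R ≤ M →
      ∫ g, windowValue K g φ R M (fun j => (ρ (-M) j).toReal) ∂μ = c)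
    {C : Set (Path I)} (hC : ∀ s, pathTest φ R s = C.indicator 1 s) :
    jointMeasure hK μ C = ENNReal.ofReal c := by
  classical
  have hCm : MeasurableSet C := by
    have : C = pathTest φ R ⁻¹' {1} := by
      ext s
      by_cases h : s ∈ C <;> simp [hC, h]
    rw [this]
    exact (continuous_pathTest φ R).measurable (measurableSet_singleton 1)
  have hcont : Continuous fun g => ∫ s, pathTest φ R s ∂(jointLaw hK g : Measure (Path I)) :=
    continuous_integral_jointLaw hK ⟨pathTest φ R, continuous_pathTest φ R⟩
  rw [← integral_integral_jointLaw hK hφ hφ1 ρ hc, jointMeasure_apply hK μ hCm,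
    ofReal_integral_eq_lintegral_ofReal (integrable_of_continuous hcont)
      (ae_of_all _ fun g => integral_nonneg fun s => (pathTest_mem_Icc hφ R s).1)]
  refine lintegral_congr fun g => ?_
  simp_rw [hC]
  rw [integral_indicator_one hCm, ofReal_measureReal]

lemma toReal_toMeasure (p : PMF (Fin (I + 1))) (t : Set (Fin (I + 1))) :
    (p.toMeasure t).toReal = ∑ i, (p i).toReal * t.indicator 1 i := by
  classical
  rw [PMF.toMeasure_apply_fintype, ENNReal.toReal_sum fun i _ => by
    by_cases h : i ∈ t <;> simp [h, p.apply_ne_top]]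
  refine Finset.sum_congr rfl fun i _ => ?_
  by_cases h : i ∈ t <;> simp [h]

lemma exists_nat_bound (s : Finset ℤ) : ∃ R : ℕ, ∀ y ∈ s, -(R : ℤ) ≤ y ∧ y < R := by
  refine ⟨s.sup fun y => y.natAbs + 1, fun y hy => ?_⟩
  have : y.natAbs + 1 ≤ s.sup fun y => y.natAbs + 1 :=
    Finset.le_sup (f := fun y : ℤ => y.natAbs + 1) hy
  omega

/-- The step maps a product measure to the product measure with the propagated marginals. -/
lemma map_newConfig_jointMeasure (hK : IsVertexKernel K ε) {π ρ π' : ℤ → PMF (Fin (I + 1))}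
    (h : Propagates K π ρ π') :
    (jointMeasure hK (prodMeasure π)).map newConfig = prodMeasure π' := by
  classical
  refine Measure.eq_infinitePi _ fun s t ht => ?_
  rw [Measure.map_apply continuous_newConfig.measurable (.pi s.countable_toSet fun _ _ => ht _)]
  obtain ⟨R, hR⟩ := exists_nat_bound s
  -- The indicator of a cylinder is a product of one-site tests that ignore the horizontal lines, as
  -- `integral_transferIter` requires.
  set ψ : ℤ → Fin (I + 1) → ℝ := fun y => if y ∈ s then (t y).indicator 1 else 1 with hψ
  have hψ01 : ∀ y i, ψ y i = 0 ∨ ψ y i = 1 := fun y i => by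
    by_cases h1 : y ∈ s <;> by_cases h2 : i ∈ t y <;> simp [hψ, h1, h2]
  have key := jointMeasure_apply_of_pathTest hK (μ := prodMeasure π) (φ := fun y i _ => ψ y i)
    (R := R) (C := newConfig ⁻¹' Set.pi s t) (c := ∏ y ∈ s, ((π' y).toMeasure (t y)).toReal)
    (fun y i j => by rcases hψ01 y i with e | e <;> simp [e])
    (fun y hy => by
      have : y ∉ s := fun hs => by have := hR y hs; omega
      ext i j; simp [hψ, this]) ρ ?_ ?_
  · rw [key, ENNReal.ofReal_prod_of_nonneg fun _ _ => ENNReal.toReal_nonneg]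
    exact Finset.prod_congr rfl fun y _ => ENNReal.ofReal_toReal (measure_ne_top _ _)
  · intro M hM
    simp only [windowValue]
    rw [integral_finsetSum _ fun j _ => integrable_of_continuous
      (continuous_transferIter _ _ _ _ _), Finset.sum_congr rfl fun j _ =>
      integral_transferIter h ψ (-M) (M + R) j, ← Finset.mul_sum, sum_toReal_pmf, mul_one,
      ← prod_Ico_int fun y => ∑ i, (π' y i).toReal * ψ y i]
    rw [← Finset.prod_subset (s₁ := s)]
    · exact Finset.prod_congr rfl fun y hy => by rw [toReal_toMeasure]; simp [hψ, hy]
    · intro y hy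
      have := hR y hy
      rw [Finset.mem_Ico]; push_cast; omega
    · intro y _ hy
      simp [hψ, hy, sum_toReal_pmf]
  · intro s'
    rw [pathTest]
    by_cases hs' : s' ∈ newConfig ⁻¹' Set.pi s t
    · rw [Set.indicator_of_mem hs']
      refine Finset.prod_eq_one fun y _ => ?_
      by_cases hy : y ∈ s
      · have : (s' y).1 ∈ t y := hs' y hy
        simp [hψ, hy, this]
      · simp [hψ, hy]
    · rw [Set.indicator_of_notMem hs']
      simp only [Set.mem_preimage, Set.mem_pi, not_forall] at hs'
      obtain ⟨y, hy, hy'⟩ := hs'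
      have hy'' : (s' y).1 ∉ t y := hy'
      exact Finset.prod_eq_zero (i := y) (Finset.mem_Ico.2 (hR y hy)) (by simp [hψ, Finset.mem_coe.1 hy, hy''])

/-- The law of the number of horizontal lines after a step from a product measure. -/
lemma jointMeasure_horizontal (hK : IsVertexKernel K ε) {π ρ π' : ℤ → PMF (Fin (I + 1))}
    (h : Propagates K π ρ π') (x : ℤ) (t : Set (Fin (I + 1))) :
    jointMeasure hK (prodMeasure π) {s | (s x).2 ∈ t} = (ρ (x + 1)).toMeasure t := by
  classical
  obtain ⟨R, hR⟩ := exists_nat_bound {x}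
  simp only [Finset.mem_singleton, forall_eq] at hR
  set φ : ℤ → Fin (I + 1) → Fin (I + 1) → ℝ :=
    fun y _ j => if y = x then t.indicator 1 j else 1 with hφ
  have key := jointMeasure_apply_of_pathTest hK (μ := prodMeasure π) (φ := φ)
    (R := R) (C := {s | (s x).2 ∈ t}) (c := ((ρ (x + 1)).toMeasure t).toReal)
    (fun y i j => by by_cases h1 : y = x <;> by_cases h2 : j ∈ t <;> simp [hφ, h1, h2])
    (fun y hy => by
      have : y ≠ x := by omega
      ext i j; simp [hφ, this]) ρ ?_ ?_
  · rw [key, ENNReal.ofReal_toReal (measure_ne_top _ _)]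
  · intro M hM
    -- The window is cut after `x`: the `a` sites before `x` and the `b` sites after it carry no
    -- test, and the latter preserve the total mass.
    obtain ⟨a, ha⟩ := Int.eq_ofNat_of_zero_le (a := M + x) (by omega)
    obtain ⟨b, hb⟩ := Int.eq_ofNat_of_zero_le (a := R - x - 1) (by omega)
    have e1 : M + R = (a + 1) + b := by omega
    have ex : -(M : ℤ) + a = x := by omega
    have hw : ∀ g : Config I, windowValue K g φ R M (fun j => (ρ (-M) j).toReal) =
        ∑ j, t.indicator 1 j *
          transferIter K g 1 (-M) (fun j => (ρ (-M) j).toReal) (a + 1) j := by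
      intro g
      rw [windowValue, e1, transferIter_add, transferIter_congr (g' := g) (φ' := 1) _
        (fun _ _ _ => rfl) (fun y h1 h2 => by
          have : y ≠ x := by push_cast at h1; omega
          ext i j; simp [hφ, this]), sum_transferIter_one hK]
      refine Finset.sum_congr rfl fun j _ => ?_
      rw [transferIter, transferIter, transferIter_congr (g' := g) (φ' := 1) _
        (fun _ _ _ => rfl) (fun y h1 h2 => by
          have : y ≠ x := by omega
          ext i j; simp [hφ, this]), ex]
      simp only [transfer, hφ, if_true, Pi.one_apply, mul_one, Finset.mul_sum]
      exact Finset.sum_congr rfl fun j' _ => Finset.sum_congr rfl fun i _ => by ring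
    simp only [hw]
    rw [integral_finsetSum _ fun j _ => (integrable_of_continuous
      (continuous_transferIter _ _ _ _ _)).const_mul _, toReal_toMeasure]
    refine Finset.sum_congr rfl fun j _ => ?_
    have := integral_transferIter h 1 (-M) (a + 1) j
    simp only [Pi.one_apply, mul_one, sum_toReal_pmf, Finset.prod_const_one, one_mul] at this
    rw [integral_const_mul, mul_comm]
    congr 1
    refine Eq.trans this ?_
    rw [← ex]
    push_cast
    rw [add_assoc]
  · intro s
    rw [pathTest, Finset.prod_eq_single x]
    · by_cases hs : (s x).2 ∈ t
      · simp [hφ, hs]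
      · simp [hφ, hs]
    · intro y _ hy; simp [hφ, hy]
    · intro hx; exact absurd (Finset.mem_Ico.2 hR) hx

/-- Lines are conserved at every vertex. -/
lemma ae_jointLaw_conservation (hK : IsVertexKernel K ε) (g : Config I) :
    ∀ᵐ s ∂(jointLaw hK g : Measure (Path I)),
      ∀ x, (g x : ℕ) + (s (x - 1)).2 = (s x).1 + (s x).2 := by
  rw [ae_all_iff]
  intro x
  -- The violation of conservation at `x` depends on two coordinates only. It is clopen, so its
  -- probability is the limit of the probabilities for the truncations, which are zero once `N`
  -- covers `x`.
  have hC : IsClopen {s : Path I | ¬ (g x : ℕ) + (s (x - 1)).2 = (s x).1 + (s x).2} := by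
    have hc : Continuous fun s : Path I => ((s (x - 1)).2, s x) :=
      (continuous_snd.comp (continuous_apply _)).prodMk (continuous_apply _)
    exact (isClopen_discrete {p : Fin (I + 1) × Fin (I + 1) × Fin (I + 1) |
      ¬ (g x : ℕ) + p.1 = p.2.1 + p.2.2}).preimage hc
  have h1 := tendsto_jointLaw hK g (clopenIndicator hC)
  simp only [integral_clopenIndicator] at h1
  have h2 : (jointLaw hK g : Measure (Path I)).real
      {s : Path I | ¬ (g x : ℕ) + (s (x - 1)).2 = (s x).1 + (s x).2} = 0 := by
    refine tendsto_nhds_unique h1 (tendsto_const_nhds.congr' ?_)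
    filter_upwards [eventually_ge_atTop x.natAbs] with N hN
    symm
    rw [measureReal_def, jointStep, Measure.sum_apply _ hC.isOpen.measurableSet]
    simp only [ENNReal.toReal_eq_zero_iff, ENNReal.tsum_eq_zero]
    refine .inl fun s => ?_
    rw [Measure.smul_apply, smul_eq_mul, mul_eq_zero]
    by_cases hs : (s : Path I) ∈
        {s : Path I | ¬ (g x : ℕ) + (s (x - 1)).2 = (s x).1 + (s x).2}
    · left
      rw [ENNReal.ofReal_eq_zero]
      have hz : K (trunc g N x) (s (x - 1)).2 (s x).1 (s x).2 = 0 := by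
        by_contra hne
        have := hK.conservation hne
        rw [trunc_apply_of_mem g (by omega) (by omega)] at this
        exact hs this
      refine le_of_eq (finprod_eq_zero _ x hz ?_)
      -- A vanishing factor kills `finprod` only if its `mulSupport` is finite; otherwise the
      -- product defaults to `1`.
      obtain ⟨R, hR⟩ := exists_support_bound (trunc g N)
      obtain ⟨R', hR'⟩ := exists_support_bound s
      refine (Finset.Ico (-((R + R' : ℕ) : ℤ) - 1) ((R + R' : ℕ) + 2)).finite_toSet.subset ?_
      intro y hy
      rw [Function.mem_mulSupport] at hy
      by_contra hc
      rw [Finset.mem_coe, Finset.mem_Ico] at hc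
      push_cast at hc
      apply hy
      rw [hR y (by omega), hR' y (by omega), hR' (y - 1) (by omega)]
      exact hK.zero
    · right
      rw [Measure.dirac_apply' _ hC.isOpen.measurableSet, Set.indicator_of_notMem hs]
  rw [measureReal_eq_zero_iff] at h2
  exact h2

/-! ### One-step stationarity -/

lemma measurable_shift (n : ℤ) : Measurable (shift (I := I) n) :=
  measurable_pi_lambda _ fun _ => measurable_pi_apply _

lemma continuous_shift (n : ℤ) : Continuous (shift (I := I) n) :=
  continuous_pi fun _ => continuous_apply _

lemma evolve_map_shift {q α : ℝ} (hK : IsVertexKernel (L I I q α) ε) (μ : Measure (Config I)) :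
    evolve I I q α (μ.map (shift 1)) = (evolve I I q α μ).map (shift 1) := by
  ext B hB
  have hB' := continuous_newConfig.measurable hB
  have hm : Measurable fun g : Config I => (jointLaw hK g : Measure (Path I)) (newConfig ⁻¹' B) :=
    (Measure.measurable_coe hB').comp (measurable_jointLaw hK)
  rw [Measure.map_apply (measurable_shift 1) hB, evolve_apply hK _ hB,
    evolve_apply hK _ (measurable_shift 1 hB),
    lintegral_map hm (measurable_shift 1)]
  refine lintegral_congr fun g => ?_
  rw [jointLaw_shift, Measure.map_apply continuous_pathShift.measurable hB']
  rfl

lemma map_shift_natCast (μ : Measure (Config I)) (t : ℕ) :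
    μ.map (shift (t : ℤ)) = (fun ν : Measure (Config I) => ν.map (shift 1))^[t] μ := by
  induction t with
  | zero =>
    have : shift (I := I) ((0 : ℕ) : ℤ) = id := by
      funext g i; simp [shift]
    rw [this, Measure.map_id]; rfl
  | succ t ih =>
    rw [Function.iterate_succ_apply', ← ih, Measure.map_map (measurable_shift 1) (measurable_shift t)]
    congr 1
    funext g i
    simp only [shift, Function.comp_apply]
    congr 1
    push_cast
    ring

/-- The probability measures that are invariant under one step of the shifted model. -/
def stepInvariant (I : ℕ) (q α : ℝ) : Set (FiniteMeasure (Config I)) :=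
  {μ | IsProbabilityMeasure (μ : Measure (Config I)) ∧
    (evolve I I q α (μ : Measure (Config I))).map (shift 1) = (μ : Measure (Config I))}

/-- The evolution commutes with the shift, so shifting by `t` after `t` steps is the `t`-th iterate
of one shifted step. -/
lemma stepInvariant_subset {q α : ℝ} (hK : IsVertexKernel (L I I q α) ε) :
    stepInvariant I q α ⊆ shiftedStationary I I q α := by
  rintro μ ⟨h1, h2⟩
  refine ⟨h1, fun t => ?_⟩
  rw [map_shift_natCast]
  have hc : Function.Commute (fun ν : Measure (Config I) => ν.map (shift 1)) (evolve I I q α) :=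
    fun ν => (evolve_map_shift hK ν).symm
  have := congrFun (hc.comp_iterate t) (μ : Measure (Config I))
  rw [Function.comp_apply] at this
  rw [← this]
  exact Function.iterate_fixed h2 t

lemma convex_stepInvariant {q α : ℝ} (hK : IsVertexKernel (L I I q α) ε) :
    Convex ℝ≥0 (stepInvariant I q α) := by
  rintro μ ⟨h1, h2⟩ ν ⟨h3, h4⟩ a b - - hab
  refine ⟨⟨?_⟩, ?_⟩
  · rw [FiniteMeasure.toMeasure_add, FiniteMeasure.toMeasure_smul, FiniteMeasure.toMeasure_smul,
      Measure.add_apply, Measure.smul_apply, Measure.smul_apply, measure_univ, measure_univ,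
      ← add_smul, hab, one_smul]
  · rw [FiniteMeasure.toMeasure_add, FiniteMeasure.toMeasure_smul, FiniteMeasure.toMeasure_smul]
    conv_rhs => rw [← h2, ← h4]
    ext B hB
    rw [Measure.add_apply, Measure.smul_apply, Measure.smul_apply]
    simp only [Measure.map_apply (measurable_shift 1) hB, evolve_apply hK _ (measurable_shift 1 hB),
      lintegral_add_measure, lintegral_smul_measure]

lemma integral_map_shift_evolve {q α : ℝ} (hK : IsVertexKernel (L I I q α) ε)
    (μ : Measure (Config I)) [IsProbabilityMeasure μ] (f : Config I →ᵇ ℝ) :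
    ∫ g, f g ∂(evolve I I q α μ).map (shift 1) =
      ∫ g, ∫ s, f (shift 1 (newConfig s)) ∂(jointLaw hK g : Measure (Path I)) ∂μ := by
  have hc : Continuous fun s : Path I => f (shift 1 (newConfig s)) :=
    f.continuous.comp ((continuous_shift 1).comp continuous_newConfig)
  set κ : Kernel (Config I) (Path I) := ⟨fun g => jointLaw hK g, measurable_jointLaw hK⟩ with hκ
  have : IsMarkovKernel κ := ⟨fun g => by rw [hκ]; exact inferInstanceAs
    (IsProbabilityMeasure (jointLaw hK g : Measure (Path I)))⟩
  have hbind : jointMeasure hK μ = (κ ∘ₖ Kernel.const Unit μ) () := by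
    rw [Kernel.comp_apply, Kernel.const_apply]; rfl
  rw [evolve_eq_map hK, Measure.map_map (measurable_shift 1) continuous_newConfig.measurable,
    integral_map ((measurable_shift 1).comp continuous_newConfig.measurable).aemeasurable
      f.continuous.measurable.aestronglyMeasurable, hbind]
  exact Kernel.integral_comp (integrable_of_continuous hc)

lemma isProbabilityMeasure_evolve {q α : ℝ} (hK : IsVertexKernel (L I I q α) ε)
    (μ : Measure (Config I)) [IsProbabilityMeasure μ] :
    IsProbabilityMeasure (evolve I I q α μ) :=
  ⟨by simp [evolve_apply hK μ .univ]⟩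

/-- Invariance amounts to equalities of integrals against `μ`, with `f` on one side and its image
under the step on the other. The latter is continuous by the Feller property, so both sides are
weakly continuous in `μ`. -/
lemma isClosed_stepInvariant {q α : ℝ} (hK : IsVertexKernel (L I I q α) ε) :
    IsClosed (stepInvariant I q α) := by
  have e : stepInvariant I q α = {μ : FiniteMeasure (Config I) | μ.mass = 1} ∩
      ⋂ f : Config I →ᵇ ℝ, {μ : FiniteMeasure (Config I) |
        ∫ g, ∫ s, f (shift 1 (newConfig s)) ∂(jointLaw hK g : Measure (Path I))
          ∂(μ : Measure (Config I)) = ∫ g, f g ∂(μ : Measure (Config I))} := by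
    ext μ
    have hm : μ.mass = 1 ↔ IsProbabilityMeasure (μ : Measure (Config I)) := by
      rw [isProbabilityMeasure_iff, ← FiniteMeasure.ennreal_mass, ENNReal.coe_eq_one]
    simp only [stepInvariant, Set.mem_inter_iff, Set.mem_ofPred_eq, Set.mem_iInter, hm]
    refine and_congr_right fun hμ => ?_
    constructor
    · intro h f
      rw [← integral_map_shift_evolve hK, h]
    · intro h
      have := isProbabilityMeasure_evolve hK (μ : Measure (Config I))
      have := Measure.isProbabilityMeasure_map (μ := evolve I I q α (μ : Measure (Config I)))
        (measurable_shift (I := I) 1).aemeasurable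
      refine ext_of_forall_integral_eq_of_IsFiniteMeasure fun f => ?_
      rw [integral_map_shift_evolve hK, h f]
  rw [e]
  refine (isClosed_eq FiniteMeasure.continuous_mass continuous_const).inter
    (isClosed_iInter fun f => isClosed_eq ?_
      (FiniteMeasure.continuous_integral_boundedContinuousFunction f))
  have hc : Continuous fun s : Path I => f (shift 1 (newConfig s)) :=
    f.continuous.comp ((continuous_shift 1).comp continuous_newConfig)
  exact FiniteMeasure.continuous_integral_boundedContinuousFunction
    (BoundedContinuousFunction.mkOfCompact
      ⟨_, continuous_integral_jointLaw hK ⟨fun s => f (shift 1 (newConfig s)), hc⟩⟩)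

lemma closure_convexHull_subset {q α : ℝ} (hK : IsVertexKernel (L I I q α) ε)
    {S : Set (FiniteMeasure (Config I))} (hS : S ⊆ stepInvariant I q α) :
    closure (convexHull ℝ≥0 S) ⊆ shiftedStationary I I q α :=
  (closure_minimal (convexHull_min hS (convex_stepInvariant hK)) (isClosed_stepInvariant hK)).trans
    (stepInvariant_subset hK)

lemma prodMeasure_map_shift (π : ℤ → PMF (Fin (I + 1))) (n : ℤ) :
    (prodMeasure π).map (shift n) = prodMeasure fun x => π (x + n) := by
  refine Measure.eq_infinitePi _ fun s t ht => ?_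
  rw [Measure.map_apply (measurable_shift n) (.pi s.countable_toSet fun _ _ => ht _)]
  have e : shift n ⁻¹' Set.pi (s : Set ℤ) t =
      Set.pi (s.map (addRightEmbedding n) : Finset ℤ) fun y => t (y - n) := by
    ext g
    simp only [shift, Set.mem_preimage, Set.mem_pi, Finset.coe_map, Set.forall_mem_image,
      Finset.mem_coe, addRightEmbedding_apply, add_sub_cancel_right]
  rw [e, Measure.infinitePi_pi _ fun _ _ => ht _, Finset.prod_map]
  simp

/-- The case `ρ = 1`: by conservation, `2I` incoming lines can only leave as `I` and `I`. -/
lemma mapsProduct_full (hK : IsVertexKernel K ε) :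
    MapsProduct K (PMF.pure (Fin.last I)) (PMF.pure (Fin.last I)) (PMF.pure (Fin.last I))
      (PMF.pure (Fin.last I)) := by
  have h0 : ∀ i' j', ¬ (i' = Fin.last I ∧ j' = Fin.last I) →
      K (Fin.last I) (Fin.last I) i' j' = 0 := by
    intro i' j' h
    by_contra hne
    have := hK.conservation hne
    simp only [Fin.val_last] at this
    exact h ⟨Fin.ext (by simp only [Fin.val_last]; omega), Fin.ext (by simp only [Fin.val_last]; omega)⟩
  have h1 : K (Fin.last I) (Fin.last I) (Fin.last I) (Fin.last I) = 1 := by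
    rw [← hK.sum_eq_one (Fin.last I) (Fin.last I), Finset.sum_eq_single (Fin.last I),
      Finset.sum_eq_single (Fin.last I)]
    · exact fun j _ hj => h0 _ _ fun h => hj h.2
    · simp
    · exact fun i _ hi => Finset.sum_eq_zero fun j _ => h0 _ _ fun h => hi h.1
    · simp
  intro i' j'
  rw [Finset.sum_eq_single (Fin.last I) (fun i _ hi => by simp [PMF.pure_apply, hi]) (by simp),
    Finset.sum_eq_single (Fin.last I) (fun i _ hi => by simp [PMF.pure_apply, hi]) (by simp)]
  by_cases h : i' = Fin.last I ∧ j' = Fin.last I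
  · rw [h.1, h.2, h1]; simp [PMF.pure_apply]
  · rw [h0 _ _ h]
    rw [not_and_or] at h
    rcases h with h | h <;> simp [PMF.pure_apply, h]

lemma map_shift_evolve_prodMeasure {q α : ℝ} (hK : IsVertexKernel (L I I q α) ε)
    {π ρ π' : ℤ → PMF (Fin (I + 1))} (h : Propagates (L I I q α) π ρ π')
    (hπ : ∀ x, π' (x + 1) = π x) :
    (evolve I I q α (prodMeasure π)).map (shift 1) = prodMeasure π := by
  rw [evolve_eq_map hK, map_newConfig_jointMeasure hK h, prodMeasure_map_shift]
  simp only [hπ]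

lemma muRho_mem_stepInvariant {q α : ℝ} (h : Admissible I I q α) (ρ : Set.Icc (0 : ℝ) 1) :
    muRho I h.pos h.ne_one ρ ∈ stepInvariant I q α := by
  obtain ⟨ε, hK⟩ := isVertexKernel_L h
  refine ⟨inferInstanceAs (IsProbabilityMeasure (prodMeasure _)), ?_⟩
  change (evolve I I q α (prodMeasure fun _ => densityLaw I h.pos h.ne_one ρ)).map (shift 1) =
    prodMeasure fun _ => densityLaw I h.pos h.ne_one ρ
  rw [densityLaw]
  split_ifs with h1
  · exact map_shift_evolve_prodMeasure hK (ρ := fun _ => PMF.pure (Fin.last I))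
      (fun _ => mapsProduct_full hK) fun _ => rfl
  · have hs : -q ^ I * (ρ : ℝ) / (1 - ρ) * (-α * q ^ I) ≤ 0 := by
      refine mul_nonpos_of_nonpos_of_nonneg (div_nonpos_of_nonpos_of_nonneg
        (mul_nonpos_of_nonpos_of_nonneg (neg_nonpos.2 (pow_pos h.pos I).le) ρ.2.1)
        (sub_nonneg.2 ρ.2.2)) (mul_nonneg (neg_nonneg.2 h.neg.le) (pow_pos h.pos I).le)
    exact map_shift_evolve_prodMeasure hK (ρ := fun _ => qNB I h.pos h.ne_one _ hs)
      (fun _ => mapsProduct_invariant h _ hs) fun _ => rfl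

/-! ### Perturbations of a background configuration -/

/-- The total excess of `g` over the background `b` is `c`; in particular it is finite. -/
def excessClass (b : Config I) (c : ℤ) : Set (Config I) :=
  {g | {x | g x ≠ b x}.Finite ∧ ∑ᶠ x, ((g x : ℤ) - (b x : ℤ)) = c}

/-- Makes the excess classes countable, hence measurable. The subtraction in `Fin (I + 1)` wraps
around and is used only as a bijective encoding. -/
lemma countable_finite_ne (b : Config I) : {g : Config I | {x | g x ≠ b x}.Finite}.Countable := by
  refine (Set.countable_range fun f : ℤ →₀ Fin (I + 1) => fun x => f x + b x).mono ?_
  intro g hg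
  refine ⟨Finsupp.ofSupportFinite (fun x => g x - b x) (hg.subset fun x hx => ?_), ?_⟩
  · exact fun h => hx (sub_eq_zero.2 h)
  · funext x
    exact sub_add_cancel (g x) (b x)

lemma measurableSet_excessClass (b : Config I) (c : ℤ) : MeasurableSet (excessClass b c) :=
  ((countable_finite_ne b).mono fun _ hg => hg.1).measurableSet

/-- Borel–Cantelli, which needs the marginals only. It therefore also applies to the crossing lines,
for which only the marginals are known. -/
lemma ae_finite_ne {b : Config I} {π : ℤ → PMF (Fin (I + 1))}
    (hb : ∑' x, (π x).toMeasure {b x}ᶜ ≠ ∞) {Ω : Type*} [MeasurableSpace Ω] {ν : Measure Ω}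
    {X : ℤ → Ω → Fin (I + 1)} (hX : ∀ x, ν {ω | X x ω ∈ ({b x}ᶜ : Set (Fin (I + 1)))} =
      (π x).toMeasure {b x}ᶜ) :
    ∀ᵐ ω ∂ν, {x | X x ω ≠ b x}.Finite := by
  refine ae_finite_setOfPred_mem (s := fun x => {ω | X x ω ∈ ({b x}ᶜ : Set (Fin (I + 1)))}) ?_
  simpa only [hX] using hb

lemma ae_prodMeasure_finite_ne {b : Config I} {π : ℤ → PMF (Fin (I + 1))}
    (hb : ∑' x, (π x).toMeasure {b x}ᶜ ≠ ∞) :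
    ∀ᵐ g ∂(prodMeasure π), {x | g x ≠ b x}.Finite := by
  refine ae_finite_ne hb (X := fun x (g : Config I) => g x) fun x => ?_
  exact (measurePreserving_eval_infinitePi (fun x => (π x).toMeasure) x).measure_preimage
    (MeasurableSet.of_discrete (s := ({b x}ᶜ : Set (Fin (I + 1))))).nullMeasurableSet

/-- Conservation of lines makes the excess invariant. -/
lemma finsum_excess_eq {b g g' h : Config I} (hg : {x | g x ≠ b x}.Finite)
    (hg' : {x | g' x ≠ b x}.Finite) (hh : {x | h x ≠ b x}.Finite)
    (hc : ∀ x, (g x : ℕ) + h (x - 1) = g' (x - 1) + h x) :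
    ∑ᶠ x, ((g x : ℤ) - (b x : ℤ)) = ∑ᶠ x, ((g' x : ℤ) - (b x : ℤ)) := by
  have hfin : ∀ {f : Config I}, {x | f x ≠ b x}.Finite →
      (Function.support fun x => ((f x : ℤ) - (b x : ℤ))).Finite := fun hf =>
    hf.subset fun x hx hx' => hx (by simp only [hx', sub_self])
  have htrans : ∀ f : Config I, ∑ᶠ x : ℤ, ((f (x - 1) : ℤ) - (b (x - 1) : ℤ)) =
      ∑ᶠ x, ((f x : ℤ) - (b x : ℤ)) := fun f =>
    finsum_comp_equiv (Equiv.subRight (1 : ℤ)) (f := fun x => ((f x : ℤ) - (b x : ℤ)))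
  have hfin' : ∀ {f : Config I}, {x | f x ≠ b x}.Finite →
      (Function.support fun x : ℤ => ((f (x - 1) : ℤ) - (b (x - 1) : ℤ))).Finite := fun hf =>
    (hfin hf).preimage (f := fun x : ℤ => x - 1) (sub_left_injective.injOn)
  have h1 := finsum_add_distrib (hfin hg) (hfin' hh)
  have h2 := finsum_add_distrib (hfin' hg') (hfin hh)
  -- After translation, the excess of the crossing lines `h` stands on both sides of the summed
  -- conservation law and cancels, being finite.
  rw [htrans] at h1 h2
  have h3 : (fun x : ℤ => ((g x : ℤ) - (b x : ℤ)) + ((h (x - 1) : ℤ) - (b (x - 1) : ℤ))) =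
      fun x => ((g' (x - 1) : ℤ) - (b (x - 1) : ℤ)) + ((h x : ℤ) - (b x : ℤ)) := by
    funext x
    have := hc x
    omega
  rw [h3] at h1
  linarith

/-- Almost surely, the shifted step preserves the excess over the background. -/
lemma ae_ae_mem_excessClass_iff (hK : IsVertexKernel K ε) {b : Config I}
    {π : ℤ → PMF (Fin (I + 1))} (hb : ∑' x, (π x).toMeasure {b x}ᶜ ≠ ∞)
    (h : Propagates K π (fun x => π (x - 1)) fun x => π (x - 1)) (c : ℤ) :
    ∀ᵐ g ∂(prodMeasure π), ∀ᵐ s ∂(jointLaw hK g : Measure (Path I)),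
      (shift 1 (newConfig s) ∈ excessClass b c ↔ g ∈ excessClass b c) := by
  -- The lines leaving `x` have the law `π x`, so they are as close to the background as the
  -- configuration itself.
  have h1 : ∀ᵐ s ∂(jointMeasure hK (prodMeasure π)), {x | (s x).2 ≠ b x}.Finite :=
    ae_finite_ne hb (X := fun x (s : Path I) => (s x).2) fun x => by
      rw [jointMeasure_horizontal hK h, add_sub_cancel_right]
  have h2 : ∀ᵐ s ∂(jointMeasure hK (prodMeasure π)),
      {x | shift 1 (newConfig s) x ≠ b x}.Finite := by
    have hm : Measurable fun s : Path I => shift 1 (newConfig s) :=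
      (measurable_shift 1).comp continuous_newConfig.measurable
    have hmap : (jointMeasure hK (prodMeasure π)).map (fun s => shift 1 (newConfig s)) =
        prodMeasure π := by
      have := Measure.map_map (μ := jointMeasure hK (prodMeasure π)) (measurable_shift (I := I) 1)
        continuous_newConfig.measurable
      rw [map_newConfig_jointMeasure hK h, prodMeasure_map_shift] at this
      simp only [add_sub_cancel_right] at this
      exact this.symm
    have := ae_prodMeasure_finite_ne hb
    rw [← hmap] at this
    exact ae_of_ae_map hm.aemeasurable this
  filter_upwards [ae_prodMeasure_finite_ne hb,
    Measure.ae_ae_of_ae_bind (measurable_jointLaw hK).aemeasurable (h1.and h2)] with g hg hs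
  filter_upwards [hs, ae_jointLaw_conservation hK g] with s hs hcons
  have e := finsum_excess_eq hg hs.2 hs.1 fun x => by
    have := hcons x
    simpa [shift, newConfig] using this
  simp only [excessClass, Set.mem_ofPred_eq, e, hg, hs.2, true_and]

/-- An invariant measure restricted to a class that the dynamics almost surely neither enters nor
leaves is again invariant, and the normalization is a common factor. -/
lemma map_shift_evolve_cond {q α : ℝ} (hK : IsVertexKernel (L I I q α) ε) {b : Config I}
    {π : ℤ → PMF (Fin (I + 1))} (hb : ∑' x, (π x).toMeasure {b x}ᶜ ≠ ∞)
    (h : Propagates (L I I q α) π (fun x => π (x - 1)) fun x => π (x - 1)) (c : ℤ) :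
    (evolve I I q α ((prodMeasure π)[|excessClass b c])).map (shift 1) =
      (prodMeasure π)[|excessClass b c] := by
  have hG := measurableSet_excessClass b c
  have hinv := map_shift_evolve_prodMeasure hK h fun x => by rw [add_sub_cancel_right]
  ext B hB
  rw [cond_apply hG, Measure.map_apply (measurable_shift 1) hB,
    evolve_apply hK _ (measurable_shift 1 hB), ProbabilityTheory.cond, lintegral_smul_measure,
    smul_eq_mul]
  congr 1
  conv_rhs => rw [← hinv]
  rw [Measure.map_apply (measurable_shift 1) (hG.inter hB),
    evolve_apply hK _ (measurable_shift 1 (hG.inter hB)), ← lintegral_indicator hG]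
  refine lintegral_congr_ae ?_
  filter_upwards [ae_ae_mem_excessClass_iff hK hb h c] with g hg
  by_cases hgG : g ∈ excessClass b c
  · rw [Set.indicator_of_mem hgG]
    refine measure_congr ?_
    filter_upwards [hg] with s hs
    have := hs.2 hgG
    exact propext ⟨fun hsB => ⟨this, hsB⟩, fun hsB => hsB.2⟩
  · rw [Set.indicator_of_notMem hgG]
    symm
    rw [measure_eq_zero_iff_ae_notMem]
    filter_upwards [hg] with s hs hsB
    exact hgG (hs.1 hsB.1)

/-- The bound `∏ (1 - e i) ≥ 1 - ∑ e i`, kept additive to avoid truncated subtraction in `ℝ≥0∞`. -/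
lemma one_le_prod_add_sum {ι : Type*} [DecidableEq ι] (T : Finset ι) {a e : ι → ℝ≥0∞}
    (h : ∀ i, a i + e i = 1) : 1 ≤ ∏ i ∈ T, a i + ∑ i ∈ T, e i := by
  induction T using Finset.induction_on with
  | empty => simp
  | insert i T hi ih =>
    rw [Finset.prod_insert hi, Finset.sum_insert hi]
    have hle : ∏ j ∈ T, a j ≤ 1 := Finset.prod_le_one' fun j _ => by
      rw [← h j]; exact le_self_add
    calc 1 ≤ (a i + e i) * ∏ j ∈ T, a j + ∑ j ∈ T, e j := by rw [h i, one_mul]; exact ih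
      _ = a i * ∏ j ∈ T, a j + (e i * ∏ j ∈ T, a j + ∑ j ∈ T, e j) := by rw [add_mul, add_assoc]
      _ ≤ a i * ∏ j ∈ T, a j + (e i + ∑ j ∈ T, e j) := by
        gcongr
        exact mul_le_of_le_one_right' hle

/-- Outside a finite set `S`, the configuration is the background and the deviation probabilities
sum to at most `1/2`. The remaining product is therefore at least `1/2`, uniformly over finite sets,
and the finitely many factors in `S` are positive. -/
lemma prodMeasure_singleton_pos {b : Config I} {π : ℤ → PMF (Fin (I + 1))}
    (hb : ∑' x, (π x).toMeasure {b x}ᶜ ≠ ∞) (hπ : ∀ x i, π x i ≠ 0) {g : Config I}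
    (hg : {x | g x ≠ b x}.Finite) : 0 < prodMeasure π {g} := by
  classical
  obtain ⟨S₀, hS₀⟩ := ((ENNReal.tendsto_tsum_compl_atTop_zero hb).eventually
    (eventually_le_nhds (b := (2 : ℝ≥0∞)⁻¹) (by simp))).exists
  set S := S₀ ∪ hg.toFinset with hS
  set a : ℤ → ℝ≥0∞ := fun x => (π x).toMeasure {g x} with ha
  have ha0 : ∀ x, a x ≠ 0 := fun x => by
    rw [ha]; simp only; rw [PMF.toMeasure_apply_singleton _ _ (measurableSet_singleton _)]
    exact hπ _ _
  have hle : ∀ T : Finset ℤ, (∏ x ∈ S, a x) * 2⁻¹ ≤ ∏ x ∈ S ∪ T, a x := by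
    intro T
    rw [← Finset.union_sdiff_self_eq_union, Finset.prod_union Finset.disjoint_sdiff]
    gcongr
    have h1 := one_le_prod_add_sum (T \ S) (a := fun x => (π x).toMeasure {b x})
      (e := fun x => (π x).toMeasure {b x}ᶜ)
      fun x => by rw [prob_add_prob_compl (measurableSet_singleton _)]
    have h2 : ∑ x ∈ T \ S, (π x).toMeasure {b x}ᶜ ≤ 2⁻¹ := by
      refine le_trans ?_ hS₀
      rw [← Finset.sum_subtype_of_mem (p := fun x => x ∉ S₀)
        (fun x => (π x).toMeasure ({b x}ᶜ : Set (Fin (I + 1))))]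
      · exact ENNReal.sum_le_tsum _
      · intro x hx hx'
        exact (Finset.mem_sdiff.1 hx).2 (Finset.mem_union_left _ hx')
    have h3 : ∏ x ∈ T \ S, a x = ∏ x ∈ T \ S, (π x).toMeasure {b x} := by
      refine Finset.prod_congr rfl fun x hx => ?_
      have : g x = b x := by
        by_contra hne
        exact (Finset.mem_sdiff.1 hx).2 (Finset.mem_union_right _ (hg.mem_toFinset.2 hne))
      rw [ha]; simp only [this]
    rw [h3]
    have h4 : (2⁻¹ : ℝ≥0∞) + 2⁻¹ ≤ (∏ x ∈ T \ S, (π x).toMeasure {b x}) + 2⁻¹ := by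
      rw [ENNReal.inv_two_add_inv_two]
      exact h1.trans (by gcongr)
    exact (ENNReal.add_le_add_iff_right (by simp)).1 h4
  have hpos : 0 < (∏ x ∈ S, a x) * 2⁻¹ :=
    ENNReal.mul_pos (Finset.prod_ne_zero_iff.2 fun x _ => ha0 x) (by simp)
  set A : ℕ → Set (Config I) := fun N =>
    Set.pi ((S ∪ Finset.Icc (-(N : ℤ)) N : Finset ℤ) : Set ℤ) fun x => {g x} with hA
  have hAm : ∀ N, MeasurableSet (A N) := fun N =>
    .pi (Finset.countable_toSet _) fun _ _ => measurableSet_singleton _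
  have hanti : Antitone A := fun M N hMN f hf x hx => hf x (by
    simp only [Finset.coe_union, Set.mem_union, Finset.mem_coe, Finset.mem_Icc] at hx ⊢
    exact hx.imp_right fun h => by omega)
  have hinter : ⋂ N, A N = {g} := by
    ext f
    simp only [Set.mem_iInter, Set.mem_singleton_iff]
    constructor
    · intro hf
      funext x
      exact hf x.natAbs x (by
        simp only [Finset.coe_union, Set.mem_union, Finset.mem_coe, Finset.mem_Icc]
        omega)
    · rintro rfl N x _
      rfl
  have hlim := tendsto_measure_iInter_atTop (μ := prodMeasure π)
    (fun N => (hAm N).nullMeasurableSet) hanti ⟨0, measure_ne_top _ _⟩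
  rw [hinter] at hlim
  refine hpos.trans_le (ge_of_tendsto' hlim fun N => ?_)
  rw [Function.comp_apply, hA, Measure.infinitePi_pi _ fun _ _ => measurableSet_singleton _]
  exact hle _

/-! ### The blocking measures -/

open Classical in
/-- The configuration with one half-line full and the other one empty. -/
def background (I : ℕ) (q : ℝ) : Config I :=
  fun x => if 1 < q ↔ x ≤ 0 then Fin.last I else 0

/-- A summable family of integers has only finitely many nonzero terms, so the two half-line series
express the same condition as a finite total excess. -/
lemma mem_excessClass_iff {b g : Config I} {c : ℤ} :
    g ∈ excessClass b c ↔
      Summable (fun k : ℕ => ((g (-(k : ℤ)) : ℕ) : ℝ) - ((b (-(k : ℤ)) : ℕ) : ℝ)) ∧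
      Summable (fun k : ℕ => ((g ((k : ℤ) + 1) : ℕ) : ℝ) - ((b ((k : ℤ) + 1) : ℕ) : ℝ)) ∧
      ∑' k : ℕ, (((g (-(k : ℤ)) : ℕ) : ℝ) - ((b (-(k : ℤ)) : ℕ) : ℝ)) +
        ∑' k : ℕ, (((g ((k : ℤ) + 1) : ℕ) : ℝ) - ((b ((k : ℤ) + 1) : ℕ) : ℝ)) = c := by
  set F : ℤ → ℝ := fun x => ((g x : ℕ) : ℝ) - ((b x : ℕ) : ℝ) with hF
  have hsupp : Function.support F = {x | g x ≠ b x} := by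
    ext x
    simp [hF, sub_eq_zero, Fin.val_inj]
  have hneg : ∀ k : ℕ, F (-(-((k : ℤ) + 1))) = F ((k : ℤ) + 1) := fun k => by rw [neg_neg]
  have hsum : Summable (fun k : ℕ => F (-(k : ℤ))) → Summable (fun k : ℕ => F ((k : ℤ) + 1)) →
      Summable F ∧ ∑' x, F x = ∑' k : ℕ, F (-(k : ℤ)) + ∑' k : ℕ, F ((k : ℤ) + 1) := by
    intro h1 h2
    have h2' : Summable fun k : ℕ => (fun x => F (-x)) (-((k : ℤ) + 1)) := by
      simpa only [hneg] using h2
    refine ⟨(Equiv.neg ℤ).summable_iff.1 (Summable.of_nat_of_neg_add_one (f := fun x => F (-x)) h1 h2'), ?_⟩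
    rw [← (Equiv.neg ℤ).tsum_eq F]
    refine (tsum_of_nat_of_neg_add_one (f := fun x => F (-x)) h1 h2').trans ?_
    simp only [hneg]
  have hfin : {x | g x ≠ b x}.Finite →
      ((∑ᶠ x, ((g x : ℤ) - (b x : ℤ)) : ℤ) : ℝ) = ∑' x, F x := by
    intro hf
    rw [tsum_eq_sum (s := hf.toFinset) fun x hx => Function.notMem_support.1 fun h =>
      hx (hf.mem_toFinset.2 (hsupp ▸ h)), finsum_eq_sum_of_support_subset (s := hf.toFinset)]
    · push_cast
      rfl
    · intro x hx
      rw [Set.Finite.coe_toFinset]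
      exact fun h => hx (by simp only [h, sub_self])
  constructor
  · rintro ⟨hf, hc⟩
    have hs : Summable F := summable_of_hasFiniteSupport (by
      rw [Function.HasFiniteSupport, hsupp]; exact hf)
    have h1 : Summable fun k : ℕ => F (-(k : ℤ)) :=
      hs.comp_injective (i := fun k : ℕ => -(k : ℤ)) fun a b h => by simpa using h
    have h2 : Summable fun k : ℕ => F ((k : ℤ) + 1) :=
      hs.comp_injective (i := fun k : ℕ => (k : ℤ) + 1) fun a b h => by simpa using h
    refine ⟨h1, h2, ?_⟩
    rw [← hc, hfin hf]
    exact (hsum h1 h2).2.symm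
  · rintro ⟨h1, h2, hc⟩
    obtain ⟨hs, e⟩ := hsum h1 h2
    have hf : {x | g x ≠ b x}.Finite := by
      have := hs.tendsto_cofinite_zero.eventually (Metric.ball_mem_nhds 0 one_pos)
      refine Set.Finite.subset this fun x hx hx' => hx ?_
      have h3 : |((g x : ℕ) : ℝ) - ((b x : ℕ) : ℝ)| < 1 := by simpa [hF] using hx'
      have h4 : |((g x : ℕ) : ℤ) - ((b x : ℕ) : ℤ)| < 1 := by exact_mod_cast h3
      rw [Int.abs_lt_one_iff] at h4
      exact Fin.ext (by omega)
    refine ⟨hf, ?_⟩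
    have h5 := hfin hf
    rw [e] at h5
    exact_mod_cast h5.trans hc

open Classical in
-- For `q < 1` the class counts holes on the right against particles on the left, which reverses the
-- sign of the excess.
lemma blockingClass_eq (I : ℕ) (q : ℝ) (n : ℤ) :
    blockingClass I q n = excessClass (background I q) (if 1 < q then n else -n) := by
  ext g
  rw [mem_excessClass_iff, blockingClass]
  have hb1 : ∀ k : ℕ, background I q (-(k : ℤ)) = if 1 < q then Fin.last I else 0 := fun k => by
    simp [background]
  have hb2 : ∀ k : ℕ, background I q ((k : ℤ) + 1) = if 1 < q then 0 else Fin.last I := fun k => by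
    have : ¬ (k : ℤ) + 1 ≤ 0 := by omega
    by_cases hq : 1 < q <;> simp [background, this, hq]
  simp only [hb1, hb2]
  split_ifs with hq
  · simp only [Set.mem_ofPred_eq, Fin.val_last, Fin.val_zero, Nat.cast_zero, sub_zero]
    have e : (fun k : ℕ => ((g (-(k : ℤ)) : ℕ) : ℝ) - (I : ℝ)) =
        fun k : ℕ => -((I : ℝ) - ((g (-(k : ℤ)) : ℕ) : ℝ)) := by funext k; ring
    rw [e, summable_neg_iff, tsum_neg]
    refine and_congr_right fun _ => and_congr_right fun _ => ?_
    constructor <;> intro h <;> linarith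
  · simp only [Set.mem_ofPred_eq, Fin.val_last, Fin.val_zero, Nat.cast_zero, sub_zero]
    have e : (fun k : ℕ => ((g ((k : ℤ) + 1) : ℕ) : ℝ) - (I : ℝ)) =
        fun k : ℕ => -((I : ℝ) - ((g ((k : ℤ) + 1) : ℕ) : ℝ)) := by funext k; ring
    rw [e, summable_neg_iff, tsum_neg]
    refine and_congr_right fun _ => and_congr_right fun _ => ?_
    push_cast
    constructor <;> intro h <;> linarith

lemma exists_mem_excessClass_of_finset (b : Config I) (T : Finset ℤ) (v : Fin (I + 1)) (δ : ℤ)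
    (hT : ∀ x ∈ T, ((v : ℕ) : ℤ) - (b x : ℤ) = δ) : (excessClass b (T.card * δ)).Nonempty := by
  classical
  refine ⟨fun x => if x ∈ T then v else b x, T.finite_toSet.subset fun x hx => ?_, ?_⟩
  · by_contra hxT
    exact hx (if_neg hxT)
  · rw [finsum_eq_sum_of_support_subset (s := T)]
    · rw [Finset.sum_congr rfl (g := fun _ => δ) fun x hx => by simp only [if_pos hx, hT x hx],
        Finset.sum_const, nsmul_eq_mul]
    · intro x hx
      by_contra hxT
      exact hx (by simp only [if_neg (mt Finset.mem_coe.2 hxT), sub_self])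

/-- One particle is added at each of `|c|` empty sites, or removed at each of `|c|` full ones. -/
lemma excessClass_background_nonempty (hI : 1 ≤ I) (q : ℝ) (c : ℤ) :
    (excessClass (background I q) c).Nonempty := by
  set one : Fin (I + 1) := ⟨1, by omega⟩
  set pre : Fin (I + 1) := ⟨I - 1, by omega⟩
  have hR : ∀ m : ℕ, ∀ x ∈ Finset.Ioc (0 : ℤ) m, ¬ x ≤ 0 := fun m x hx => by
    rw [Finset.mem_Ioc] at hx; omega
  have hL : ∀ m : ℕ, ∀ x ∈ Finset.Ioc (-(m : ℤ)) 0, x ≤ 0 := fun m x hx => by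
    rw [Finset.mem_Ioc] at hx; omega
  have hpre : ((pre : ℕ) : ℤ) - ((Fin.last I : ℕ) : ℤ) = -1 := by
    simp only [pre, Fin.val_last]; omega
  have hone : ((one : ℕ) : ℤ) - (((0 : Fin (I + 1)) : ℕ) : ℤ) = 1 := by
    simp [one]
  obtain ⟨m, rfl | rfl⟩ := Int.eq_nat_or_neg c
  · by_cases hq : 1 < q
    · have := exists_mem_excessClass_of_finset (background I q) (Finset.Ioc 0 (m : ℤ)) one 1
        fun x hx => by
          rw [background, if_neg (by simp [hq, hR m x hx]), hone]
      simpa using this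
    · have := exists_mem_excessClass_of_finset (background I q) (Finset.Ioc (-(m : ℤ)) 0) one 1
        fun x hx => by
          rw [background, if_neg (by simp [hq, hL m x hx]), hone]
      simpa using this
  · by_cases hq : 1 < q
    · have := exists_mem_excessClass_of_finset (background I q) (Finset.Ioc (-(m : ℤ)) 0) pre (-1)
        fun x hx => by
          rw [background, if_pos (by simp [hq, hL m x hx]), hpre]
      simpa using this
    · have := exists_mem_excessClass_of_finset (background I q) (Finset.Ioc 0 (m : ℤ)) pre (-1)
        fun x hx => by
          rw [background, if_pos (by simp [hq, hR m x hx]), hpre]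
      simpa using this

/-- The one-site marginal of `μ_*`. -/
def starLaw (I : ℕ) {q : ℝ} (hq : 0 < q) (hq1 : q ≠ 1) (x : ℤ) : PMF (Fin (I + 1)) :=
  qNB I hq hq1 (-q ^ (-x * I + 1)) (neg_nonpos.2 (zpow_pos hq _).le)

/-- The parameters of `μ_*` satisfy `p_x q ^ I = p_{x-1}`, which is the ratio required for the
exchange at every vertex. -/
lemma propagates_starLaw {q α : ℝ} (h : Admissible I I q α) :
    Propagates (L I I q α) (starLaw I h.pos h.ne_one)
      (fun x => starLaw I h.pos h.ne_one (x - 1)) fun x => starLaw I h.pos h.ne_one (x - 1) := by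
  intro x
  simp only [add_sub_cancel_right]
  refine mapsProduct_exchange h _ _ ?_
  rw [← zpow_natCast q I, neg_mul (q ^ _), ← zpow_add₀ h.pos.ne']
  congr 2
  ring

/-! ### Positivity and tails of the one-site laws of `μ_*` -/

lemma poch_rpow_neg_ne_zero {q : ℝ} (hq : 0 < q) (hq1 : q ≠ 1) {n : ℕ} (hn : n ≤ I) :
    poch q (q ^ (-(I : ℝ))) n ≠ 0 := by
  refine poch_ne_zero fun k hk h => hq1 ?_
  obtain ⟨d, rfl⟩ := Nat.exists_eq_add_of_lt (hk.trans_le hn)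
  have e : q ^ (-((k + d + 1 : ℕ) : ℝ)) * q ^ k = (q ^ (d + 1))⁻¹ := by
    rw [Real.rpow_neg hq.le, Real.rpow_natCast, add_assoc, pow_add, mul_inv, mul_right_comm,
      inv_mul_cancel₀ (pow_pos hq k).ne', one_mul]
  rw [e, inv_eq_one] at h
  exact (pow_eq_one_iff_of_nonneg hq.le (Nat.succ_ne_zero d)).1 h

lemma qNB_ne_zero {q : ℝ} (hq : 0 < q) (hq1 : q ≠ 1) {p : ℝ} (hp : p < 0) (n : Fin (I + 1)) :
    qNB I hq hq1 p hp.le n ≠ 0 := by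
  intro h
  have := toReal_qNB I hq hq1 hp.le n
  rw [h, ENNReal.toReal_zero, eq_comm, mul_eq_zero, nbTerm, mul_eq_zero, div_eq_zero_iff] at this
  rcases this with (h | h | h) | h
  · exact pow_ne_zero _ hp.ne h
  · exact poch_rpow_neg_ne_zero hq hq1 (Nat.lt_succ_iff.1 n.2) h
  · exact poch_self_ne_zero hq hq1 _ h
  · exact (inv_pos.2 (prod_pos' hq hp.le I)).ne' h

/-- The `q`-negative binomial distribution concentrates at `0` for small and at `I` for large
values of the parameter. -/
lemma exists_qNB_le {q : ℝ} (hq : 0 < q) (hq1 : q ≠ 1) :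
    ∃ C : ℝ, 0 ≤ C ∧ ∀ (p : ℝ) (hp : p < 0) (n : Fin (I + 1)),
      (n ≠ 0 → (qNB I hq hq1 p hp.le n).toReal ≤ C * |p|) ∧
      (n ≠ Fin.last I → (qNB I hq hq1 p hp.le n).toReal ≤ C * |p|⁻¹) := by
  set d : Fin (I + 1) → ℝ := fun n => |poch q (q ^ (-(I : ℝ))) n / poch q q n| with hd
  have hd0 : ∀ n, 0 < d n := fun n => abs_pos.2 (div_ne_zero
    (poch_rpow_neg_ne_zero hq hq1 (Nat.lt_succ_iff.1 n.2)) (poch_self_ne_zero hq hq1 _))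
  have hdz : d 0 = 1 := by simp [hd]
  set C₁ := ∑ n, d n with hC₁
  have hdC : ∀ n, d n ≤ C₁ := fun n =>
    Finset.single_le_sum (f := d) (fun n _ => (hd0 n).le) (Finset.mem_univ n)
  have hC₁1 : 1 ≤ C₁ := hdz ▸ hdC 0
  have hl := hd0 (Fin.last I)
  have hC₂1 : 1 ≤ C₁ / d (Fin.last I) := (one_le_div hl).2 (hdC _)
  refine ⟨C₁ + C₁ / d (Fin.last I), by positivity, fun p hp n => ?_⟩
  have hp0 : 0 < |p| := abs_pos.2 hp.ne
  set w : Fin (I + 1) → ℝ := fun n => (qNB I hq hq1 p hp.le n).toReal with hw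
  have hw0 : ∀ n, 0 ≤ w n := fun n => ENNReal.toReal_nonneg
  have hw1 : ∀ n, w n ≤ 1 := fun n => by
    rw [← sum_toReal_pmf (qNB I hq hq1 p hp.le)]
    exact Finset.single_le_sum (f := w) (fun n _ => hw0 n) (Finset.mem_univ n)
  -- Ratios of probabilities are free of the normalization. Comparison with the weight at `0`,
  -- respectively at `I`, then gives the two bounds.
  have hcross : ∀ m n : Fin (I + 1), w n * (|p| ^ (m : ℕ) * d m) = w m * (|p| ^ (n : ℕ) * d n) := by
    intro m n
    have e : ∀ n : Fin (I + 1), |p| ^ (n : ℕ) * d n = |nbTerm q I p n| := fun n => by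
      rw [nbTerm, abs_mul, abs_pow]
    have e' : ∀ n : Fin (I + 1), w n = |nbTerm q I p n| *
        |(∏ k ∈ Finset.range I, (1 - p * q ^ (-(I : ℤ)) * q ^ k))⁻¹| := fun n => by
      rw [← abs_mul, ← toReal_qNB I hq hq1 hp.le n, abs_of_nonneg (hw0 n)]
    rw [e, e, e', e']
    ring
  constructor
  · intro hn
    have hn1 : 1 ≤ (n : ℕ) := Nat.one_le_iff_ne_zero.2 fun h => hn (Fin.ext h)
    suffices w n ≤ C₁ * |p| from this.trans (by gcongr; linarith)
    rcases le_total |p| 1 with hp1 | hp1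
    · have h1 := hcross 0 n
      rw [Fin.val_zero, pow_zero, hdz, mul_one, mul_one] at h1
      calc w n = w 0 * (|p| ^ (n : ℕ) * d n) := h1
        _ ≤ 1 * (|p| * C₁) := by
          have hpow : |p| ^ (n : ℕ) ≤ |p| := pow_le_of_le_one hp0.le hp1 (by omega)
          gcongr
          · exact hw1 0
          · exact hdC n
        _ = C₁ * |p| := by ring
    · exact (hw1 n).trans (one_le_mul_of_one_le_of_one_le hC₁1 hp1)
  · intro hn
    have hn1 : (n : ℕ) + 1 ≤ I := Nat.lt_of_le_of_ne (Nat.lt_succ_iff.1 n.2) fun h => hn (Fin.ext h)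
    suffices w n ≤ C₁ / d (Fin.last I) * |p|⁻¹ from this.trans (by gcongr; linarith)
    rcases le_total |p| 1 with hp1 | hp1
    · exact (hw1 n).trans (one_le_mul_of_one_le_of_one_le hC₂1 ((one_le_inv₀ hp0).2 hp1))
    · have h1 := hcross (Fin.last I) n
      rw [div_mul_eq_mul_div, le_div_iff₀ hl, ← div_eq_mul_inv, le_div_iff₀ hp0]
      refine le_of_mul_le_mul_right ?_ (pow_pos hp0 (n : ℕ))
      calc w n * d (Fin.last I) * |p| * |p| ^ (n : ℕ)
          = w n * (|p| ^ ((n : ℕ) + 1) * d (Fin.last I)) := by ring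
        _ ≤ w n * (|p| ^ I * d (Fin.last I)) := by
          have := hw0 n
          gcongr
        _ = w (Fin.last I) * (|p| ^ (n : ℕ) * d n) := h1
        _ ≤ 1 * (|p| ^ (n : ℕ) * C₁) := by
          gcongr
          · exact hw1 _
          · exact hdC n
        _ = C₁ * |p| ^ (n : ℕ) := by ring

lemma toMeasure_compl_le (p : PMF (Fin (I + 1))) (a : Fin (I + 1)) {c : ℝ} (hc : 0 ≤ c)
    (h : ∀ n, n ≠ a → (p n).toReal ≤ c) :
    p.toMeasure {a}ᶜ ≤ ENNReal.ofReal ((I + 1) * c) := by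
  classical
  rw [← ENNReal.ofReal_toReal (measure_ne_top p.toMeasure {a}ᶜ), toReal_toMeasure]
  refine ENNReal.ofReal_le_ofReal ?_
  calc ∑ i, (p i).toReal * ({a}ᶜ : Set (Fin (I + 1))).indicator 1 i ≤ ∑ _i : Fin (I + 1), c := by
        refine Finset.sum_le_sum fun i _ => ?_
        by_cases hi : i = a
        · simp [hi, hc]
        · simpa [hi] using h i hi
    _ = (I + 1) * c := by simp

lemma summable_pow_natAbs {r : ℝ} (h0 : 0 ≤ r) (h1 : r < 1) :
    Summable fun x : ℤ => r ^ x.natAbs := by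
  have := summable_geometric_of_lt_one h0 h1
  refine Summable.of_nat_of_neg_add_one (by simpa using this) ?_
  have h2 := (summable_nat_add_iff 1).2 this
  refine h2.congr fun k => ?_
  congr 1

/-- The parameter of `μ_*` tends to `0` geometrically on the empty half-line and to `-∞`
geometrically on the full one, so deviations from the background are summable. -/
lemma tsum_starLaw_ne_top (hI : 1 ≤ I) {q : ℝ} (hq : 0 < q) (hq1 : q ≠ 1) :
    ∑' x, (starLaw I hq hq1 x).toMeasure {background I q x}ᶜ ≠ ∞ := by
  obtain ⟨C, hC, hCp⟩ := exists_qNB_le (I := I) hq hq1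
  obtain ⟨r, R, hr0, hr1, hR, hle⟩ : ∃ r R : ℝ, 0 ≤ r ∧ r < 1 ∧ 0 ≤ R ∧ ∀ x : ℤ,
      (background I q x = 0 → q ^ (-x * I + 1) ≤ R * r ^ x.natAbs) ∧
      (background I q x = Fin.last I → (q ^ (-x * I + 1))⁻¹ ≤ R * r ^ x.natAbs) := by
    have hl : Fin.last I ≠ 0 := fun h => by
      have := congrArg Fin.val h
      simp at this
      omega
    have hI' : (1 : ℤ) ≤ I := by exact_mod_cast hI
    have hsgn : ∀ x : ℤ, (x ≤ 0 → -x ≤ -x * I) ∧ (0 ≤ x → x ≤ x * I) := fun x =>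
      ⟨fun hx => by nlinarith, fun hx => by nlinarith⟩
    rcases lt_or_gt_of_ne hq1 with h | h
    -- The prefactor `q⁻¹` absorbs the `+ 1` in the exponent, which is harmful only on the full
    -- side, where the parameter is inverted.
    · refine ⟨q, q⁻¹, hq.le, h, (inv_pos.2 hq).le, fun x => ?_⟩
      have e : q⁻¹ * q ^ x.natAbs = q ^ ((x.natAbs : ℤ) - 1) := by
        rw [zpow_sub_one₀ hq.ne', zpow_natCast, mul_comm]
      rw [e, ← zpow_neg]
      constructor
      · intro hb
        have hx : x ≤ 0 := by
          by_contra hx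
          exact hl (by rw [← hb, background, if_pos (by simp [h.not_gt, hx])])
        have := (hsgn x).1 hx
        exact (zpow_le_zpow_iff_right_of_lt_one₀ hq h).2 (by omega)
      · intro hb
        have hx : 0 < x := by
          by_contra hx
          exact hl (by rw [← hb, background, if_neg (by simp [h.not_gt, not_lt.1 hx])])
        have := (hsgn x).2 hx.le
        exact (zpow_le_zpow_iff_right_of_lt_one₀ hq h).2 (by
          rw [neg_mul]; omega)
    · refine ⟨q⁻¹, q, (inv_pos.2 hq).le, inv_lt_one_of_one_lt₀ h, hq.le, fun x => ?_⟩
      have e : q * q⁻¹ ^ x.natAbs = q ^ (1 - (x.natAbs : ℤ)) := by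
        rw [zpow_sub₀ hq.ne', zpow_one, zpow_natCast, inv_pow, div_eq_mul_inv]
      rw [e, ← zpow_neg]
      constructor
      · intro hb
        have hx : 0 < x := by
          by_contra hx
          exact hl (by rw [← hb, background, if_pos (by simp [h, not_lt.1 hx])])
        have := (hsgn x).2 hx.le
        exact (zpow_le_zpow_iff_right₀ h).2 (by rw [neg_mul]; omega)
      · intro hb
        have hx : x ≤ 0 := by
          by_contra hx
          exact hl (by rw [← hb, background, if_neg (by simp [h, hx])])
        have := (hsgn x).1 hx
        exact (zpow_le_zpow_iff_right₀ h).2 (by omega)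
  refine ne_top_of_le_ne_top (((summable_pow_natAbs hr0 hr1).mul_left
    ((I + 1) * (C * R))).tsum_ofReal_ne_top) (ENNReal.tsum_le_tsum fun x => ?_)
  have hp : -q ^ (-x * I + 1) < 0 := neg_lt_zero.2 (zpow_pos hq _)
  have habs : |-q ^ (-x * I + 1)| = q ^ (-x * I + 1) := by
    rw [abs_neg, abs_of_pos (zpow_pos hq _)]
  rw [show (I + 1 : ℝ) * (C * R) * r ^ x.natAbs = (I + 1) * (C * (R * r ^ x.natAbs)) by ring]
  refine toMeasure_compl_le _ _ (by positivity) fun n hn => ?_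
  have hb : background I q x = 0 ∨ background I q x = Fin.last I := by
    rw [background]; split_ifs <;> simp
  rcases hb with hb | hb
  · refine ((hCp _ hp n).1 (hb ▸ hn)).trans ?_
    rw [habs]
    exact mul_le_mul_of_nonneg_left ((hle x).1 hb) hC
  · refine ((hCp _ hp n).2 (hb ▸ hn)).trans ?_
    rw [habs]
    exact mul_le_mul_of_nonneg_left ((hle x).2 hb) hC

/-- Membership includes total mass one, so this is also where `μ_*(G_n) > 0` is established, through
one atom in the class. -/
lemma muBlock_mem_stepInvariant (hI : 1 ≤ I) {q α : ℝ} (h : Admissible I I q α) (n : ℤ) :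
    muBlock I h.pos h.ne_one n ∈ stepInvariant I q α := by
  classical
  obtain ⟨ε, hK⟩ := isVertexKernel_L h
  have hsum := tsum_starLaw_ne_top hI h.pos h.ne_one
  set c := if 1 < q then n else -n
  have e : (muBlock I h.pos h.ne_one n : Measure (Config I)) =
      (prodMeasure (starLaw I h.pos h.ne_one))[|excessClass (background I q) c] := by
    rw [← blockingClass_eq]; rfl
  obtain ⟨g, hg⟩ := excessClass_background_nonempty hI q c
  have hpos : prodMeasure (starLaw I h.pos h.ne_one) (excessClass (background I q) c) ≠ 0 :=
    ((prodMeasure_singleton_pos hsum (fun x i => qNB_ne_zero h.pos h.ne_one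
      (neg_lt_zero.2 (zpow_pos h.pos _)) i) hg.1).trans_le
        (measure_mono (Set.singleton_subset_iff.2 hg))).ne'
  refine ⟨?_, ?_⟩
  · rw [e]; exact cond_isProbabilityMeasure hpos
  · rw [e]; exact map_shift_evolve_cond hK hsum (propagates_starLaw h) c

end SHS6V

end

theorem mainTheorem4 (I : ℕ) (hI : 1 ≤ I) (q α : ℝ) (h : SHS6V.Admissible I I q α) :
    closure (convexHull ℝ≥0
        (Set.range (SHS6V.muRho I h.pos h.ne_one) ∪ Set.range (SHS6V.muBlock I h.pos h.ne_one))) ⊆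
      SHS6V.shiftedStationary I I q α := by
  obtain ⟨ε, hK⟩ := SHS6V.isVertexKernel_L h
  refine SHS6V.closure_convexHull_subset hK (Set.union_subset ?_ ?_)
  · rintro _ ⟨ρ, rfl⟩
    exact SHS6V.muRho_mem_stepInvariant h ρ
  · rintro _ ⟨n, rfl⟩
    exact SHS6V.muBlock_mem_stepInvariant hI h n
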